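/- **Setting.** A cluster has a random size $N$ with bounded support, a treatment $A\in\{0,1\}$, covariates $\mathbf C=(\mathbf X_1,\dots,\mathbf X_N,\mathbf V)$, mediators $\mathbf M=(M^k_j)_{k\in[K],\,j\in[N]}$ and real outcomes $Y_1,\dots,Y_N$; write $\mathcal O=(N,A,\mathbf C,\mathbf M,\mathbf Y)$. The outcomes have finite second moments given $N$, $A$ is independent of $(N,\mathbf C)$, and $\Pr(A=1)=\pi\in(0,1)$ is known. Given $(A,\mathbf C,N)$, $\mathbf M$ has density $f(\mathbf m\mid A,\mathbf C,N)$ with respect to a product of $\sigma$-finite measures (one per mediator) on a measurable support set $\mathcal M_N$; all integrals run over this support. For $U\subseteq[K]\times[N]$, $f(\mathbf m_U\mid a,\mathbf C,N)$ is the conditional density of the subvector $\mathbf M_U$, and $\eta_j(a,\mathbf m,\mathbf C,N)=E\{Y_j\mid A=a,\mathbf M=\mathbf m,\mathbf C,N\}$. Let $w=w(\mathbf V,N)$ be a known weight (for $w\equiv1$, or more generally $E w=1$, the functionals below are the usual weighted averages). For $a^*,a'\in\{0,1\}$ and a family $U=(U_j)_j$ of sets $U_j\subseteq[K]\times[N]$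 put $$\theta_{\mathrm I}(a^*,a')=E\Big\{\tfrac wN\sum_{j=1}^N\eta^*_j\Big\},\qquad \eta_j^*=\int\eta_j(a^*,\mathbf m,\mathbf C,N)f(\mathbf m\mid a',\mathbf C,N)\,d\mathbf m,$$ $$\theta_U=E\Big\{\tfrac wN\sum_{j=1}^N\lambda_j\Big\},\qquad \lambda_j=\int\eta_j(1,\mathbf m,\mathbf C,N)f(\mathbf m_{U_j}\mid0,\mathbf C,N)f(\mathbf m_{U_j^c}\mid1,\mathbf C,N)\,d\mathbf m .$$ For $J\subseteq[K]$ and $k\in[K]\setminus J$ let $\theta_{\mathrm{II}}(J)$ be $\theta_U$ with $U_j=J\times[N]$, and $\theta_{\mathrm{III}}(k,J)$ be $\theta_U$ with $U_j=((J\cup\{k\})\times[N])\setminus\{(k,j)\}$. With $\Gamma=(\eta,f)$ the collection of nuisance functions, the uncentered influence functions are, for $\theta_{\mathrm I}(a^*,a')$, $$\phi(\mathcal O;\Gamma)=\tfrac wN\sum_{j=1}^N\Big[\tfrac{\mathcal I(A=a^*)}{\Pr(A=a^*)}\tfrac{f(\mathbf M\mid a',\mathbf C,N)}{f(\mathbf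 M\mid a^*,\mathbf C,N)}\{Y_j-\eta_j(a^*,\mathbf M,\mathbf C,N)\}+\tfrac{\mathcal I(A=a')}{\Pr(A=a')}\{\eta_j(a^*,\mathbf M,\mathbf C,N)-\eta^*_j\}+\eta_j^*\Big],$$ and for $\theta_U$ $$\phi(\mathcal O;\Gamma)=\tfrac wN\sum_{j=1}^N\Big[\tfrac{\mathcal I(A=0)}{\Pr(A=0)}\!\int\!\eta_j(1,\cdot)f(\mathbf m_{U_j^c}\mid1,\mathbf C,N)\,d\mathbf m_{U_j^c}+\Big\{1-\sum_{a=0}^1\tfrac{\mathcal I(A=a)}{\Pr(A=a)}\Big\}\lambda_j$$ $$\qquad+\tfrac{\mathcal I(A=1)}{\Pr(A=1)}\Big(\tfrac{f(\mathbf M_{U_j}\mid0,\mathbf C,N)f(\mathbf M_{U_j^c}\mid1,\mathbf C,N)}{f(\mathbf M\mid1,\mathbf C,N)}\{Y_j-\eta_j(1,\mathbf M,\mathbf C,N)\}+\!\int\!\eta_j(1,\cdot)f(\mathbf m_{U_j}\mid0,\mathbf C,N)\,d\mathbf m_{U_j}\Big)\Big],$$ where in the two single-block integrals the mediators that are not integrated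 are at their observed values. Put $\varphi(\mathcal O;\theta)=\phi(\mathcal O;\Gamma)-\theta$. **Estimator.** From i.i.d. clusters $\mathcal O_1,\dots,\mathcal O_I$, partitioned into a fixed number $S$ of folds independently of the data, with $I_s$ clusters in fold $s$, let $\widehat\Gamma^s$ be nuisance estimates computed from the clusters outside fold $s$ (the estimates $\widehat\eta$, $\widehat f$ and those of the densities of subvectors may be fitted separately). The cross-fitted one-step estimator is $\widehat\theta=I^{-1}\sum_{s=1}^S I_s\,\mathbb P_s\{\phi(\mathcal O;\widehat\Gamma^s)\}$, where $\mathbb P_s$ and $\mathbb P_I$ are the empirical averages over fold $s$ and over all clusters. **Theorem.** Assume, for the nuisance functions that enter the functional $\theta$ under consideration: (i) $|w(\mathbf V,N)|$ is uniformly bounded; (ii) $f$ and $\widehat f$ are uniformly bounded away from zero on the support, and the estimates $\widehat\eta_j$, $\widehat f$ and of the subvector densities, as well as the true density $f(\mathbf m_{U_j^c}\mid1,\mathbf C,N)$, are uniformly bounded, with probability one; (iii) $E[\{Y_j-\eta_j(a,\mathbf M,\mathbf C,N)\}^2\mid A=a,\mathbf M,\mathbf C,N]$ is uniformly bounded; (iv)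 given $N$, each estimated nuisance function is consistent in probability for its target in the $L^2(\mathbb P)$ norm, in every fold. Then $\theta$ is well defined, $\varphi$ is integrable and $$\widehat\theta-\theta=(\mathbb P_I-E)\{\varphi(\mathcal O;\theta)\}+\mathrm{Rem}_\theta+o_{\mathbb P}(I^{-1/2}),$$ where $\mathrm{Rem}_\theta=O_{\mathbb P}\big(I^{-1}\sum_s I_s R_s\big)$ with $R_s$ given as follows in terms of $\widehat\Gamma=\widehat\Gamma^s$. Superscripts denote the treatment level, $\|\cdot\|_2$ is the $L^2(\mathbb P)$ norm in $(\mathbf M,\mathbf C,N)$, $d_2(\widehat g_j,g_j)=\|\max_j|\widehat g_j-g_j|\|_2$, and $\overline\eta=N^{-1}\sum_{j}\eta_j$: (i) for $\theta_{\mathrm I}(a^*,a')$: $R_s=\|\widehat{\overline\eta}{}^{a^*}-\overline\eta^{a^*}\|_2\{\|\widehat f^{a^*}-f^{a^*}\|_2+\|\widehat f^{a'}-f^{a'}\|_2\}$; (ii) for $\theta_{\mathrm{II}}(J)$, with $f_J,f_{[K]\setminus J}$ the densities of the mediators in $J$ and in $[K]\setminus J$: $R_s=d_2(\widehat\eta^1_j,\eta^1_j)\{\|\widehat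 f^1-f^1\|_2+\|\widehat f^1_{[K]\setminus J}-f^1_{[K]\setminus J}\|_2+\|\widehat f^0_J-f^0_J\|_2\}+\|\widehat f^1_{[K]\setminus J}-f^1_{[K]\setminus J}\|_2\|\widehat f^0_J-f^0_J\|_2$; (iii) for $\theta_{\mathrm{III}}(k,J)$, with $f_{-j}$ and $f_{j}$ the densities of $\mathbf M_{U_j}$ and $\mathbf M_{U_j^c}$: $R_s=d_2(\widehat\eta^1_j,\eta^1_j)\{\|\widehat f^1-f^1\|_2+d_2(\widehat f^1_{j},f^1_{j})+d_2(\widehat f^0_{-j},f^0_{-j})\}+d_2(\widehat f^1_{j},f^1_{j})\,d_2(\widehat f^0_{-j},f^0_{-j})$. -/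

import Mathlib

open MeasureTheory ProbabilityTheory Filter Topology
open scoped ENNReal NNReal

noncomputable section

namespace CRT

/-! ### Data of a cluster randomized trial -/

/-- Mediators of a cluster of size `n`: the coordinate `(k, j)` is the `k`-th mediator of the
`j`-th individual. -/
abbrev Med (K n : ℕ) : Type := Fin K × Fin n → ℝ

/-- Baseline covariates `C` of a cluster of size `n`: the individual-level covariates of its
members and the cluster-level covariates. -/
abbrev Cov (𝒳 𝒱 : Type*) (n : ℕ) : Type _ := (Fin n → 𝒳) × 𝒱

/-- Data `(A, C, M, Y)` of a cluster of size `n` (treatment, covariates, mediators, outcomes);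
the treated condition `A = 1` is `true`. -/
abbrev Dat (K : ℕ) (𝒳 𝒱 : Type*) (n : ℕ) : Type _ :=
  Bool × Cov 𝒳 𝒱 n × Med K n × (Fin n → ℝ)

/-- Observed data of a cluster, whose size `N` is random. -/
abbrev Obs (K : ℕ) (𝒳 𝒱 : Type*) : Type _ := Σ n : ℕ, Dat K 𝒳 𝒱 n

section Accessors

variable {K : ℕ} {𝒳 𝒱 : Type*} {n : ℕ}

/-- Treatment of a cluster of size `n`. -/
def trt (o : Dat K 𝒳 𝒱 n) : Bool := o.1

/-- Covariates of a cluster of size `n`. -/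
def cov (o : Dat K 𝒳 𝒱 n) : Cov 𝒳 𝒱 n := o.2.1

/-- Cluster-level covariates of a cluster of size `n`. -/
def clv (o : Dat K 𝒳 𝒱 n) : 𝒱 := o.2.1.2

/-- Mediators of a cluster of size `n`. -/
def med (o : Dat K 𝒳 𝒱 n) : Med K n := o.2.2.1

/-- Outcome of individual `j` in a cluster of size `n`. -/
def out (j : Fin n) (o : Dat K 𝒳 𝒱 n) : ℝ := o.2.2.2 j

end Accessors

/-- The known ingredients: for every mediator a reference measure on `ℝ` with respect to which
mediator densities are taken (for instance Lebesgue measure if it is continuous, counting measure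
on its values if it is discrete); the support of the mediator vector, for every cluster size; the
weight `w(V, N)`; the treatment probability `Pr(A = 1)`. -/
structure Design (K : ℕ) (𝒱 : Type*) where
  nu : Fin K → Measure ℝ
  supp : ∀ n : ℕ, Set (Med K n)
  w : 𝒱 → ℕ → ℝ
  pi : ℝ

/-- A collection of nuisance functions: `eta n j a c m` is an outcome mean of individual `j`,
`dens n a c m` a density of the whole mediator vector, and `sub n U a c u` a density of the
subvector of the mediators that is indexed by `U`, everything at cluster size `n`, treatment `a`
and covariates `c`. For estimated nuisance functions these components need not be related to one
another. -/
structure Nuis (K : ℕ) (𝒳 𝒱 : Type*) where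
  eta : ∀ n : ℕ, Fin n → Bool → Cov 𝒳 𝒱 n → Med K n → ℝ
  dens : ∀ n : ℕ, Bool → Cov 𝒳 𝒱 n → Med K n → ℝ
  sub : ∀ (n : ℕ) (U : Finset (Fin K × Fin n)), Bool → Cov 𝒳 𝒱 n → (U → ℝ) → ℝ

section Functionals

variable {K : ℕ} {𝒳 𝒱 : Type*}

/-- Reference measure for the subvector of the mediators that is indexed by `U`. -/
def refSub (D : Design K 𝒱) {n : ℕ} (U : Finset (Fin K × Fin n)) : Measure (U → ℝ) :=
  Measure.pi fun i : U => D.nu i.1.1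

/-- Reference measure for the whole mediator vector, restricted to its support. -/
def ref (D : Design K 𝒱) (n : ℕ) : Measure (Med K n) :=
  (Measure.pi fun i : Fin K × Fin n => D.nu i.1).restrict (D.supp n)

/-- `Pr(A = a)`. -/
def prob (D : Design K 𝒱) (a : Bool) : ℝ := if a then D.pi else 1 - D.pi

/-- `𝓘(A = a) / Pr(A = a)`. -/
def ipw (D : Design K 𝒱) (a A : Bool) : ℝ := if A = a then 1 / prob D a else 0

/-- The integrand of `lam1`: outcome mean under `a₁`, subvector `U` of the mediators drawn under
`a₂`, remaining mediators drawn independently under `a₃`. -/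
def lam1Kernel (G : Nuis K 𝒳 𝒱) {n : ℕ} (j : Fin n) (U : Finset (Fin K × Fin n))
    (a₁ a₂ a₃ : Bool) (c : Cov 𝒳 𝒱 n) (m : Med K n) : ℝ :=
  G.eta n j a₁ c m * G.sub n U a₂ c (U.restrict m) * G.sub n Uᶜ a₃ c (Uᶜ.restrict m)

/-- `∫ η_j(a₁, m, C, N) f(m_U | a₂, C, N) f(m_{Uᶜ} | a₃, C, N) dm`. -/
def lam1 (D : Design K 𝒱) (G : Nuis K 𝒳 𝒱) {n : ℕ} (j : Fin n) (U : Finset (Fin K × Fin n))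
    (a₁ a₂ a₃ : Bool) (c : Cov 𝒳 𝒱 n) : ℝ :=
  ∫ m, lam1Kernel G j U a₁ a₂ a₃ c m ∂(ref D n)

/-- `∫ η_j(1, m, C, N) f(m_U | a, C, N) dm_U`; it depends on `m` through `m_{Uᶜ}` only. -/
def lam2 (D : Design K 𝒱) (G : Nuis K 𝒳 𝒱) {n : ℕ} (j : Fin n) (U : Finset (Fin K × Fin n))
    (a : Bool) (c : Cov 𝒳 𝒱 n) (m : Med K n) : ℝ :=
  ∫ u in {u : U → ℝ | Function.updateFinset m U u ∈ D.supp n},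
    G.eta n j true c (Function.updateFinset m U u) * G.sub n U a c u ∂(refSub D U)

/-- `f(m_U | a₁, C, N) f(m_{Uᶜ} | a₂, C, N) / f(m | a₃, C, N)`. -/
def lam3 (G : Nuis K 𝒳 𝒱) {n : ℕ} (U : Finset (Fin K × Fin n))
    (a₁ a₂ a₃ : Bool) (c : Cov 𝒳 𝒱 n) (m : Med K n) : ℝ :=
  G.sub n U a₁ c (U.restrict m) * G.sub n Uᶜ a₂ c (Uᶜ.restrict m) / G.dens n a₃ c m

/-- The integrand `η_j(a*, m, C, N) f(m | a', C, N)`. -/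
def etaStarKernel (G : Nuis K 𝒳 𝒱) {n : ℕ} (j : Fin n) (aStar a' : Bool)
    (c : Cov 𝒳 𝒱 n) (m : Med K n) : ℝ :=
  G.eta n j aStar c m * G.dens n a' c m

/-- `∫ η_j(a*, m, C, N) f(m | a', C, N) dm`. -/
def etaStar (D : Design K 𝒱) (G : Nuis K 𝒳 𝒱) {n : ℕ} (j : Fin n) (aStar a' : Bool)
    (c : Cov 𝒳 𝒱 n) : ℝ :=
  ∫ m, etaStarKernel G j aStar a' c m ∂(ref D n)

/-- For every cluster size and every individual `j`, a set of mediator coordinates: the block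
that is drawn under control, its complement being drawn under treatment. -/
abbrev Split (K : ℕ) : Type := ∀ n : ℕ, Fin n → Finset (Fin K × Fin n)

/-- The block of all mediators in `J` of all individuals. -/
def blockII (J : Finset (Fin K)) (n : ℕ) : Finset (Fin K × Fin n) := J ×ˢ Finset.univ

/-- The split with the mediators in `J` of all individuals under control and the mediators outside
`J` under treatment. -/
def splitII (J : Finset (Fin K)) : Split K := fun n _ => blockII J n

/-- The split with the mediators in `J` of all individuals and the `k`-th mediator of all
individuals but `j` under control, and the `k`-th mediator of `j` and all the remaining mediators
under treatment. -/
def splitIII (k : Fin K) (J : Finset (Fin K)) : Split K :=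
  fun _ j => ((insert k J) ×ˢ Finset.univ).erase (k, j)

/-- Integrand (over clusters) of the functional `θ₁(a*, a', …, a')`. -/
def integrandI (D : Design K 𝒱) (G : Nuis K 𝒳 𝒱) (aStar a' : Bool) (o : Obs K 𝒳 𝒱) : ℝ :=
  D.w (clv o.2) o.1 / o.1 * ∑ j : Fin o.1, etaStar D G j aStar a' (cov o.2)

/-- Integrand (over clusters) of the functional with outcome under treatment and mediators split
according to `U`. -/
def integrandSplit (D : Design K 𝒱) (G : Nuis K 𝒳 𝒱) (U : Split K) (o : Obs K 𝒳 𝒱) : ℝ :=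
  D.w (clv o.2) o.1 / o.1 * ∑ j : Fin o.1, lam1 D G j (U o.1 j) true false true (cov o.2)

/-- Uncentered influence function for `θ₁(a*, a', …, a')`. -/
def phiI (D : Design K 𝒱) (G : Nuis K 𝒳 𝒱) (aStar a' : Bool) (o : Obs K 𝒳 𝒱) : ℝ :=
  D.w (clv o.2) o.1 / o.1 * ∑ j : Fin o.1,
    (ipw D aStar (trt o.2) *
        (G.dens o.1 a' (cov o.2) (med o.2) / G.dens o.1 aStar (cov o.2) (med o.2)) *
        (out j o.2 - G.eta o.1 j aStar (cov o.2) (med o.2))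
      + ipw D a' (trt o.2) *
        (G.eta o.1 j aStar (cov o.2) (med o.2) - etaStar D G j aStar a' (cov o.2))
      + etaStar D G j aStar a' (cov o.2))

/-- Uncentered influence function for the functional with outcome under treatment and mediators
split according to `U`. -/
def phiSplit (D : Design K 𝒱) (G : Nuis K 𝒳 𝒱) (U : Split K) (o : Obs K 𝒳 𝒱) : ℝ :=
  D.w (clv o.2) o.1 / o.1 * ∑ j : Fin o.1,
    (ipw D false (trt o.2) * lam2 D G j (U o.1 j)ᶜ true (cov o.2) (med o.2)
      + (1 - ∑ a : Bool, ipw D a (trt o.2)) *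
        lam1 D G j (U o.1 j) true false true (cov o.2)
      + ipw D true (trt o.2) *
        (lam3 G (U o.1 j) false true true (cov o.2) (med o.2) *
            (out j o.2 - G.eta o.1 j true (cov o.2) (med o.2))
          + lam2 D G j (U o.1 j) false (cov o.2) (med o.2)))

end Functionals

/-! ### The observed-data law and its nuisance functions -/

section Law

variable {K : ℕ} {𝒳 𝒱 : Type*} [MeasurableSpace 𝒳] [MeasurableSpace 𝒱]

/-- Conditional law of the data of a cluster given `N = n` (zero if `N = n` has probability
zero). -/
def condLaw (P : Measure (Obs K 𝒳 𝒱)) (n : ℕ) : Measure (Dat K 𝒳 𝒱 n) :=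
  (ProbabilityTheory.cond P {o | o.1 = n}).comap (Sigma.mk n)

/-- The σ-algebra generated by `(A, C, M)`. -/
abbrev sigmaACM (K : ℕ) (𝒳 𝒱 : Type*) [MeasurableSpace 𝒳] [MeasurableSpace 𝒱] (n : ℕ) :
    MeasurableSpace (Dat K 𝒳 𝒱 n) :=
  MeasurableSpace.comap (fun o => (trt o, cov o, med o)) inferInstance

/-- Standing assumptions on the design and on the law `P` of a cluster: bounded cluster sizes,
treatment randomized with known probability strictly between `0` and `1`, outcomes with finite
second moments. -/
structure Standing (D : Design K 𝒱) (P : Measure (Obs K 𝒳 𝒱)) : Prop where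
  sigmaFinite : ∀ k, SigmaFinite (D.nu k)
  measurable_supp : ∀ n, MeasurableSet (D.supp n)
  measurable_w : ∀ n, Measurable fun v => D.w v n
  bounded_size : ∃ Nmax : ℕ, ∀ᵐ o ∂P, o.1 ≤ Nmax
  pi_pos : 0 < D.pi
  pi_lt_one : D.pi < 1
  prob_treated : P.real {o | trt o.2 = true} = D.pi
  randomized : IndepFun (fun o : Obs K 𝒳 𝒱 => trt o.2)
    (fun o : Obs K 𝒳 𝒱 => (⟨o.1, cov o.2⟩ : Σ n : ℕ, Cov 𝒳 𝒱 n)) P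
  second_moment : ∀ (n : ℕ) (j : Fin n), MemLp (out j) 2 (condLaw P n)

/-- `G` consists of the nuisance functions of the law `P`: `dens` and `sub` are the conditional
densities of `M` and of its subvectors given `(A, C, N)`, and `eta` is the conditional mean of the
outcomes given `(A, M, C, N)`. -/
structure IsNuisOf (D : Design K 𝒱) (P : Measure (Obs K 𝒳 𝒱)) (G : Nuis K 𝒳 𝒱) : Prop where
  measurable_eta : ∀ (n : ℕ) (j : Fin n) (a : Bool),
    Measurable fun x : Cov 𝒳 𝒱 n × Med K n => G.eta n j a x.1 x.2
  measurable_dens : ∀ (n : ℕ) (a : Bool),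
    Measurable fun x : Cov 𝒳 𝒱 n × Med K n => G.dens n a x.1 x.2
  measurable_sub : ∀ (n : ℕ) (U : Finset (Fin K × Fin n)) (a : Bool),
    Measurable fun x : Cov 𝒳 𝒱 n × (U → ℝ) => G.sub n U a x.1 x.2
  dens_nonneg : ∀ n a c m, 0 ≤ G.dens n a c m
  sub_nonneg : ∀ n U a c u, 0 ≤ G.sub n U a c u
  dens_spec : ∀ (n : ℕ) (F : Bool × Cov 𝒳 𝒱 n × Med K n → ℝ≥0∞), Measurable F →
    ∫⁻ o, F (trt o, cov o, med o) ∂(condLaw P n) =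
      ∫⁻ o, (∫⁻ m, F (trt o, cov o, m) * ENNReal.ofReal (G.dens n (trt o) (cov o) m)
        ∂(ref D n)) ∂(condLaw P n)
  sub_spec : ∀ (n : ℕ) (U : Finset (Fin K × Fin n))
    (F : Bool × Cov 𝒳 𝒱 n × (U → ℝ) → ℝ≥0∞), Measurable F →
    ∫⁻ o, F (trt o, cov o, U.restrict (med o)) ∂(condLaw P n) =
      ∫⁻ o, (∫⁻ u, F (trt o, cov o, u) * ENNReal.ofReal (G.sub n U (trt o) (cov o) u)
        ∂(refSub D U)) ∂(condLaw P n)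
  eta_spec : ∀ (n : ℕ) (j : Fin n),
    (condLaw P n)[out j | sigmaACM K 𝒳 𝒱 n] =ᵐ[condLaw P n]
      fun o => G.eta n j (trt o) (cov o) (med o)

/-- The mediation functional `θ₁(a*, a', …, a')`:
`E{w(V, N) / N ∑_j ∫ η_j(a*, m, C, N) f(m | a', C, N) dm}`. -/
def thetaI (D : Design K 𝒱) (P : Measure (Obs K 𝒳 𝒱)) (G : Nuis K 𝒳 𝒱) (aStar a' : Bool) : ℝ :=
  ∫ o, integrandI D G aStar a' o ∂P

/-- The mediation functional with outcome under treatment and mediators split according to `U`: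
`E{w(V, N) / N ∑_j ∫ η_j(1, m, C, N) f(m_{U_j} | 0, C, N) f(m_{U_jᶜ} | 1, C, N) dm}`. -/
def thetaSplit (D : Design K 𝒱) (P : Measure (Obs K 𝒳 𝒱)) (G : Nuis K 𝒳 𝒱) (U : Split K) : ℝ :=
  ∫ o, integrandSplit D G U o ∂P

/-- The weight is uniformly bounded. -/
def WeightBdd (D : Design K 𝒱) (P : Measure (Obs K 𝒳 𝒱)) : Prop :=
  ∃ B : ℝ, ∀ᵐ o ∂P, |D.w (clv o.2) o.1| ≤ B

/-- The density of the mediators given `(A, C, N)` is uniformly bounded away from zero on the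
support, under treatment and under control. -/
def DensBddBelow (D : Design K 𝒱) (P : Measure (Obs K 𝒳 𝒱)) (G : Nuis K 𝒳 𝒱) : Prop :=
  ∃ b : ℝ, 0 < b ∧ ∀ (a : Bool) (n : ℕ), ∀ᵐ o ∂(condLaw P n), ∀ᵐ m ∂(ref D n),
    b ≤ G.dens n a (cov o) m

/-- The conditional variance of the outcomes given `(A, M, C, N)` is uniformly bounded. -/
def CondVarBdd (P : Measure (Obs K 𝒳 𝒱)) (G : Nuis K 𝒳 𝒱) : Prop :=
  ∃ B : ℝ, ∀ (n : ℕ) (j : Fin n),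
    (condLaw P n)[fun o => (out j o - G.eta n j (trt o) (cov o) (med o)) ^ 2 |
      sigmaACM K 𝒳 𝒱 n] ≤ᵐ[condLaw P n] fun _ => B

end Law

/-! ### Components of the nuisance functions and their errors

All components are functions of `(C, M)` and, possibly, of an individual `j`, the treatment being
held at a fixed level `a`. -/

section Components

variable {K : ℕ} {𝒳 𝒱 : Type*}

/-- A real function of `(N, C, M)`. -/
abbrev Comp (K : ℕ) (𝒳 𝒱 : Type*) : Type _ := ∀ n : ℕ, Cov 𝒳 𝒱 n → Med K n → ℝ

/-- A real function of `(N, C, M)` for every individual of the cluster. -/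
abbrev CompJ (K : ℕ) (𝒳 𝒱 : Type*) : Type _ := ∀ n : ℕ, Fin n → Cov 𝒳 𝒱 n → Med K n → ℝ

/-- `η_j(a, M, C, N)`. -/
def etaAt (a : Bool) (G : Nuis K 𝒳 𝒱) : CompJ K 𝒳 𝒱 := fun n j c m => G.eta n j a c m

/-- `N⁻¹ ∑_j η_j(a, M, C, N)`. -/
def etaBarAt (a : Bool) (G : Nuis K 𝒳 𝒱) : Comp K 𝒳 𝒱 :=
  fun n c m => (n : ℝ)⁻¹ * ∑ j : Fin n, G.eta n j a c m

/-- `f(M | a, C, N)`. -/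
def densAt (a : Bool) (G : Nuis K 𝒳 𝒱) : Comp K 𝒳 𝒱 := fun n c m => G.dens n a c m

/-- `f(M_U | a, C, N)` for a block `U` that does not depend on an individual. -/
def subAt (U : ∀ n : ℕ, Finset (Fin K × Fin n)) (a : Bool) (G : Nuis K 𝒳 𝒱) : Comp K 𝒳 𝒱 :=
  fun n c m => G.sub n (U n) a c ((U n).restrict m)

/-- `f(M_{U_j} | a, C, N)` for a block `U_j` that depends on the individual `j`. -/
def subAtJ (U : Split K) (a : Bool) (G : Nuis K 𝒳 𝒱) : CompJ K 𝒳 𝒱 :=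
  fun n j c m => G.sub n (U n j) a c ((U n j).restrict m)

/-- The complementary blocks. -/
def complII (J : Finset (Fin K)) (n : ℕ) : Finset (Fin K × Fin n) := (blockII J n)ᶜ

/-- The complementary split. -/
def complSplit (U : Split K) : Split K := fun n j => (U n j)ᶜ

variable [MeasurableSpace 𝒳] [MeasurableSpace 𝒱]

/-- `‖q - r‖₂`, the `L²(P)` norm (possibly `∞`). -/
def dist2 (P : Measure (Obs K 𝒳 𝒱)) (q r : Comp K 𝒳 𝒱) : ℝ≥0∞ :=
  eLpNorm (fun o : Obs K 𝒳 𝒱 =>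
    q o.1 (cov o.2) (med o.2) - r o.1 (cov o.2) (med o.2)) 2 P

/-- `d₂(q, r) = ‖max_j |q_j - r_j|‖₂`. -/
def d2 (P : Measure (Obs K 𝒳 𝒱)) (q r : CompJ K 𝒳 𝒱) : ℝ≥0∞ :=
  eLpNorm (fun o : Obs K 𝒳 𝒱 =>
    ⨆ j : Fin o.1, |q o.1 j (cov o.2) (med o.2) - r o.1 j (cov o.2) (med o.2)|) 2 P

/-- `L²` norm of `q - r` conditional on `N = n`. -/
def condDist2 (P : Measure (Obs K 𝒳 𝒱)) (n : ℕ) (q r : Cov 𝒳 𝒱 n → Med K n → ℝ) : ℝ≥0∞ :=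
  eLpNorm (fun o : Dat K 𝒳 𝒱 n => q (cov o) (med o) - r (cov o) (med o)) 2 (condLaw P n)

end Components

/-! ### Cross-fitting and stochastic orders -/

section CrossFitting

variable {K : ℕ} {𝒳 𝒱 : Type*} [MeasurableSpace 𝒳] [MeasurableSpace 𝒱]

/-- A cross-fitted nuisance estimator with `S` folds: given a partition `p` of the `I` clusters
into folds and the data, `fit I s p d` is computed from the clusters outside fold `s`. -/
structure Learner (K : ℕ) (𝒳 𝒱 : Type*) [MeasurableSpace 𝒳] [MeasurableSpace 𝒱] (S : ℕ) where
  fit : ∀ I : ℕ, Fin S → (Fin I → Fin S) → (Fin I → Obs K 𝒳 𝒱) → Nuis K 𝒳 𝒱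
  out_of_fold : ∀ (I : ℕ) (s : Fin S) (p : Fin I → Fin S) (d d' : Fin I → Obs K 𝒳 𝒱),
    (∀ i, p i ≠ s → d i = d' i) → fit I s p d = fit I s p d'
  measurable_eta : ∀ (I : ℕ) (s : Fin S) (p : Fin I → Fin S) (n : ℕ) (j : Fin n) (a : Bool),
    Measurable fun x : (Fin I → Obs K 𝒳 𝒱) × Cov 𝒳 𝒱 n × Med K n =>
      (fit I s p x.1).eta n j a x.2.1 x.2.2
  measurable_dens : ∀ (I : ℕ) (s : Fin S) (p : Fin I → Fin S) (n : ℕ) (a : Bool),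
    Measurable fun x : (Fin I → Obs K 𝒳 𝒱) × Cov 𝒳 𝒱 n × Med K n =>
      (fit I s p x.1).dens n a x.2.1 x.2.2
  measurable_sub : ∀ (I : ℕ) (s : Fin S) (p : Fin I → Fin S) (n : ℕ)
    (U : Finset (Fin K × Fin n)) (a : Bool),
    Measurable fun x : (Fin I → Obs K 𝒳 𝒱) × Cov 𝒳 𝒱 n × (U → ℝ) =>
      (fit I s p x.1).sub n U a x.2.1 x.2.2

/-- Random nuisance functions, one for every sample size and fold. -/
abbrev RandNuis (Ω : Type*) (K : ℕ) (𝒳 𝒱 : Type*) (S : ℕ) : Type _ :=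
  ℕ → Fin S → Ω → Nuis K 𝒳 𝒱

/-- The fitted nuisance functions. -/
def fitted {Ω : Type*} {S : ℕ} (L : Learner K 𝒳 𝒱 S) (fold : ∀ I : ℕ, Ω → Fin I → Fin S)
    (O : ℕ → Ω → Obs K 𝒳 𝒱) : RandNuis Ω K 𝒳 𝒱 S :=
  fun I s ω => L.fit I s (fold I ω) fun i => O i ω

/-- `I_s`, the number of clusters in fold `s`. -/
def foldSize {S I : ℕ} (p : Fin I → Fin S) (s : Fin S) : ℕ :=
  (Finset.univ.filter fun i => p i = s).card

/-- Averages over folds `I⁻¹ ∑_s I_s x_s`, real-valued. -/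
def foldAvg {S I : ℕ} (p : Fin I → Fin S) (x : Fin S → ℝ) : ℝ :=
  (I : ℝ)⁻¹ * ∑ s : Fin S, (foldSize p s : ℝ) * x s

/-- Averages over folds `I⁻¹ ∑_s I_s x_s`, with values in `[0, ∞]`. -/
def foldAvgE {S I : ℕ} (p : Fin I → Fin S) (x : Fin S → ℝ≥0∞) : ℝ≥0∞ :=
  (I : ℝ≥0∞)⁻¹ * ∑ s : Fin S, (foldSize p s : ℝ≥0∞) * x s

/-- The empirical average over fold `s` of `g`. -/
def foldMean {S I : ℕ} (p : Fin I → Fin S) (s : Fin S) (g : Obs K 𝒳 𝒱 → ℝ)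
    (d : Fin I → Obs K 𝒳 𝒱) : ℝ :=
  (foldSize p s : ℝ)⁻¹ * ∑ i ∈ Finset.univ.filter (fun i => p i = s), g (d i)

/-- The empirical average over the first `I` clusters. -/
def empMean {Ω : Type*} (O : ℕ → Ω → Obs K 𝒳 𝒱) (g : Obs K 𝒳 𝒱 → ℝ) (I : ℕ) (ω : Ω) : ℝ :=
  (I : ℝ)⁻¹ * ∑ i : Fin I, g (O i ω)

/-- The cross-fitted one-step estimator for the uncentered influence function `phi`. -/
def thetaHat {Ω : Type*} {S : ℕ} (fold : ∀ I : ℕ, Ω → Fin I → Fin S)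
    (O : ℕ → Ω → Obs K 𝒳 𝒱) (Gh : RandNuis Ω K 𝒳 𝒱 S)
    (phi : Nuis K 𝒳 𝒱 → Obs K 𝒳 𝒱 → ℝ) (I : ℕ) (ω : Ω) : ℝ :=
  foldAvg (fold I ω) fun s => foldMean (fold I ω) s (phi (Gh I s ω)) fun i => O i ω

/-- `R = O_P(X)`. -/
def IsBigOP {Ω : Type*} [MeasurableSpace Ω] (Pr : Measure Ω) (R : ℕ → Ω → ℝ)
    (X : ℕ → Ω → ℝ≥0∞) : Prop :=
  ∀ ε : ℝ≥0∞, 0 < ε → ∃ C : ℝ≥0, ∀ᶠ I in atTop,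
    Pr {ω | (C : ℝ≥0∞) * X I ω < ENNReal.ofReal |R I ω|} ≤ ε

/-- `X = o_P(1)`. -/
def IsLittleOP {Ω : Type*} [MeasurableSpace Ω] (Pr : Measure Ω) (X : ℕ → Ω → ℝ≥0∞) : Prop :=
  ∀ ε : ℝ≥0∞, 0 < ε → Tendsto (fun I => Pr {ω | ε ≤ X I ω}) atTop (𝓝 0)

/-- The component `q` of the random nuisance functions is bounded with probability one, by a
constant that depends neither on the sample size nor on the fold. -/
def UnifBdd {Ω : Type*} [MeasurableSpace Ω] {S : ℕ} (Pr : Measure Ω) (D : Design K 𝒱)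
    (P : Measure (Obs K 𝒳 𝒱)) (Gh : RandNuis Ω K 𝒳 𝒱 S) (q : Nuis K 𝒳 𝒱 → Comp K 𝒳 𝒱) : Prop :=
  ∃ B : ℝ, ∀ (I : ℕ) (s : Fin S), ∀ᵐ ω ∂Pr, ∀ n, ∀ᵐ o ∂(condLaw P n), ∀ᵐ m ∂(ref D n),
    |q (Gh I s ω) n (cov o) m| ≤ B

/-- The same for a component that is indexed by the individuals. -/
def UnifBddJ {Ω : Type*} [MeasurableSpace Ω] {S : ℕ} (Pr : Measure Ω) (D : Design K 𝒱)
    (P : Measure (Obs K 𝒳 𝒱)) (Gh : RandNuis Ω K 𝒳 𝒱 S) (q : Nuis K 𝒳 𝒱 → CompJ K 𝒳 𝒱) : Prop :=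
  ∃ B : ℝ, ∀ (I : ℕ) (s : Fin S), ∀ᵐ ω ∂Pr, ∀ (n : ℕ) (j : Fin n),
    ∀ᵐ o ∂(condLaw P n), ∀ᵐ m ∂(ref D n), |q (Gh I s ω) n j (cov o) m| ≤ B

/-- The component `q` of the random nuisance functions is bounded away from zero with probability
one, by a constant that depends neither on the sample size nor on the fold. -/
def UnifBddBelow {Ω : Type*} [MeasurableSpace Ω] {S : ℕ} (Pr : Measure Ω) (D : Design K 𝒱)
    (P : Measure (Obs K 𝒳 𝒱)) (Gh : RandNuis Ω K 𝒳 𝒱 S) (q : Nuis K 𝒳 𝒱 → Comp K 𝒳 𝒱) : Prop :=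
  ∃ b : ℝ, 0 < b ∧ ∀ (I : ℕ) (s : Fin S), ∀ᵐ ω ∂Pr, ∀ n, ∀ᵐ o ∂(condLaw P n),
    ∀ᵐ m ∂(ref D n), b ≤ q (Gh I s ω) n (cov o) m

/-- A component of the true nuisance functions is bounded. -/
def TrueBdd (D : Design K 𝒱) (P : Measure (Obs K 𝒳 𝒱)) (q : Comp K 𝒳 𝒱) : Prop :=
  ∃ B : ℝ, ∀ n, ∀ᵐ o ∂(condLaw P n), ∀ᵐ m ∂(ref D n), |q n (cov o) m| ≤ B

/-- The same for a component that is indexed by the individuals. -/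
def TrueBddJ (D : Design K 𝒱) (P : Measure (Obs K 𝒳 𝒱)) (q : CompJ K 𝒳 𝒱) : Prop :=
  ∃ B : ℝ, ∀ (n : ℕ) (j : Fin n), ∀ᵐ o ∂(condLaw P n), ∀ᵐ m ∂(ref D n),
    |q n j (cov o) m| ≤ B

/-- Conditionally on `N`, the component `q` is estimated consistently in `L²`. -/
def Consistent {Ω : Type*} [MeasurableSpace Ω] {S : ℕ} (Pr : Measure Ω)
    (P : Measure (Obs K 𝒳 𝒱)) (G : Nuis K 𝒳 𝒱) (Gh : RandNuis Ω K 𝒳 𝒱 S)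
    (q : Nuis K 𝒳 𝒱 → Comp K 𝒳 𝒱) : Prop :=
  ∀ (s : Fin S) (n : ℕ),
    IsLittleOP Pr fun I ω => condDist2 P n (q (Gh I s ω) n) (q G n)

/-- The same for a component that is indexed by the individuals. -/
def ConsistentJ {Ω : Type*} [MeasurableSpace Ω] {S : ℕ} (Pr : Measure Ω)
    (P : Measure (Obs K 𝒳 𝒱)) (G : Nuis K 𝒳 𝒱) (Gh : RandNuis Ω K 𝒳 𝒱 S)
    (q : Nuis K 𝒳 𝒱 → CompJ K 𝒳 𝒱) : Prop :=
  ∀ (s : Fin S) (n : ℕ) (j : Fin n),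
    IsLittleOP Pr fun I ω => condDist2 P n (q (Gh I s ω) n j) (q G n j)

/-- Asymptotic expansion of the estimator `est` of `θ` with influence function `infl`:
`est - θ = (ℙ_I - E) infl + Rem + o_P(I^{-1/2})` with `Rem = O_P(X)`. -/
def Expansion {Ω : Type*} [MeasurableSpace Ω] (Pr : Measure Ω) (P : Measure (Obs K 𝒳 𝒱))
    (O : ℕ → Ω → Obs K 𝒳 𝒱) (est : ℕ → Ω → ℝ) (θ : ℝ) (infl : Obs K 𝒳 𝒱 → ℝ)
    (X : ℕ → Ω → ℝ≥0∞) : Prop :=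
  Integrable infl P ∧ ∃ Rem Q : ℕ → Ω → ℝ,
    (∀ I ω, est I ω - θ = (empMean O infl I ω - ∫ o, infl o ∂P) + Rem I ω + Q I ω) ∧
    IsBigOP Pr Rem X ∧
    IsLittleOP Pr fun I ω => ENNReal.ofReal |Real.sqrt I * Q I ω|

end CrossFitting

end CRT

end

/-!
The estimation error of a cross-fitted one-step estimator splits into the empirical process of the
influence function, the empirical processes of the errors of the estimated influence functions, and
the averaged biases `E φ(O; Γ̂ˢ) - θ`. So two properties of an influence function suffice: its bias
is of second order in the errors of the nuisance functions, and it is continuous in them with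
respect to `L²`. All estimates are made given the cluster size; as this is bounded, the law of a
cluster is a finite mixture of its conditional laws (`law_eq_sum`).

*Randomization and positivity.* Weighting with `𝓘(A = a) / Pr(A = a)` gives the law `armLaw` of a
cluster under an enforced treatment. As the treatment is independent of the covariates, the pair
`(C, M)` then has density `f(· | a, C, N)` with respect to the product `refLaw` of the law of the
covariates and the reference measure on the support (`map_covMed_armLaw`). Since `f` is bounded
away from zero, `refLaw` is dominated by the observed law of `(C, M)` (`lintegral_refLaw_le`); in
particular it is finite, and `L²(ℙ)` errors control integrals over the support. Integrals over a
single block of mediators are bounded in `L²` as well, because the density of the complementary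
block bounds both the size of the section of the support and the mass that the section carries
(`lintegral_blockInt_sq_le`).

*Bias.* Under `armLaw`, every term of an influence function has a mean that is an integral with
respect to `refLaw`, since outcome residuals are orthogonal to functions of `(A, C, M)`. Collecting
terms, the bias for a split functional is the integral of
`(η - η̂) (û v̂ / f̂ · f - u v) - η̂ (û - u) (v̂ - v)`, with `u` and `v` the densities of `M_U` under
control and of the complementary block under treatment (`integral_psiSplit`). The factor of
`η - η̂` is linear in the errors of `f`, `u` and `v`, so Hölder's inequality yields the products of
norms in `R_s` (`bias_phiSplit_le`). When all mediators are under one arm, the second product is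
absent and the factor of `η_j - η̂_j` does not depend on `j`, which leaves the error of the averaged
regression functions (`integral_psiI`, `bias_phiI_le`). At `Γ̂ = Γ` the bias vanishes, so the
influence functions are centered.

*Consistency.* The terms of the influence functions are Lipschitz in `L²`; for the outcome
residuals this uses their bounded conditional variance (`eLpNorm_phiSplit_sub_le`,
`eLpNorm_phiI_sub_le`). The bounds that this requires for the true nuisance functions are inherited
from those for the estimates, as limits in probability of bounded functions are bounded
(`ae_abs_le_of_isLittleOP`).

*Cross-fitting.* Given the clusters outside a fold, the estimated influence function is fixed and
the clusters in the fold are independent copies of one another. Chebyshev's inequality on slices of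
the product space bounds its empirical process by its `L²` norm (`measure_fold_sum_ge_le`), so that
consistency makes the empirical processes of the errors negligible (`isLittleOP_fold_sum`).
`expansion_of_bias_of_consistency` combines these facts.
-/

noncomputable section

namespace CRT

/-! ### The law of a cluster and its conditional laws given the cluster size -/

lemma range_sigmaMk {K : ℕ} {𝒳 𝒱 : Type*} (n : ℕ) :
    Set.range (Sigma.mk n : Dat K 𝒳 𝒱 n → Obs K 𝒳 𝒱) = {o | o.1 = n} := by
  ext ⟨k, o⟩
  constructor
  · rintro ⟨o', h⟩
    exact (congrArg Sigma.fst h).symm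
  · rintro h
    obtain rfl : k = n := h
    exact ⟨o, rfl⟩

section Sizes

variable {K : ℕ} {𝒳 𝒱 : Type*} [MeasurableSpace 𝒳] [MeasurableSpace 𝒱] {n : ℕ}

@[fun_prop]
lemma measurable_trt : Measurable (trt : Dat K 𝒳 𝒱 n → Bool) := measurable_fst

@[fun_prop]
lemma measurable_cov : Measurable (cov : Dat K 𝒳 𝒱 n → Cov 𝒳 𝒱 n) :=
  measurable_fst.comp measurable_snd

@[fun_prop]
lemma measurable_med : Measurable (med : Dat K 𝒳 𝒱 n → Med K n) :=
  measurable_fst.comp (measurable_snd.comp measurable_snd)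

@[fun_prop]
lemma measurable_out (j : Fin n) : Measurable (out j : Dat K 𝒳 𝒱 n → ℝ) :=
  (measurable_pi_apply j).comp (measurable_snd.comp (measurable_snd.comp measurable_snd))

lemma measurableSet_sigma_iff {ι : Type*} {β : ι → Type*} [∀ i, MeasurableSpace (β i)]
    {s : Set (Σ i, β i)} : MeasurableSet s ↔ ∀ i, MeasurableSet (Sigma.mk i ⁻¹' s) := by
  change MeasurableSet[⨅ i, _] s ↔ _
  rw [MeasurableSpace.measurableSet_iInf]
  rfl

lemma measurable_sigma_iff {ι γ : Type*} {β : ι → Type*} [∀ i, MeasurableSpace (β i)]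
    [MeasurableSpace γ] {f : (Σ i, β i) → γ} :
    Measurable f ↔ ∀ i, Measurable fun b : β i => f ⟨i, b⟩ := by
  constructor
  · intro h i t ht
    exact measurableSet_sigma_iff.1 (h ht) i
  · intro h t ht
    exact measurableSet_sigma_iff.2 fun i => h i ht

lemma measurableEmbedding_sigmaMk {ι : Type*} {β : ι → Type*} [∀ i, MeasurableSpace (β i)]
    (i : ι) : MeasurableEmbedding (Sigma.mk i : β i → Σ i, β i) where
  injective := sigma_mk_injective
  measurable := measurable_sigma_iff.1 measurable_id i
  measurableSet_image' := by
    intro s hs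
    refine measurableSet_sigma_iff.2 fun k => ?_
    by_cases h : k = i
    · subst h
      rwa [Set.preimage_image_eq _ sigma_mk_injective]
    · convert MeasurableSet.empty
      ext b
      simp only [Set.mem_preimage, Set.mem_image, Set.mem_empty_iff_false, iff_false]
      rintro ⟨a, -, ha⟩
      exact h (congrArg Sigma.fst ha).symm

/-- Joint measurability of a function of a parameter and an element of a countable disjoint union
may be checked on the summands. -/
lemma measurable_prod_sigma {ι X γ : Type*} [Countable ι] {β : ι → Type*} [MeasurableSpace X]
    [∀ i, MeasurableSpace (β i)] [MeasurableSpace γ] {f : X × (Σ i, β i) → γ}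
    (h : ∀ i, Measurable fun y : X × β i => f (y.1, ⟨i, y.2⟩)) : Measurable f := by
  intro t ht
  have : f ⁻¹' t = ⋃ i, (Prod.map id (Sigma.mk i)) ''
      ((fun y : X × β i => f (y.1, ⟨i, y.2⟩)) ⁻¹' t) := by
    ext ⟨x, i, b⟩
    simp only [Set.mem_preimage, Set.mem_iUnion, Set.mem_image]
    constructor
    · intro hx
      exact ⟨i, (x, b), hx, rfl⟩
    · rintro ⟨i', ⟨x', b'⟩, hx, he⟩
      simp only [Prod.map_apply, id_eq, Prod.mk.injEq] at he
      obtain ⟨rfl, he⟩ := he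
      rw [← he]
      exact hx
  rw [this]
  exact MeasurableSet.iUnion fun i =>
    (MeasurableEmbedding.id.prodMap (measurableEmbedding_sigmaMk i)).measurableSet_image.2
      (h i ht)

lemma measurableSet_size (n : ℕ) : MeasurableSet {o : Obs K 𝒳 𝒱 | o.1 = n} := by
  refine measurableSet_sigma_iff.2 fun k => ?_
  by_cases h : k = n <;> simp [h]

variable (P : Measure (Obs K 𝒳 𝒱))

lemma map_condLaw (n : ℕ) :
    (condLaw P n).map (Sigma.mk n) = ProbabilityTheory.cond P {o | o.1 = n} := by
  rw [condLaw, (measurableEmbedding_sigmaMk n).map_comap, range_sigmaMk,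
    ProbabilityTheory.cond, Measure.restrict_smul,
    Measure.restrict_restrict (measurableSet_size n), Set.inter_self]

lemma condLaw_apply (n : ℕ) (s : Set (Dat K 𝒳 𝒱 n)) :
    condLaw P n s = (P {o | o.1 = n})⁻¹ * P (Sigma.mk n '' s) := by
  rw [condLaw, (measurableEmbedding_sigmaMk n).comap_apply,
    ProbabilityTheory.cond_apply (measurableSet_size n), Set.inter_eq_self_of_subset_right]
  rw [← range_sigmaMk]
  exact Set.image_subset_range _ _

lemma condLaw_eq_zero {n : ℕ} (hn : P {o | o.1 = n} = 0) : condLaw P n = 0 := by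
  rw [condLaw, ProbabilityTheory.cond, Measure.restrict_eq_zero.2 hn, smul_zero,
    Measure.comap_zero]

lemma isProbabilityMeasure_condLaw [IsFiniteMeasure P] {n : ℕ} (hn : P {o | o.1 = n} ≠ 0) :
    IsProbabilityMeasure (condLaw P n) := by
  constructor
  rw [condLaw_apply, Set.image_univ, range_sigmaMk, ENNReal.inv_mul_cancel hn (measure_ne_top _ _)]

instance isFiniteMeasure_condLaw [IsFiniteMeasure P] (n : ℕ) : IsFiniteMeasure (condLaw P n) := by
  by_cases hn : P {o | o.1 = n} = 0
  · rw [condLaw_eq_zero P hn]; infer_instance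
  · have := isProbabilityMeasure_condLaw P hn
    infer_instance

/-- The law of a cluster is a finite mixture of its conditional laws given the cluster size. -/
lemma law_eq_sum [IsFiniteMeasure P] {Nmax : ℕ} (h : ∀ᵐ o ∂P, o.1 ≤ Nmax) :
    P = ∑ n ∈ Finset.range (Nmax + 1), P {o | o.1 = n} • (condLaw P n).map (Sigma.mk n) := by
  ext s hs
  have h1 : ∀ n, (P {o | o.1 = n} • (condLaw P n).map (Sigma.mk n)) s
      = (P.restrict s) (Sigma.fst ⁻¹' {n}) := by
    intro n
    rw [map_condLaw, Measure.smul_apply, ProbabilityTheory.cond_apply (measurableSet_size n),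
      smul_eq_mul,
      show Sigma.fst ⁻¹' {n} = {o : Obs K 𝒳 𝒱 | o.1 = n} from rfl,
      Measure.restrict_apply (measurableSet_size n)]
    by_cases hn : P {o | o.1 = n} = 0
    · rw [hn, zero_mul]
      exact (measure_mono_null Set.inter_subset_left hn).symm
    · rw [← mul_assoc, ENNReal.mul_inv_cancel hn (measure_ne_top _ _), one_mul]
  rw [Measure.finsetSum_apply, Finset.sum_congr rfl fun n _ => h1 n,
    sum_measure_preimage_singleton]
  · rw [Measure.restrict_apply' hs]
    refine measure_congr ?_
    filter_upwards [h] with o ho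
    refine propext ⟨fun h => ⟨?_, h⟩, fun h => h.2⟩
    simpa [Nat.lt_succ_iff] using ho
  · exact fun n _ => measurableSet_size n

lemma ae_law_iff [IsFiniteMeasure P] {p : Obs K 𝒳 𝒱 → Prop}
    (hb : ∃ Nmax : ℕ, ∀ᵐ o ∂P, o.1 ≤ Nmax)
    (h : ∀ n, P {o | o.1 = n} ≠ 0 → ∀ᵐ o ∂(condLaw P n), p ⟨n, o⟩) : ∀ᵐ o ∂P, p o := by
  obtain ⟨Nmax, hN⟩ := hb
  rw [law_eq_sum P hN, ae_iff, Measure.finsetSum_apply, Finset.sum_eq_zero]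
  intro n _
  rw [Measure.smul_apply, smul_eq_mul]
  by_cases hn : P {o | o.1 = n} = 0
  · rw [hn, zero_mul]
  · rw [(measurableEmbedding_sigmaMk n).map_apply]
    have := h n hn
    rw [ae_iff] at this
    rw [mul_eq_zero]
    exact Or.inr this

lemma ae_condLaw [IsFiniteMeasure P] {p : Obs K 𝒳 𝒱 → Prop} (h : ∀ᵐ o ∂P, p o) (n : ℕ) :
    ∀ᵐ o ∂(condLaw P n), p ⟨n, o⟩ := by
  rw [ae_iff, condLaw_apply]
  rw [ae_iff] at h
  refine mul_eq_zero.2 (Or.inr (measure_mono_null ?_ h))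
  rintro _ ⟨o, ho, rfl⟩
  exact ho

lemma lintegral_law [IsFiniteMeasure P] {Nmax : ℕ} (h : ∀ᵐ o ∂P, o.1 ≤ Nmax)
    (F : Obs K 𝒳 𝒱 → ℝ≥0∞) :
    ∫⁻ o, F o ∂P = ∑ n ∈ Finset.range (Nmax + 1),
      P {o | o.1 = n} * ∫⁻ o, F ⟨n, o⟩ ∂(condLaw P n) := by
  conv_lhs => rw [law_eq_sum P h]
  rw [lintegral_finsetSum_measure]
  refine Finset.sum_congr rfl fun n _ => ?_
  rw [lintegral_smul_measure, (measurableEmbedding_sigmaMk n).lintegral_map, smul_eq_mul]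

lemma integrable_law [IsFiniteMeasure P] (hb : ∃ Nmax : ℕ, ∀ᵐ o ∂P, o.1 ≤ Nmax)
    {F : Obs K 𝒳 𝒱 → ℝ}
    (hF : ∀ n, P {o | o.1 = n} ≠ 0 → Integrable (fun o => F ⟨n, o⟩) (condLaw P n)) :
    Integrable F P := by
  obtain ⟨Nmax, h⟩ := hb
  rw [law_eq_sum P h, integrable_finsetSum_measure]
  intro n _
  by_cases hn : P {o | o.1 = n} = 0
  · rw [hn, zero_smul]
    exact integrable_zero_measure
  · refine Integrable.smul_measure ?_ (measure_ne_top _ _)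
    rw [(measurableEmbedding_sigmaMk n).integrable_map_iff]
    exact hF n hn

lemma integral_law [IsFiniteMeasure P] {Nmax : ℕ} (h : ∀ᵐ o ∂P, o.1 ≤ Nmax)
    {F : Obs K 𝒳 𝒱 → ℝ} (hF : Integrable F P) :
    ∫ o, F o ∂P = ∑ n ∈ Finset.range (Nmax + 1),
      P.real {o | o.1 = n} * ∫ o, F ⟨n, o⟩ ∂(condLaw P n) := by
  have hF' := hF
  rw [law_eq_sum P h, integrable_finsetSum_measure] at hF'
  conv_lhs => rw [law_eq_sum P h]
  rw [integral_finsetSum_measure hF']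
  refine Finset.sum_congr rfl fun n _ => ?_
  rw [integral_smul_measure, (measurableEmbedding_sigmaMk n).integral_map, smul_eq_mul]
  rfl

end Sizes

/-! ### Randomization and the reference law of covariates and mediators -/

section Reference

@[fun_prop]
lemma measurable_ipw {K : ℕ} {𝒱 : Type*} {D : Design K 𝒱} (a : Bool) :
    Measurable (ipw D a) := measurable_of_finite _

variable {K : ℕ} {𝒳 𝒱 : Type*} [MeasurableSpace 𝒳] [MeasurableSpace 𝒱] {n : ℕ}

/-- The pair `(C, M)` of covariates and mediators. -/
def covMed (o : Dat K 𝒳 𝒱 n) : Cov 𝒳 𝒱 n × Med K n := (cov o, med o)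

@[fun_prop]
lemma measurable_covMed : Measurable (covMed : Dat K 𝒳 𝒱 n → Cov 𝒳 𝒱 n × Med K n) :=
  measurable_cov.prodMk measurable_med

variable (D : Design K 𝒱) (P : Measure (Obs K 𝒳 𝒱))

/-- The law of the covariates given `N = n`. -/
def covLaw (n : ℕ) : Measure (Cov 𝒳 𝒱 n) := (condLaw P n).map cov

/-- The reference law of covariates and mediators given `N = n`: the covariates have their own
law, the mediators follow the reference measure on the support. -/
def refLaw (n : ℕ) : Measure (Cov 𝒳 𝒱 n × Med K n) := (covLaw P n).prod (ref D n)

/-- The law of a cluster of size `n` weighted with `𝓘(A = a) / Pr(A = a)`. As the treatment is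
randomized, this is the law in which treatment `a` is enforced. -/
def armLaw (a : Bool) (n : ℕ) : Measure (Dat K 𝒳 𝒱 n) :=
  (condLaw P n).withDensity fun o => ENNReal.ofReal (ipw D a (trt o))

variable {D P}

instance isFiniteMeasure_covLaw [IsFiniteMeasure P] : IsFiniteMeasure (covLaw P n) := by
  unfold covLaw; infer_instance

lemma sigmaFinite_refSub (hD : Standing D P) (U : Finset (Fin K × Fin n)) :
    SigmaFinite (refSub D U) := by
  have := hD.sigmaFinite
  unfold refSub; infer_instance

lemma sigmaFinite_ref (hD : Standing D P) : SigmaFinite (ref D n) := by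
  have := hD.sigmaFinite
  unfold ref; infer_instance

lemma prob_pos (hD : Standing D P) (a : Bool) : 0 < prob D a := by
  have := hD.pi_pos
  have := hD.pi_lt_one
  cases a <;> simp [prob] <;> linarith

lemma ipw_nonneg (hD : Standing D P) (a A : Bool) : 0 ≤ ipw D a A := by
  unfold ipw
  split_ifs
  · exact (one_div_pos.2 (prob_pos hD a)).le
  · exact le_rfl

lemma ipw_le (hD : Standing D P) (a A : Bool) : ipw D a A ≤ 1 / prob D a := by
  unfold ipw
  split_ifs
  · exact le_rfl
  · exact (one_div_pos.2 (prob_pos hD a)).le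

lemma measurable_weight (a : Bool) :
    Measurable fun o : Dat K 𝒳 𝒱 n => ENNReal.ofReal (ipw D a (trt o)) := by fun_prop

lemma measure_trt_eq [IsProbabilityMeasure P] (hD : Standing D P) (a : Bool) :
    P {o | trt o.2 = a} = ENNReal.ofReal (prob D a) := by
  have hm : MeasurableSet {o : Obs K 𝒳 𝒱 | trt o.2 = true} :=
    measurableSet_sigma_iff.2 fun i => measurable_trt (measurableSet_singleton true)
  have ht : P {o | trt o.2 = true} = ENNReal.ofReal D.pi := by
    rw [← hD.prob_treated, ofReal_measureReal]
  cases a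
  · have : {o : Obs K 𝒳 𝒱 | trt o.2 = false} = {o | trt o.2 = true}ᶜ := by
      ext o; simp
    rw [this, prob_compl_eq_one_sub hm, ht, prob, if_neg (by simp),
      ENNReal.ofReal_sub _ hD.pi_pos.le, ENNReal.ofReal_one]
  · simpa [prob] using ht

/-- Given the cluster size, treatment and covariates are independent. -/
lemma condLaw_trt_cov [IsProbabilityMeasure P] (hD : Standing D P) (a : Bool)
    {B : Set (Cov 𝒳 𝒱 n)} (hB : MeasurableSet B) :
    condLaw P n {o | trt o = a ∧ cov o ∈ B} =
      ENNReal.ofReal (prob D a) * condLaw P n {o | cov o ∈ B} := by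
  have hi := hD.randomized.measure_inter_preimage_eq_mul {a}
    (Sigma.mk n '' B) (measurableSet_singleton a)
    ((measurableEmbedding_sigmaMk n).measurableSet_image.2 hB)
  have h1 : (fun o : Obs K 𝒳 𝒱 => (⟨o.1, cov o.2⟩ : Σ n : ℕ, Cov 𝒳 𝒱 n)) ⁻¹' (Sigma.mk n '' B)
      = Sigma.mk n '' {o | cov o ∈ B} := by
    ext ⟨k, o⟩
    simp only [Set.mem_preimage, Set.mem_image, Sigma.mk.injEq, Set.mem_ofPred_eq]
    constructor
    · rintro ⟨c, hc, rfl, h⟩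
      exact ⟨o, (eq_of_heq h) ▸ hc, rfl, HEq.rfl⟩
    · rintro ⟨o', ho', rfl, h⟩
      obtain rfl := eq_of_heq h
      exact ⟨_, ho', rfl, HEq.rfl⟩
  have h2 : (fun o : Obs K 𝒳 𝒱 => trt o.2) ⁻¹' {a} ∩ Sigma.mk n '' {o | cov o ∈ B}
      = Sigma.mk n '' {o | trt o = a ∧ cov o ∈ B} := by
    ext ⟨k, o⟩
    simp only [Set.mem_inter_iff, Set.mem_preimage, Set.mem_singleton_iff, Set.mem_image,
      Sigma.mk.injEq, Set.mem_ofPred_eq]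
    constructor
    · rintro ⟨ha, o', ho', rfl, h⟩
      obtain rfl := eq_of_heq h
      exact ⟨_, ⟨ha, ho'⟩, rfl, HEq.rfl⟩
    · rintro ⟨o', ⟨ha, ho'⟩, rfl, h⟩
      obtain rfl := eq_of_heq h
      exact ⟨ha, _, ho', rfl, HEq.rfl⟩
  rw [h1, h2, show (fun o : Obs K 𝒳 𝒱 => trt o.2) ⁻¹' {a} = {o | trt o.2 = a} from rfl,
    measure_trt_eq hD] at hi
  rw [condLaw_apply, condLaw_apply, hi]
  ring

/-- Enforcing a treatment does not change the law of the covariates. -/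
lemma map_cov_armLaw [IsProbabilityMeasure P] (hD : Standing D P) (a : Bool) :
    (armLaw D P a n).map cov = covLaw P n := by
  ext B hB
  rw [Measure.map_apply measurable_cov hB, covLaw, Measure.map_apply measurable_cov hB, armLaw,
    withDensity_apply _ (measurable_cov hB)]
  have h1 : ∀ o : Dat K 𝒳 𝒱 n, ENNReal.ofReal (ipw D a (trt o)) =
      ({o : Dat K 𝒳 𝒱 n | trt o = a}.indicator
        (fun _ => ENNReal.ofReal (1 / prob D a))) o := by
    intro o
    by_cases h : trt o = a <;> simp [ipw, h]
  have hm : MeasurableSet {o : Dat K 𝒳 𝒱 n | trt o = a} :=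
    measurable_trt (measurableSet_singleton a)
  rw [lintegral_congr h1, lintegral_indicator hm, setLIntegral_const,
    Measure.restrict_apply hm]
  have := condLaw_trt_cov (n := n) hD a hB
  rw [show {o : Dat K 𝒳 𝒱 n | trt o = a} ∩ cov ⁻¹' B = {o | trt o = a ∧ cov o ∈ B} from rfl,
    this, ← mul_assoc, ← ENNReal.ofReal_mul (one_div_pos.2 (prob_pos hD a)).le,
    one_div_mul_cancel (prob_pos hD a).ne', ENNReal.ofReal_one, one_mul]
  rfl

lemma lintegral_armLaw (a : Bool) {F : Dat K 𝒳 𝒱 n → ℝ≥0∞} (hF : Measurable F) :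
    ∫⁻ o, F o ∂(armLaw D P a n) =
      ∫⁻ o, ENNReal.ofReal (ipw D a (trt o)) * F o ∂(condLaw P n) := by
  rw [armLaw, lintegral_withDensity_eq_lintegral_mul _ (measurable_weight a) hF]
  rfl

lemma integral_armLaw (hD : Standing D P) (a : Bool) (F : Dat K 𝒳 𝒱 n → ℝ) :
    ∫ o, F o ∂(armLaw D P a n) = ∫ o, ipw D a (trt o) * F o ∂(condLaw P n) := by
  rw [armLaw, integral_withDensity_eq_integral_toReal_smul (measurable_weight a)
    (ae_of_all _ fun _ => ENNReal.ofReal_lt_top)]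
  simp [ENNReal.toReal_ofReal (ipw_nonneg hD a _)]

/-- Under an enforced treatment `a`, the mediators have density `f(· | a, C, N)`. -/
lemma map_covMed_armLaw [IsProbabilityMeasure P] (hD : Standing D P) {G : Nuis K 𝒳 𝒱}
    (hG : IsNuisOf D P G) (a : Bool) :
    (armLaw D P a n).map covMed =
      (refLaw D P n).withDensity fun z => ENNReal.ofReal (G.dens n a z.1 z.2) := by
  have := sigmaFinite_ref (n := n) hD
  have hd : Measurable fun z : Cov 𝒳 𝒱 n × Med K n => ENNReal.ofReal (G.dens n a z.1 z.2) :=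
    (hG.measurable_dens n a).ennreal_ofReal
  refine Measure.ext_of_lintegral _ fun F hF => ?_
  rw [lintegral_map hF measurable_covMed,
    lintegral_armLaw a (F := fun o => F (covMed o)) (hF.comp measurable_covMed),
    lintegral_withDensity_eq_lintegral_mul _ hd hF, refLaw,
    lintegral_prod _ (hd.mul hF).aemeasurable, ← map_cov_armLaw hD a,
    lintegral_map (hd.mul hF).lintegral_prod_right' measurable_cov,
    lintegral_armLaw a (F := fun o => ∫⁻ _, _ ∂_)
      ((hd.mul hF).lintegral_prod_right'.comp measurable_cov)]
  have := hG.dens_spec n (fun x => ENNReal.ofReal (ipw D a x.1) * F x.2) (by fun_prop)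
  refine this.trans (lintegral_congr fun o => ?_)
  by_cases h : trt o = a
  · rw [← lintegral_const_mul]
    · refine lintegral_congr fun m => ?_
      simp only [Pi.mul_apply, h]
      ring
    · exact (hd.mul hF).comp measurable_prodMk_left
  · simp [ipw, h]

/-- Under an enforced treatment `a`, the subvector `M_U` has density `f(m_U | a, C, N)`. -/
lemma map_cov_restrict_armLaw [IsProbabilityMeasure P] (hD : Standing D P) {G : Nuis K 𝒳 𝒱}
    (hG : IsNuisOf D P G) (U : Finset (Fin K × Fin n)) (a : Bool) :
    (armLaw D P a n).map (fun o => (cov o, U.restrict (med o))) =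
      ((covLaw P n).prod (refSub D U)).withDensity
        fun z => ENNReal.ofReal (G.sub n U a z.1 z.2) := by
  have := sigmaFinite_refSub hD U
  have hd : Measurable fun z : Cov 𝒳 𝒱 n × (U → ℝ) => ENNReal.ofReal (G.sub n U a z.1 z.2) :=
    (hG.measurable_sub n U a).ennreal_ofReal
  have hr : Measurable fun o : Dat K 𝒳 𝒱 n => (cov o, U.restrict (med o)) :=
    measurable_cov.prodMk ((Finset.measurable_restrict U).comp measurable_med)
  refine Measure.ext_of_lintegral _ fun F hF => ?_
  rw [lintegral_map hF hr,
    lintegral_armLaw a (F := fun o => F (cov o, U.restrict (med o))) (hF.comp hr),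
    lintegral_withDensity_eq_lintegral_mul _ hd hF,
    lintegral_prod _ (hd.mul hF).aemeasurable, ← map_cov_armLaw hD a,
    lintegral_map (hd.mul hF).lintegral_prod_right' measurable_cov,
    lintegral_armLaw a (F := fun o => ∫⁻ _, _ ∂_)
      ((hd.mul hF).lintegral_prod_right'.comp measurable_cov)]
  have := hG.sub_spec n U (fun x => ENNReal.ofReal (ipw D a x.1) * F x.2) (by fun_prop)
  refine this.trans (lintegral_congr fun o => ?_)
  by_cases h : trt o = a
  · rw [← lintegral_const_mul]
    · refine lintegral_congr fun m => ?_
      simp only [Pi.mul_apply, h]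
      ring
    · exact (hd.mul hF).comp measurable_prodMk_left
  · simp [ipw, h]

lemma ae_refLaw_iff (hD : Standing D P) {p : Cov 𝒳 𝒱 n × Med K n → Prop}
    (hp : MeasurableSet {z | p z}) :
    (∀ᵐ z ∂(refLaw D P n), p z) ↔ ∀ᵐ o ∂(condLaw P n), ∀ᵐ m ∂(ref D n), p (cov o, m) := by
  have := sigmaFinite_ref (n := n) hD
  have hm : MeasurableSet {c : Cov 𝒳 𝒱 n | ∀ᵐ m ∂(ref D n), p (c, m)} := by
    have : {c : Cov 𝒳 𝒱 n | ∀ᵐ m ∂(ref D n), p (c, m)}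
        = (fun c => ref D n (Prod.mk c ⁻¹' {z | p z}ᶜ)) ⁻¹' {0} := by
      ext c
      simp only [Set.mem_ofPred_eq, ae_iff, Set.mem_preimage, Set.mem_singleton_iff]
      rfl
    rw [this]
    exact measurable_measure_prodMk_left hp.compl (measurableSet_singleton 0)
  rw [refLaw, Measure.ae_prod_iff_ae_ae hp, covLaw, ae_map_iff measurable_cov.aemeasurable hm]

end Reference

/-! ### Positivity: comparison of the law of covariates and mediators with the reference law -/

section Positivity

variable {K : ℕ} {𝒳 𝒱 : Type*} [MeasurableSpace 𝒳] [MeasurableSpace 𝒱] {n : ℕ}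
variable {D : Design K 𝒱} {P : Measure (Obs K 𝒳 𝒱)} {G : Nuis K 𝒳 𝒱}

/-- `b` is a lower bound of the mediator densities on the support. -/
def IsDensLB (D : Design K 𝒱) (P : Measure (Obs K 𝒳 𝒱)) (G : Nuis K 𝒳 𝒱) (b : ℝ) : Prop :=
  0 < b ∧ ∀ (a : Bool) (n : ℕ), ∀ᵐ o ∂(condLaw P n), ∀ᵐ m ∂(ref D n),
    b ≤ G.dens n a (cov o) m

/-- The constant by which the law of covariates and mediators dominates the reference law. -/
def refConst (D : Design K 𝒱) (b : ℝ) : ℝ≥0 := Real.toNNReal (1 / prob D true * b⁻¹)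

lemma IsDensLB.ae_le (hD : Standing D P) (hG : IsNuisOf D P G) {b : ℝ} (hb : IsDensLB D P G b)
    (a : Bool) : ∀ᵐ z ∂(refLaw D P n), b ≤ G.dens n a z.1 z.2 :=
  (ae_refLaw_iff hD (measurableSet_le measurable_const (hG.measurable_dens n a))).2 (hb.2 a n)

lemma lintegral_armLaw_le (hD : Standing D P) (a : Bool) {F : Dat K 𝒳 𝒱 n → ℝ≥0∞}
    (hF : Measurable F) :
    ∫⁻ o, F o ∂(armLaw D P a n) ≤
      ENNReal.ofReal (1 / prob D a) * ∫⁻ o, F o ∂(condLaw P n) := by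
  rw [lintegral_armLaw a hF, ← lintegral_const_mul _ hF]
  gcongr with o
  exact ipw_le hD a _

/-- Positivity: where the mediator densities exceed `b`, the law of covariates and mediators under
an enforced treatment dominates `b` times the reference law. -/
lemma lintegral_refLaw_le_armLaw [IsProbabilityMeasure P] (hD : Standing D P)
    (hG : IsNuisOf D P G) {b : ℝ} (hb : IsDensLB D P G b) (a : Bool)
    {F : Cov 𝒳 𝒱 n × Med K n → ℝ≥0∞} (hF : Measurable F) :
    ENNReal.ofReal b * ∫⁻ z, F z ∂(refLaw D P n) ≤ ∫⁻ o, F (covMed o) ∂(armLaw D P a n) := by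
  have hd : Measurable fun z : Cov 𝒳 𝒱 n × Med K n => ENNReal.ofReal (G.dens n a z.1 z.2) :=
    (hG.measurable_dens n a).ennreal_ofReal
  rw [← lintegral_map hF measurable_covMed, map_covMed_armLaw hD hG,
    lintegral_withDensity_eq_lintegral_mul _ hd hF, ← lintegral_const_mul _ hF]
  refine lintegral_mono_ae ?_
  filter_upwards [hb.ae_le hD hG a] with z hz
  exact mul_le_mul_left (ENNReal.ofReal_le_ofReal hz) _

/-- The observed law of covariates and mediators dominates the reference law up to a constant, so
`L²` errors with respect to the former control those with respect to the latter. -/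
lemma lintegral_refLaw_le [IsProbabilityMeasure P] (hD : Standing D P)
    (hG : IsNuisOf D P G) {b : ℝ} (hb : IsDensLB D P G b)
    {F : Cov 𝒳 𝒱 n × Med K n → ℝ≥0∞} (hF : Measurable F) :
    ∫⁻ z, F z ∂(refLaw D P n) ≤ refConst D b * ∫⁻ o, F (covMed o) ∂(condLaw P n) := by
  have h1 := (lintegral_refLaw_le_armLaw hD hG hb true hF).trans
    (lintegral_armLaw_le hD true (hF.comp measurable_covMed))
  have hb0 : ENNReal.ofReal b ≠ 0 := by simpa using hb.1
  calc ∫⁻ z, F z ∂(refLaw D P n)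
      = (ENNReal.ofReal b)⁻¹ * (ENNReal.ofReal b * ∫⁻ z, F z ∂(refLaw D P n)) := by
        rw [← mul_assoc, ENNReal.inv_mul_cancel hb0 ENNReal.ofReal_ne_top, one_mul]
    _ ≤ (ENNReal.ofReal b)⁻¹ * (ENNReal.ofReal (1 / prob D true) *
          ∫⁻ o, F (covMed o) ∂(condLaw P n)) := mul_le_mul_right h1 _
    _ = refConst D b * ∫⁻ o, F (covMed o) ∂(condLaw P n) := by
        rw [← mul_assoc, mul_comm (ENNReal.ofReal b)⁻¹, ← ENNReal.ofReal_inv_of_pos hb.1,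
          ← ENNReal.ofReal_mul (one_div_pos.2 (prob_pos hD true)).le]
        rfl

lemma isFiniteMeasure_refLaw [IsProbabilityMeasure P] (hD : Standing D P)
    (hG : IsNuisOf D P G) {b : ℝ} (hb : IsDensLB D P G b) :
    IsFiniteMeasure (refLaw D P n) := by
  constructor
  have := lintegral_refLaw_le (n := n) hD hG hb (F := fun _ => 1) measurable_const
  rw [lintegral_one, lintegral_one] at this
  exact this.trans_lt (ENNReal.mul_lt_top ENNReal.coe_lt_top (measure_lt_top _ _))

lemma ref_univ_le [IsProbabilityMeasure P] (hD : Standing D P)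
    (hG : IsNuisOf D P G) {b : ℝ} (hb : IsDensLB D P G b) (hn : P {o | o.1 = n} ≠ 0) :
    ref D n Set.univ ≤ refConst D b := by
  have := sigmaFinite_ref (n := n) hD
  have := isProbabilityMeasure_condLaw P hn
  have h1 := lintegral_refLaw_le (n := n) hD hG hb (F := fun _ => 1) measurable_const
  rw [lintegral_one, lintegral_one, measure_univ (μ := condLaw P n), mul_one, refLaw,
    ← Set.univ_prod_univ,
    Measure.prod_prod, covLaw, Measure.map_apply measurable_cov MeasurableSet.univ,
    Set.preimage_univ, measure_univ, one_mul] at h1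
  exact h1

/-- What holds almost everywhere on the support holds almost surely for the observed mediators. -/
lemma ae_covMed [IsProbabilityMeasure P] (hD : Standing D P)
    (hG : IsNuisOf D P G) {p : Cov 𝒳 𝒱 n × Med K n → Prop} (h : ∀ᵐ z ∂(refLaw D P n), p z) :
    ∀ᵐ o ∂(condLaw P n), p (covMed o) := by
  set s := toMeasurable (refLaw D P n) {z | ¬ p z}
  have hs : MeasurableSet s := measurableSet_toMeasurable _ _
  have h0 : ∀ᵐ z ∂(refLaw D P n), z ∉ s := by
    rw [ae_iff]
    rw [show {z | ¬ z ∉ s} = s by ext; simp, measure_toMeasurable]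
    exact ae_iff.1 h
  have h1 := (ae_refLaw_iff hD hs.compl).1 h0
  have hF : Measurable fun x : Bool × Cov 𝒳 𝒱 n × Med K n =>
      s.indicator (1 : Cov 𝒳 𝒱 n × Med K n → ℝ≥0∞) x.2 :=
    (measurable_one.indicator hs).comp measurable_snd
  have h2 := hG.dens_spec n _ hF
  have h3 : ∫⁻ o, s.indicator (1 : Cov 𝒳 𝒱 n × Med K n → ℝ≥0∞) (covMed o) ∂(condLaw P n) = 0 := by
    refine h2.trans ((lintegral_congr_ae ?_).trans lintegral_zero)
    filter_upwards [h1] with o ho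
    refine (lintegral_congr_ae ?_).trans lintegral_zero
    filter_upwards [ho] with m hm
    simp [hm]
  replace h3 := (lintegral_eq_zero_iff
    ((measurable_one.indicator hs).comp measurable_covMed)).1 h3
  filter_upwards [h3] with o ho
  by_contra hc
  have : covMed o ∈ s := subset_toMeasurable _ _ hc
  simp [this] at ho

lemma ae_refLaw_of_ae_covMed [IsProbabilityMeasure P] (hD : Standing D P)
    (hG : IsNuisOf D P G) {b : ℝ} (hb : IsDensLB D P G b)
    {p : Cov 𝒳 𝒱 n × Med K n → Prop} (hp : MeasurableSet {z | p z})
    (h : ∀ᵐ o ∂(condLaw P n), p (covMed o)) : ∀ᵐ z ∂(refLaw D P n), p z := by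
  have h1 := lintegral_refLaw_le (n := n) hD hG hb
    (measurable_one.indicator hp.compl :
      Measurable (Set.indicator {z | p z}ᶜ (1 : Cov 𝒳 𝒱 n × Med K n → ℝ≥0∞)))
  rw [lintegral_indicator_one hp.compl] at h1
  rw [ae_iff]
  refine le_antisymm (h1.trans (le_of_eq ?_)) (zero_le)
  rw [mul_eq_zero]
  right
  refine (lintegral_congr_ae ?_).trans lintegral_zero
  filter_upwards [h] with o ho
  exact Set.indicator_of_notMem (by simpa using ho) _

end Positivity

/-! ### Integration over a block of mediators -/

section Blocks

variable {K : ℕ} {𝒳 𝒱 : Type*} [MeasurableSpace 𝒳] [MeasurableSpace 𝒱] {n : ℕ}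

/-- The covariates and the mediator vector that is composed of its subvectors on `Vᶜ` and
on `V`. The innermost vector `0` only serves as a start for `Function.updateFinset`: all of its
coordinates are overwritten. -/
def glue (V : Finset (Fin K × Fin n)) (x : (Cov 𝒳 𝒱 n × (↥Vᶜ → ℝ)) × (V → ℝ)) :
    Cov 𝒳 𝒱 n × Med K n :=
  (x.1.1, Function.updateFinset (Function.updateFinset (0 : Med K n) Vᶜ x.1.2) V x.2)

lemma measurable_glue (V : Finset (Fin K × Fin n)) :
    Measurable (glue V : (Cov 𝒳 𝒱 n × (↥Vᶜ → ℝ)) × (V → ℝ) → Cov 𝒳 𝒱 n × Med K n) := by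
  refine (measurable_fst.comp measurable_fst).prodMk ?_
  refine measurable_updateFinset'.comp (Measurable.prodMk ?_ measurable_snd)
  exact measurable_updateFinset.comp (measurable_snd.comp measurable_fst)

lemma updateFinset_glue {K n : ℕ} (V : Finset (Fin K × Fin n)) (m : Med K n) (u : V → ℝ) :
    Function.updateFinset (Function.updateFinset (0 : Med K n) Vᶜ (Vᶜ.restrict m)) V u
      = Function.updateFinset m V u := by
  ext i
  by_cases h : i ∈ V <;> simp [Function.updateFinset, h, Finset.restrict]

lemma restrict_updateFinset {K n : ℕ} (V : Finset (Fin K × Fin n)) (m : Med K n) (u : V → ℝ) :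
    V.restrict (Function.updateFinset m V u) = u := by
  ext i
  simp [Function.updateFinset, Finset.restrict]

lemma restrict_compl_glue {K n : ℕ} {𝒳 𝒱 : Type*} (V : Finset (Fin K × Fin n))
    (x : (Cov 𝒳 𝒱 n × (↥Vᶜ → ℝ)) × (V → ℝ)) :
    Vᶜ.restrict (glue V x).2 = x.1.2 := by
  ext ⟨i, hi⟩
  have : i ∉ V := by simpa using hi
  simp [glue, Function.updateFinset, Finset.restrict, this]

variable {D : Design K 𝒱} {P : Measure (Obs K 𝒳 𝒱)} {G : Nuis K 𝒳 𝒱}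

/-- Up to the order of the coordinates, the product of the mediator measures is the product over
`Vᶜ` times the product over `V`. -/
lemma measurePreserving_glue [IsProbabilityMeasure P] (hD : Standing D P)
    (V : Finset (Fin K × Fin n)) :
    MeasurePreserving (glue V) (((covLaw P n).prod (refSub D Vᶜ)).prod (refSub D V))
      ((covLaw P n).prod (Measure.pi fun i : Fin K × Fin n => D.nu i.1)) := by
  have := hD.sigmaFinite
  have := sigmaFinite_refSub hD V
  have := sigmaFinite_refSub hD Vᶜ
  refine ⟨measurable_glue V, Measure.ext_of_lintegral _ fun F hF => ?_⟩
  have h1 := hF.comp (measurable_glue (𝒳 := 𝒳) (𝒱 := 𝒱) V)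
  rw [lintegral_map hF (measurable_glue V)]
  change ∫⁻ x, (F ∘ glue V) x ∂_ = _
  rw [lintegral_prod _ h1.aemeasurable, lintegral_prod _ h1.lintegral_prod_right'.aemeasurable,
    lintegral_prod _ hF.aemeasurable]
  refine lintegral_congr fun c => ?_
  have hc : Measurable fun m => F (c, m) := hF.comp measurable_prodMk_left
  rw [lintegral_eq_lmarginal_univ (0 : Med K n), ← Finset.union_compl V, Finset.union_comm,
    lmarginal_union _ _ hc disjoint_compl_left]
  rfl

/-- The set of values of the subvector on `V` that are compatible with the support. -/
def suppSection (D : Design K 𝒱) (V : Finset (Fin K × Fin n)) (y : Cov 𝒳 𝒱 n × (↥Vᶜ → ℝ)) :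
    Set (V → ℝ) :=
  {u | (glue V (y, u)).2 ∈ D.supp n}

lemma refLaw_eq_restrict [IsProbabilityMeasure P] (hD : Standing D P) :
    refLaw D P n = ((covLaw P n).prod (Measure.pi fun i : Fin K × Fin n => D.nu i.1)).restrict
      {z | z.2 ∈ D.supp n} := by
  have := hD.sigmaFinite
  have h : {z : Cov 𝒳 𝒱 n × Med K n | z.2 ∈ D.supp n} = Set.univ ×ˢ D.supp n := by
    ext; simp
  rw [h, ← Measure.prod_restrict, Measure.restrict_univ]
  rfl

lemma measurableSet_supp_snd (hD : Standing D P) :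
    MeasurableSet {z : Cov 𝒳 𝒱 n × Med K n | z.2 ∈ D.supp n} :=
  measurable_snd (hD.measurable_supp n)

lemma measurableSet_suppSection (hD : Standing D P) (V : Finset (Fin K × Fin n))
    (y : Cov 𝒳 𝒱 n × (↥Vᶜ → ℝ)) : MeasurableSet (suppSection D V y) :=
  (measurable_glue V).comp measurable_prodMk_left (measurableSet_supp_snd hD)

lemma lintegral_refLaw_eq [IsProbabilityMeasure P] (hD : Standing D P)
    (V : Finset (Fin K × Fin n)) {F : Cov 𝒳 𝒱 n × Med K n → ℝ≥0∞} (hF : Measurable F) :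
    ∫⁻ z, F z ∂(refLaw D P n) = ∫⁻ y, ∫⁻ u in suppSection D V y, F (glue V (y, u)) ∂(refSub D V)
      ∂((covLaw P n).prod (refSub D Vᶜ)) := by
  have := sigmaFinite_refSub hD V
  have hS := measurableSet_supp_snd (n := n) hD
  have hm := (hF.indicator hS).comp (measurable_glue V)
  rw [refLaw_eq_restrict hD, ← lintegral_indicator hS,
    ← (measurePreserving_glue hD V).lintegral_comp (hF.indicator hS)]
  change ∫⁻ x, (Set.indicator _ F ∘ glue V) x ∂_ = _
  rw [lintegral_prod _ hm.aemeasurable]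
  refine lintegral_congr fun y => ?_
  rw [← lintegral_indicator (measurableSet_suppSection hD V y)]
  rfl

lemma integral_refLaw_eq [IsProbabilityMeasure P] (hD : Standing D P)
    (V : Finset (Fin K × Fin n)) {F : Cov 𝒳 𝒱 n × Med K n → ℝ} (hF : Measurable F)
    (hi : Integrable F (refLaw D P n)) :
    ∫ z, F z ∂(refLaw D P n) = ∫ y, ∫ u in suppSection D V y, F (glue V (y, u)) ∂(refSub D V)
      ∂((covLaw P n).prod (refSub D Vᶜ)) := by
  have := sigmaFinite_refSub hD V
  have := sigmaFinite_refSub hD Vᶜ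
  have hS := measurableSet_supp_snd (n := n) hD
  have hmp := measurePreserving_glue (P := P) hD V
  have hind := hF.indicator hS
  rw [refLaw_eq_restrict hD] at hi ⊢
  replace hi := (integrable_indicator_iff hS).2 hi
  rw [← integral_indicator hS, ← hmp.map_eq,
    integral_map hmp.measurable.aemeasurable hind.aestronglyMeasurable, integral_prod]
  · refine integral_congr_ae (ae_of_all _ fun y => ?_)
    dsimp only
    rw [← integral_indicator (measurableSet_suppSection hD V y)]
    rfl
  · exact (hmp.integrable_comp hind.aestronglyMeasurable).2 hi

/-- The density of `M_{Vᶜ}` bounds the size of the sections of the support. -/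
lemma refSub_suppSection_le [IsProbabilityMeasure P] (hD : Standing D P)
    (hG : IsNuisOf D P G) {b : ℝ} (hb : IsDensLB D P G b) (V : Finset (Fin K × Fin n))
    (a : Bool) : ∀ᵐ y ∂((covLaw P n).prod (refSub D Vᶜ)),
      ENNReal.ofReal b * refSub D V (suppSection D V y) ≤
        ENNReal.ofReal (G.sub n Vᶜ a y.1 y.2) := by
  have := sigmaFinite_refSub hD V
  have := sigmaFinite_refSub hD Vᶜ
  have hS := measurableSet_supp_snd (n := n) hD
  have hms : Measurable fun y : Cov 𝒳 𝒱 n × (↥Vᶜ → ℝ) => refSub D V (suppSection D V y) :=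
    measurable_measure_prodMk_left (measurable_glue V hS)
  have hsub : Measurable fun y : Cov 𝒳 𝒱 n × (↥Vᶜ → ℝ) => ENNReal.ofReal (G.sub n Vᶜ a y.1 y.2) :=
    (hG.measurable_sub n Vᶜ a).ennreal_ofReal
  refine ae_le_of_forall_setLIntegral_le_of_sigmaFinite (hms.const_mul _) fun T hT _ => ?_
  have hr : Measurable fun o : Dat K 𝒳 𝒱 n => (cov o, Vᶜ.restrict (med o)) :=
    measurable_cov.prodMk ((Finset.measurable_restrict Vᶜ).comp measurable_med)
  have hr' : Measurable fun z : Cov 𝒳 𝒱 n × Med K n => (z.1, Vᶜ.restrict z.2) :=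
    measurable_fst.prodMk ((Finset.measurable_restrict Vᶜ).comp measurable_snd)
  have hT1 : Measurable (T.indicator (1 : Cov 𝒳 𝒱 n × (↥Vᶜ → ℝ) → ℝ≥0∞)) :=
    measurable_one.indicator hT
  have h1 : ∫⁻ y in T, ENNReal.ofReal (G.sub n Vᶜ a y.1 y.2)
      ∂((covLaw P n).prod (refSub D Vᶜ)) =
      ∫⁻ o, T.indicator 1 (cov o, Vᶜ.restrict (med o)) ∂(armLaw D P a n) := by
    rw [← lintegral_map hT1 hr, map_cov_restrict_armLaw hD hG,
      lintegral_indicator_one hT, withDensity_apply _ hT]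
  have h2 := lintegral_refLaw_le_armLaw (n := n) hD hG hb a (hT1.comp hr')
  rw [h1]
  refine le_trans (le_of_eq ?_) h2
  rw [lintegral_refLaw_eq hD V (hT1.comp hr'), lintegral_const_mul _ hms,
    ← lintegral_indicator hT]
  congr 1
  refine lintegral_congr fun y => ?_
  have h3 : ∀ u, (T.indicator (1 : Cov 𝒳 𝒱 n × (↥Vᶜ → ℝ) → ℝ≥0∞) ∘
      fun z : Cov 𝒳 𝒱 n × Med K n => (z.1, Vᶜ.restrict z.2)) (glue V (y, u))
      = T.indicator 1 y := by
    intro u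
    simp only [Function.comp_apply, restrict_compl_glue]
    rfl
  rw [lintegral_congr h3, setLIntegral_const]
  by_cases hy : y ∈ T <;> simp [hy]

/-- A bound on the density of `M_{Vᶜ}` that holds on the support carries over to its arguments,
except for those over which the section of the support is a null set. -/
lemma suppSection_null_or_le [IsProbabilityMeasure P] (hD : Standing D P)
    (hG : IsNuisOf D P G) (V : Finset (Fin K × Fin n)) (a : Bool) {B : ℝ}
    (hB : ∀ᵐ z ∂(refLaw D P n), |G.sub n Vᶜ a z.1 (Vᶜ.restrict z.2)| ≤ B) :
    ∀ᵐ y ∂((covLaw P n).prod (refSub D Vᶜ)),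
      refSub D V (suppSection D V y) = 0 ∨ |G.sub n Vᶜ a y.1 y.2| ≤ B := by
  have := sigmaFinite_refSub hD V
  have hS := measurableSet_supp_snd (n := n) hD
  have hms : Measurable fun y : Cov 𝒳 𝒱 n × (↥Vᶜ → ℝ) => refSub D V (suppSection D V y) :=
    measurable_measure_prodMk_left (measurable_glue V hS)
  have hr' : Measurable fun z : Cov 𝒳 𝒱 n × Med K n => (z.1, Vᶜ.restrict z.2) :=
    measurable_fst.prodMk ((Finset.measurable_restrict Vᶜ).comp measurable_snd)
  set T : Set (Cov 𝒳 𝒱 n × (↥Vᶜ → ℝ)) := {y | |G.sub n Vᶜ a y.1 y.2| ≤ B}ᶜ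
  have hT : MeasurableSet T :=
    (measurableSet_le (hG.measurable_sub n Vᶜ a).abs measurable_const).compl
  have hT1 : Measurable (T.indicator (1 : Cov 𝒳 𝒱 n × (↥Vᶜ → ℝ) → ℝ≥0∞)) :=
    measurable_one.indicator hT
  have h0 : ∫⁻ z, T.indicator 1 (z.1, Vᶜ.restrict z.2) ∂(refLaw D P n) = 0 := by
    refine (lintegral_congr_ae ?_).trans lintegral_zero
    filter_upwards [hB] with z hz
    exact Set.indicator_of_notMem (by simpa [T] using hz) _
  replace h0 := (lintegral_refLaw_eq hD V (hT1.comp hr')).symm.trans h0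
  have h3 : ∀ y u, T.indicator (1 : Cov 𝒳 𝒱 n × (↥Vᶜ → ℝ) → ℝ≥0∞)
      ((glue V (y, u)).1, Vᶜ.restrict (glue V (y, u)).2)
      = T.indicator 1 y := by
    intro y u
    rw [restrict_compl_glue]
    rfl
  simp only [Function.comp_apply, h3, setLIntegral_const] at h0
  replace h0 := (lintegral_eq_zero_iff (hT1.mul hms)).1 h0
  filter_upwards [h0] with y hy
  by_cases h : y ∈ T
  · left
    simpa [h] using hy
  · right
    simpa [T] using h

end Blocks

/-! ### `L²` bounds for averages over mediators and for outcome residuals -/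

lemma sq_lintegral_le {α : Type*} [MeasurableSpace α] (ν : Measure α) {f : α → ℝ≥0∞}
    (hf : AEMeasurable f ν) : (∫⁻ x, f x ∂ν) ^ 2 ≤ ν Set.univ * ∫⁻ x, f x ^ 2 ∂ν := by
  have h := ENNReal.lintegral_mul_le_Lp_mul_Lq ν Real.HolderConjugate.two_two hf
    (aemeasurable_const (b := (1 : ℝ≥0∞)))
  simp only [Pi.mul_apply, mul_one, ENNReal.one_rpow, lintegral_one] at h
  calc (∫⁻ x, f x ∂ν) ^ 2
      ≤ ((∫⁻ x, f x ^ (2 : ℝ) ∂ν) ^ (1 / 2 : ℝ) * ν Set.univ ^ (1 / 2 : ℝ)) ^ 2 := by gcongr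
    _ = _ := by
        rw [mul_pow, ← ENNReal.rpow_natCast, ← ENNReal.rpow_mul, ← ENNReal.rpow_natCast,
          ← ENNReal.rpow_mul, mul_comm]
        norm_num

lemma eLpNorm_two_sq {α : Type*} [MeasurableSpace α] (ν : Measure α) (f : α → ℝ) :
    eLpNorm f 2 ν ^ 2 = ∫⁻ x, ‖f x‖ₑ ^ 2 ∂ν := by
  rw [eLpNorm_eq_lintegral_rpow_enorm_toReal (by norm_num) (by norm_num), ← ENNReal.rpow_natCast,
    ← ENNReal.rpow_mul]
  norm_num

lemma eLpNorm_two_le_of_sq {α β : Type*} [MeasurableSpace α] [MeasurableSpace β]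
    {ν : Measure α} {ρ : Measure β} {f : α → ℝ} {g : β → ℝ} {c : ℝ≥0∞}
    (h : ∫⁻ x, ‖f x‖ₑ ^ 2 ∂ν ≤ c ^ 2 * ∫⁻ x, ‖g x‖ₑ ^ 2 ∂ρ) :
    eLpNorm f 2 ν ≤ c * eLpNorm g 2 ρ := by
  rw [← eLpNorm_two_sq, ← eLpNorm_two_sq, ← mul_pow] at h
  exact (ENNReal.pow_le_pow_left_iff (by norm_num)).1 h

section Averages

/-- `∫ k(C, m) dm_V` over the support, as a function of `(C, m)`; it depends on `m` through
`m_{Vᶜ}` only. -/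
def blockInt {K n : ℕ} {𝒳 𝒱 : Type*} (D : Design K 𝒱) (V : Finset (Fin K × Fin n))
    (k : Cov 𝒳 𝒱 n × Med K n → ℝ)
    (z : Cov 𝒳 𝒱 n × Med K n) : ℝ :=
  ∫ u in {u : V → ℝ | Function.updateFinset z.2 V u ∈ D.supp n},
    k (z.1, Function.updateFinset z.2 V u) ∂(refSub D V)

lemma blockInt_set_eq {K n : ℕ} {𝒳 𝒱 : Type*} (D : Design K 𝒱) (V : Finset (Fin K × Fin n))
    (z : Cov 𝒳 𝒱 n × Med K n) :
    {u : V → ℝ | Function.updateFinset z.2 V u ∈ D.supp n}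
      = suppSection D V (z.1, Vᶜ.restrict z.2) := by
  ext u
  simp only [suppSection, glue, updateFinset_glue]

lemma blockInt_eq {K n : ℕ} {𝒳 𝒱 : Type*} (D : Design K 𝒱) (V : Finset (Fin K × Fin n))
    (k : Cov 𝒳 𝒱 n × Med K n → ℝ)
    (z : Cov 𝒳 𝒱 n × Med K n) :
    blockInt D V k z = ∫ u in suppSection D V (z.1, Vᶜ.restrict z.2),
      k (glue V ((z.1, Vᶜ.restrict z.2), u)) ∂(refSub D V) := by
  rw [blockInt, blockInt_set_eq]
  simp only [glue, updateFinset_glue]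

variable {K : ℕ} {𝒳 𝒱 : Type*} [MeasurableSpace 𝒳] [MeasurableSpace 𝒱] {n : ℕ}
variable {D : Design K 𝒱} {P : Measure (Obs K 𝒳 𝒱)} {G : Nuis K 𝒳 𝒱} {b : ℝ}

lemma ae_finite_ref (hD : Standing D P) {k : Cov 𝒳 𝒱 n × Med K n → ℝ} (hk : Measurable k) {B : ℝ}
    (hB : ∀ᵐ z ∂(refLaw D P n), |k z| ≤ B) :
    ∀ᵐ o ∂(condLaw P n), ∀ᵐ m ∂(ref D n), |k (cov o, m)| ≤ B :=
  (ae_refLaw_iff hD (measurableSet_le hk.abs measurable_const)).1 hB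

/-- Bounded functions are integrable over the support. -/
lemma ae_integrable_ref [IsProbabilityMeasure P] (hD : Standing D P)
    (hG : IsNuisOf D P G) (hb : IsDensLB D P G b) (hn : P {o | o.1 = n} ≠ 0)
    {k : Cov 𝒳 𝒱 n × Med K n → ℝ} (hk : Measurable k) {B : ℝ}
    (hB : ∀ᵐ z ∂(refLaw D P n), |k z| ≤ B) :
    ∀ᵐ o ∂(condLaw P n), Integrable (fun m => k (cov o, m)) (ref D n) := by
  have : IsFiniteMeasure (ref D n) :=
    ⟨(ref_univ_le hD hG hb hn).trans_lt ENNReal.coe_lt_top⟩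
  filter_upwards [ae_finite_ref hD hk hB] with o ho
  exact Integrable.of_bound (hk.comp measurable_prodMk_left).aestronglyMeasurable B ho

lemma integrable_refLaw [IsProbabilityMeasure P] (hD : Standing D P)
    (hG : IsNuisOf D P G) (hb : IsDensLB D P G b)
    {k : Cov 𝒳 𝒱 n × Med K n → ℝ} (hk : Measurable k) {B : ℝ}
    (hB : ∀ᵐ z ∂(refLaw D P n), |k z| ≤ B) : Integrable k (refLaw D P n) := by
  have := isFiniteMeasure_refLaw (n := n) hD hG hb
  exact Integrable.of_bound hk.aestronglyMeasurable B hB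

lemma measurable_integral_ref (hD : Standing D P) {k : Cov 𝒳 𝒱 n × Med K n → ℝ}
    (hk : Measurable k) : Measurable fun c => ∫ m, k (c, m) ∂(ref D n) := by
  have := sigmaFinite_ref (n := n) hD
  exact hk.stronglyMeasurable.integral_prod_right'.measurable

lemma integral_cov_eq [IsProbabilityMeasure P] (hD : Standing D P)
    {k : Cov 𝒳 𝒱 n × Med K n → ℝ} (hk : Measurable k)
    (hi : Integrable k (refLaw D P n)) :
    ∫ o, ∫ m, k (cov o, m) ∂(ref D n) ∂(condLaw P n) = ∫ z, k z ∂(refLaw D P n) := by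
  have := sigmaFinite_ref (n := n) hD
  rw [refLaw, integral_prod _ hi, covLaw, integral_map measurable_cov.aemeasurable
    (measurable_integral_ref hD hk).aestronglyMeasurable]

/-- As positivity makes the support have finite measure, averaging over all mediators is bounded
in `L²`. -/
lemma eLpNorm_integral_ref_le [IsProbabilityMeasure P] (hD : Standing D P)
    (hG : IsNuisOf D P G) (hb : IsDensLB D P G b) (hn : P {o | o.1 = n} ≠ 0)
    {k : Cov 𝒳 𝒱 n × Med K n → ℝ} (hk : Measurable k) :
    eLpNorm (fun o => ∫ m, k (cov o, m) ∂(ref D n)) 2 (condLaw P n) ≤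
      refConst D b * eLpNorm (fun o => k (covMed o)) 2 (condLaw P n) := by
  have := sigmaFinite_ref (n := n) hD
  refine eLpNorm_two_le_of_sq ?_
  have hk2 : Measurable fun z => ‖k z‖ₑ ^ 2 := hk.enorm.pow_const 2
  calc ∫⁻ o, ‖∫ m, k (cov o, m) ∂(ref D n)‖ₑ ^ 2 ∂(condLaw P n)
      ≤ ∫⁻ o, refConst D b * ∫⁻ m, ‖k (cov o, m)‖ₑ ^ 2 ∂(ref D n) ∂(condLaw P n) := by
        refine lintegral_mono fun o => ?_
        calc ‖∫ m, k (cov o, m) ∂(ref D n)‖ₑ ^ 2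
            ≤ (∫⁻ m, ‖k (cov o, m)‖ₑ ∂(ref D n)) ^ 2 := by
              gcongr
              exact enorm_integral_le_lintegral_enorm _
          _ ≤ _ := sq_lintegral_le _ (hk.comp measurable_prodMk_left).enorm.aemeasurable
          _ ≤ _ := by
              gcongr
              exact ref_univ_le hD hG hb hn
    _ = refConst D b * ∫⁻ z, ‖k z‖ₑ ^ 2 ∂(refLaw D P n) := by
        rw [lintegral_const_mul' _ _ ENNReal.coe_ne_top, refLaw,
          lintegral_prod _ hk2.aemeasurable, covLaw,
          lintegral_map hk2.lintegral_prod_right' measurable_cov]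
    _ ≤ refConst D b * (refConst D b * ∫⁻ o, ‖k (covMed o)‖ₑ ^ 2 ∂(condLaw P n)) := by
        gcongr
        exact lintegral_refLaw_le hD hG hb hk2
    _ = _ := by rw [pow_two, mul_assoc]

lemma measurable_block (hD : Standing D P) (V : Finset (Fin K × Fin n))
    {k : Cov 𝒳 𝒱 n × Med K n → ℝ} (hk : Measurable k) :
    Measurable fun y => ∫ u in suppSection D V y, k (glue V (y, u)) ∂(refSub D V) := by
  have := sigmaFinite_refSub hD V
  have hS := measurableSet_supp_snd (n := n) hD
  have h := ((hk.indicator hS).comp (measurable_glue V)).stronglyMeasurable.integral_prod_right'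
    (ν := refSub D V)
  convert h.measurable using 2 with y
  rw [← integral_indicator (measurableSet_suppSection hD V y)]
  rfl

lemma measurable_restrict_snd (V : Finset (Fin K × Fin n)) :
    Measurable fun z : Cov 𝒳 𝒱 n × Med K n => (z.1, V.restrict z.2) :=
  measurable_fst.prodMk ((Finset.measurable_restrict V).comp measurable_snd)

lemma measurable_cov_restrict (V : Finset (Fin K × Fin n)) :
    Measurable fun o : Dat K 𝒳 𝒱 n => (cov o, V.restrict (med o)) :=
  measurable_cov.prodMk ((Finset.measurable_restrict V).comp measurable_med)

lemma measurable_blockInt (hD : Standing D P) (V : Finset (Fin K × Fin n))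
    {k : Cov 𝒳 𝒱 n × Med K n → ℝ} (hk : Measurable k) : Measurable (blockInt D V k) := by
  have := (measurable_block hD V hk).comp (measurable_restrict_snd Vᶜ)
  convert this using 1
  funext z
  rw [blockInt_eq]
  rfl

lemma ae_armLaw_of_ae_block [IsProbabilityMeasure P] (hD : Standing D P) (hG : IsNuisOf D P G)
    (V : Finset (Fin K × Fin n)) (a : Bool) {p : Cov 𝒳 𝒱 n × (V → ℝ) → Prop}
    (h : ∀ᵐ y ∂((covLaw P n).prod (refSub D V)), p y) :
    ∀ᵐ o ∂(armLaw D P a n), p (cov o, V.restrict (med o)) := by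
  refine ae_of_ae_map (measurable_cov_restrict V).aemeasurable ?_
  rw [map_cov_restrict_armLaw hD hG]
  exact (withDensity_absolutelyContinuous _ _).ae_le h

lemma ae_suppSection [IsProbabilityMeasure P] (hD : Standing D P)
    (V : Finset (Fin K × Fin n)) {p : Cov 𝒳 𝒱 n × Med K n → Prop} (hp : MeasurableSet {z | p z})
    (h : ∀ᵐ z ∂(refLaw D P n), p z) :
    ∀ᵐ y ∂((covLaw P n).prod (refSub D Vᶜ)), ∀ᵐ u ∂((refSub D V).restrict (suppSection D V y)),
      p (glue V (y, u)) := by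
  have := sigmaFinite_refSub hD V
  have := sigmaFinite_refSub hD Vᶜ
  rw [refLaw_eq_restrict hD, ae_restrict_iff hp] at h
  have h1 := (measurePreserving_glue (P := P) hD V).quasiMeasurePreserving.ae h
  have h2 := Measure.ae_ae_of_ae_prod h1
  filter_upwards [h2] with y hy
  rw [ae_restrict_iff' (measurableSet_suppSection hD V y)]
  exact hy

/-- Bounded functions are integrable over a block of mediators: the sections of the support have
finite measure, by `refSub_suppSection_le`. -/
lemma ae_integrable_block [IsProbabilityMeasure P] (hD : Standing D P) (hG : IsNuisOf D P G)
    (hb : IsDensLB D P G b) (V : Finset (Fin K × Fin n)) (a : Bool)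
    {k : Cov 𝒳 𝒱 n × Med K n → ℝ} (hk : Measurable k) {B : ℝ}
    (hB : ∀ᵐ z ∂(refLaw D P n), |k z| ≤ B) :
    ∀ᵐ o ∂(armLaw D P a n), Integrable (fun u => k (glue V ((cov o, Vᶜ.restrict (med o)), u)))
      ((refSub D V).restrict (suppSection D V (cov o, Vᶜ.restrict (med o)))) := by
  refine ae_armLaw_of_ae_block hD hG Vᶜ a (p := fun y => Integrable (fun u => k (glue V (y, u)))
    ((refSub D V).restrict (suppSection D V y))) ?_
  filter_upwards [ae_suppSection hD V (measurableSet_le hk.abs measurable_const) hB,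
    refSub_suppSection_le hD hG hb V a] with y h1 h2
  have : IsFiniteMeasure ((refSub D V).restrict (suppSection D V y)) := by
    constructor
    rw [Measure.restrict_apply_univ]
    by_contra hc
    rw [not_lt, top_le_iff] at hc
    rw [hc, ENNReal.mul_top (by simpa using hb.1)] at h2
    exact absurd h2 (not_le.2 ENNReal.ofReal_lt_top)
  exact Integrable.of_bound
    ((hk.comp (measurable_glue V)).comp measurable_prodMk_left).aestronglyMeasurable B h1

lemma blockInt_sub [IsProbabilityMeasure P] (hD : Standing D P) (hG : IsNuisOf D P G)
    (hb : IsDensLB D P G b) (V : Finset (Fin K × Fin n)) (a : Bool)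
    {k k' : Cov 𝒳 𝒱 n × Med K n → ℝ} (hk : Measurable k) (hk' : Measurable k') {B B' : ℝ}
    (hB : ∀ᵐ z ∂(refLaw D P n), |k z| ≤ B) (hB' : ∀ᵐ z ∂(refLaw D P n), |k' z| ≤ B') :
    ∀ᵐ o ∂(armLaw D P a n), blockInt D V k (covMed o) - blockInt D V k' (covMed o)
      = blockInt D V (fun z => k z - k' z) (covMed o) := by
  filter_upwards [ae_integrable_block hD hG hb V a hk hB,
    ae_integrable_block hD hG hb V a hk' hB'] with o h1 h2
  simp only [blockInt_eq]
  exact (integral_sub h1 h2).symm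

/-- If the density of `M_{Vᶜ}` under treatment `a` is bounded, averaging over the block `V` is
bounded from `L²` of the reference law to `L²` under treatment `a`: the density bounds the size of
the sections of the support over which the average extends, as well as the weight that they
receive. -/
lemma lintegral_blockInt_sq_le [IsProbabilityMeasure P] (hD : Standing D P) (hG : IsNuisOf D P G)
    (hb : IsDensLB D P G b) (V : Finset (Fin K × Fin n)) (a : Bool)
    {k : Cov 𝒳 𝒱 n × Med K n → ℝ} (hk : Measurable k) {B : ℝ} (hB0 : 0 ≤ B)
    (hB : ∀ᵐ z ∂(refLaw D P n), |G.sub n Vᶜ a z.1 (Vᶜ.restrict z.2)| ≤ B) :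
    ∫⁻ o, ‖blockInt D V k (covMed o)‖ₑ ^ 2 ∂(armLaw D P a n) ≤
      ENNReal.ofReal (B ^ 2 / b) * ∫⁻ z, ‖k z‖ₑ ^ 2 ∂(refLaw D P n) := by
  have := sigmaFinite_refSub hD V
  have := sigmaFinite_refSub hD Vᶜ
  have hsub : Measurable fun y : Cov 𝒳 𝒱 n × (↥Vᶜ → ℝ) => ENNReal.ofReal (G.sub n Vᶜ a y.1 y.2) :=
    (hG.measurable_sub n Vᶜ a).ennreal_ofReal
  have hk2 : Measurable fun z => ‖k z‖ₑ ^ 2 := hk.enorm.pow_const 2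
  have hg := ((measurable_block hD V hk).enorm.pow_const 2)
  have h1 : ∫⁻ o, ‖blockInt D V k (covMed o)‖ₑ ^ 2 ∂(armLaw D P a n) =
      ∫⁻ y, ENNReal.ofReal (G.sub n Vᶜ a y.1 y.2) *
        ‖∫ u in suppSection D V y, k (glue V (y, u)) ∂(refSub D V)‖ₑ ^ 2
        ∂((covLaw P n).prod (refSub D Vᶜ)) := by
    refine Eq.trans ?_ (lintegral_withDensity_eq_lintegral_mul _ hsub hg)
    rw [← map_cov_restrict_armLaw hD hG Vᶜ a, lintegral_map hg (measurable_cov_restrict Vᶜ)]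
    refine lintegral_congr fun o => ?_
    rw [blockInt_eq]
    rfl
  rw [h1, lintegral_refLaw_eq hD V hk2, ← lintegral_const_mul' _ _ ENNReal.ofReal_ne_top]
  refine lintegral_mono_ae ?_
  filter_upwards [refSub_suppSection_le hD hG hb V a, suppSection_null_or_le hD hG V a hB]
    with y hy hy'
  rcases hy' with h0 | hle
  · rw [Measure.restrict_eq_zero.2 h0]
    simp
  have h2 : ENNReal.ofReal (G.sub n Vᶜ a y.1 y.2) ≤ ENNReal.ofReal B :=
    ENNReal.ofReal_le_ofReal ((le_abs_self _).trans hle)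
  have h3 : refSub D V (suppSection D V y) ≤ ENNReal.ofReal (B / b) := by
    rw [ENNReal.ofReal_div_of_pos hb.1,
      ENNReal.le_div_iff_mul_le (Or.inl (by simpa using hb.1)) (Or.inl ENNReal.ofReal_ne_top),
      mul_comm]
    exact hy.trans h2
  calc ENNReal.ofReal (G.sub n Vᶜ a y.1 y.2) *
        ‖∫ u in suppSection D V y, k (glue V (y, u)) ∂(refSub D V)‖ₑ ^ 2
      ≤ ENNReal.ofReal B *
        (∫⁻ u in suppSection D V y, ‖k (glue V (y, u))‖ₑ ∂(refSub D V)) ^ 2 := by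
        gcongr
        exact enorm_integral_le_lintegral_enorm _
    _ ≤ ENNReal.ofReal B * (ENNReal.ofReal (B / b) *
        ∫⁻ u in suppSection D V y, ‖k (glue V (y, u))‖ₑ ^ 2 ∂(refSub D V)) := by
        gcongr
        refine (sq_lintegral_le _ ((hk.comp (measurable_glue V)).comp
          measurable_prodMk_left).enorm.aemeasurable).trans ?_
        rw [Measure.restrict_apply_univ]
        gcongr
        exact le_rfl
    _ = _ := by
        rw [← mul_assoc, ← ENNReal.ofReal_mul hB0]
        congr 2
        ring

/-- An average over the block `V`, observed under treatment `a`, has the same mean as the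
integrand with the density of `M_{Vᶜ}` as weight. -/
lemma integral_blockInt [IsProbabilityMeasure P] (hD : Standing D P) (hG : IsNuisOf D P G)
    (V : Finset (Fin K × Fin n)) (a : Bool)
    {k : Cov 𝒳 𝒱 n × Med K n → ℝ} (hk : Measurable k)
    (hi : Integrable (fun z => k z * G.sub n Vᶜ a z.1 (Vᶜ.restrict z.2)) (refLaw D P n)) :
    ∫ o, blockInt D V k (covMed o) ∂(armLaw D P a n) =
      ∫ z, k z * G.sub n Vᶜ a z.1 (Vᶜ.restrict z.2) ∂(refLaw D P n) := by
  have hsub : Measurable fun y : Cov 𝒳 𝒱 n × (↥Vᶜ → ℝ) => ENNReal.ofReal (G.sub n Vᶜ a y.1 y.2) :=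
    (hG.measurable_sub n Vᶜ a).ennreal_ofReal
  have hg := measurable_block hD V hk
  have h1 : ∫ o, blockInt D V k (covMed o) ∂(armLaw D P a n) =
      ∫ y, G.sub n Vᶜ a y.1 y.2 *
        ∫ u in suppSection D V y, k (glue V (y, u)) ∂(refSub D V)
        ∂((covLaw P n).prod (refSub D Vᶜ)) := by
    have h2 := integral_withDensity_eq_integral_toReal_smul (μ := (covLaw P n).prod (refSub D Vᶜ))
      hsub (ae_of_all _ fun _ => ENNReal.ofReal_lt_top)
      (fun y => ∫ u in suppSection D V y, k (glue V (y, u)) ∂(refSub D V))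
    simp only [ENNReal.toReal_ofReal (hG.sub_nonneg _ _ _ _ _), smul_eq_mul] at h2
    rw [← h2, ← map_cov_restrict_armLaw hD hG Vᶜ a,
      integral_map (measurable_cov_restrict Vᶜ).aemeasurable hg.aestronglyMeasurable]
    refine integral_congr_ae (ae_of_all _ fun o => ?_)
    dsimp only
    rw [blockInt_eq]
    rfl
  have hm : Measurable fun z => k z * G.sub n Vᶜ a z.1 (Vᶜ.restrict z.2) :=
    hk.mul ((hG.measurable_sub n Vᶜ a).comp (measurable_restrict_snd Vᶜ))
  rw [h1, integral_refLaw_eq hD V hm hi]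
  refine integral_congr_ae (ae_of_all _ fun y => ?_)
  dsimp only
  rw [← integral_const_mul]
  refine integral_congr_ae (ae_of_all _ fun u => ?_)
  dsimp only
  rw [restrict_compl_glue, mul_comm]
  rfl

/-- Under an enforced treatment `a`, means are integrals against the density of the mediators. -/
lemma integral_covMed_armLaw [IsProbabilityMeasure P] (hD : Standing D P) (hG : IsNuisOf D P G)
    (a : Bool) {k : Cov 𝒳 𝒱 n × Med K n → ℝ} (hk : Measurable k) :
    ∫ o, k (covMed o) ∂(armLaw D P a n) = ∫ z, k z * G.dens n a z.1 z.2 ∂(refLaw D P n) := by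
  have hd : Measurable fun z : Cov 𝒳 𝒱 n × Med K n => ENNReal.ofReal (G.dens n a z.1 z.2) :=
    (hG.measurable_dens n a).ennreal_ofReal
  rw [← integral_map measurable_covMed.aemeasurable hk.aestronglyMeasurable,
    map_covMed_armLaw hD hG, integral_withDensity_eq_integral_toReal_smul hd
      (ae_of_all _ fun _ => ENNReal.ofReal_lt_top)]
  simp only [ENNReal.toReal_ofReal (hG.dens_nonneg _ _ _ _), smul_eq_mul, mul_comm]

/-- Enforcing a treatment does not change means of functions of the covariates. -/
lemma integral_cov_armLaw [IsProbabilityMeasure P] (hD : Standing D P) (a : Bool)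
    {k : Cov 𝒳 𝒱 n → ℝ} (hk : Measurable k) :
    ∫ o, k (cov o) ∂(armLaw D P a n) = ∫ o, k (cov o) ∂(condLaw P n) := by
  rw [← integral_map measurable_cov.aemeasurable hk.aestronglyMeasurable, map_cov_armLaw hD,
    covLaw, integral_map measurable_cov.aemeasurable hk.aestronglyMeasurable]

lemma eLpNorm_ipw_mul_le (hD : Standing D P) (a : Bool) {F : Dat K 𝒳 𝒱 n → ℝ} :
    eLpNorm (fun o => ipw D a (trt o) * F o) 2 (condLaw P n) ≤
      Real.toNNReal (1 / prob D a) * eLpNorm F 2 (condLaw P n) := by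
  refine eLpNorm_le_nnreal_smul_eLpNorm_of_ae_le_mul (ae_of_all _ fun o => ?_) 2
  rw [nnnorm_mul]
  gcongr
  rw [← NNReal.coe_le_coe, coe_nnnorm, Real.norm_of_nonneg (ipw_nonneg hD _ _)]
  exact (ipw_le hD _ _).trans (Real.le_coe_toNNReal _)

lemma lintegral_ipw_mul_sq (hD : Standing D P) (a : Bool) {F : Dat K 𝒳 𝒱 n → ℝ}
    (hF : Measurable F) :
    ∫⁻ o, ‖ipw D a (trt o) * F o‖ₑ ^ 2 ∂(condLaw P n) ≤
      ENNReal.ofReal (1 / prob D a) * ∫⁻ o, ‖F o‖ₑ ^ 2 ∂(armLaw D P a n) := by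
  rw [lintegral_armLaw a (hF.enorm.pow_const 2), ← lintegral_const_mul' _ _ ENNReal.ofReal_ne_top]
  refine lintegral_mono fun o => ?_
  rw [enorm_mul, mul_pow, pow_two ‖ipw D a (trt o)‖ₑ, mul_assoc,
    Real.enorm_of_nonneg (ipw_nonneg hD _ _)]
  gcongr
  exact ipw_le hD _ _

lemma eLpNorm_ipw_blockInt_le [IsProbabilityMeasure P] (hD : Standing D P) (hG : IsNuisOf D P G)
    (hb : IsDensLB D P G b) (V : Finset (Fin K × Fin n)) (a : Bool) {B : ℝ} (hB0 : 0 ≤ B)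
    (hB : ∀ᵐ z ∂(refLaw D P n), |G.sub n Vᶜ a z.1 (Vᶜ.restrict z.2)| ≤ B) :
    ∃ c : ℝ≥0, ∀ k : Cov 𝒳 𝒱 n × Med K n → ℝ, Measurable k →
      eLpNorm (fun o => ipw D a (trt o) * blockInt D V k (covMed o)) 2 (condLaw P n) ≤
        c * eLpNorm (fun o => k (covMed o)) 2 (condLaw P n) := by
  set c : ℝ≥0 := Real.toNNReal (1 / prob D a) * (Real.toNNReal (B ^ 2 / b) * refConst D b)
  refine ⟨NNReal.sqrt c, fun k hk => eLpNorm_two_le_of_sq ?_⟩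
  rw [← ENNReal.coe_pow, NNReal.sq_sqrt]
  refine (lintegral_ipw_mul_sq hD a ((measurable_blockInt hD V hk).comp measurable_covMed)).trans ?_
  rw [ENNReal.coe_mul, ENNReal.coe_mul, mul_assoc, mul_assoc]
  refine mul_le_mul_right ?_ _
  refine (lintegral_blockInt_sq_le hD hG hb V a hk hB0 hB).trans ?_
  refine mul_le_mul_right ?_ _
  exact lintegral_refLaw_le hD hG hb (hk.enorm.pow_const 2)

end Averages

/-! ### Outcome residuals -/

section Residuals

variable {K : ℕ} {𝒳 𝒱 : Type*} [MeasurableSpace 𝒳] [MeasurableSpace 𝒱] {n : ℕ}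
variable {D : Design K 𝒱} {P : Measure (Obs K 𝒳 𝒱)} {G : Nuis K 𝒳 𝒱}

/-- The residual `Y_j - η_j(A, M, C, N)`. -/
def resid (G : Nuis K 𝒳 𝒱) (j : Fin n) (o : Dat K 𝒳 𝒱 n) : ℝ :=
  out j o - G.eta n j (trt o) (cov o) (med o)

lemma measurable_tcm :
    Measurable fun o : Dat K 𝒳 𝒱 n => (trt o, cov o, med o) := by fun_prop

lemma sigmaACM_le : sigmaACM K 𝒳 𝒱 n ≤ (inferInstance : MeasurableSpace (Dat K 𝒳 𝒱 n)) :=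
  measurable_tcm.comap_le

lemma measurable_eta_trt (hG : IsNuisOf D P G) (j : Fin n) :
    Measurable fun x : Bool × Cov 𝒳 𝒱 n × Med K n => G.eta n j x.1 x.2.1 x.2.2 :=
  measurable_from_prod_countable_right fun a => hG.measurable_eta n j a

lemma measurable_resid (hG : IsNuisOf D P G) (j : Fin n) :
    Measurable (resid G j : Dat K 𝒳 𝒱 n → ℝ) :=
  (measurable_out j).sub ((measurable_eta_trt hG j).comp measurable_tcm)

lemma memLp_resid [IsProbabilityMeasure P] (hD : Standing D P) (hG : IsNuisOf D P G) (j : Fin n) :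
    MemLp (resid G j : Dat K 𝒳 𝒱 n → ℝ) 2 (condLaw P n) := by
  have h1 := hD.second_moment n j
  refine h1.sub ?_
  exact (memLp_congr_ae (hG.eta_spec n j)).1 (MemLp.condExp (m := sigmaACM K 𝒳 𝒱 n)
    one_le_two h1)

/-- Outcome residuals are orthogonal to bounded functions of `(A, C, M)`. -/
lemma integral_mul_resid [IsProbabilityMeasure P] (hD : Standing D P) (hG : IsNuisOf D P G)
    (j : Fin n) {g : Bool × Cov 𝒳 𝒱 n × Med K n → ℝ} (hg : Measurable g) {B : ℝ}
    (hB : ∀ᵐ o ∂(condLaw P n), |g (trt o, cov o, med o)| ≤ B) :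
    ∫ o, g (trt o, cov o, med o) * resid G j o ∂(condLaw P n) = 0 := by
  have hi : Integrable (resid G j : Dat K 𝒳 𝒱 n → ℝ) (condLaw P n) :=
    (memLp_resid hD hG j).integrable (by norm_num)
  have hgm : StronglyMeasurable[sigmaACM K 𝒳 𝒱 n]
      fun o : Dat K 𝒳 𝒱 n => g (trt o, cov o, med o) :=
    (hg.comp (comap_measurable _)).stronglyMeasurable
  have hio : Integrable (out j : Dat K 𝒳 𝒱 n → ℝ) (condLaw P n) :=
    (hD.second_moment n j).integrable (by norm_num)
  have hie : Integrable (fun o : Dat K 𝒳 𝒱 n => G.eta n j (trt o) (cov o) (med o))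
      (condLaw P n) := (integrable_congr (hG.eta_spec n j)).1 integrable_condExp
  have hem : StronglyMeasurable[sigmaACM K 𝒳 𝒱 n]
      fun o : Dat K 𝒳 𝒱 n => G.eta n j (trt o) (cov o) (med o) :=
    ((measurable_eta_trt hG j).comp (comap_measurable _)).stronglyMeasurable
  have h0 : (condLaw P n)[(resid G j : Dat K 𝒳 𝒱 n → ℝ) | sigmaACM K 𝒳 𝒱 n]
      =ᵐ[condLaw P n] 0 := by
    refine (condExp_sub hio hie _).trans ?_
    rw [condExp_of_stronglyMeasurable sigmaACM_le hem hie]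
    filter_upwards [hG.eta_spec n j] with o ho
    simp [ho]
  have h1 := condExp_stronglyMeasurable_mul_of_bound (sigmaACM_le) hgm hi B hB
  rw [← integral_condExp sigmaACM_le]
  refine (integral_congr_ae h1).trans ?_
  refine (integral_congr_ae ?_).trans (integral_zero _ _)
  filter_upwards [h0] with o ho
  simp [ho]

/-- A bounded conditional variance makes multiplication with the residual a bounded operation in
`L²`. -/
lemma eLpNorm_mul_resid_le [IsProbabilityMeasure P] (hD : Standing D P) (hG : IsNuisOf D P G)
    (hvar : CondVarBdd P G) : ∃ c : ℝ≥0, ∀ (n : ℕ) (j : Fin n)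
      (g : Bool × Cov 𝒳 𝒱 n × Med K n → ℝ), Measurable g →
      (∃ B : ℝ, ∀ᵐ o ∂(condLaw P n), |g (trt o, cov o, med o)| ≤ B) →
      eLpNorm (fun o => g (trt o, cov o, med o) * resid G j o) 2 (condLaw P n) ≤
        c * eLpNorm (fun o => g (trt o, cov o, med o)) 2 (condLaw P n) := by
  obtain ⟨B₀, hB₀⟩ := hvar
  obtain ⟨Bv, hneg, hBv⟩ : ∃ Bv : ℝ, 0 ≤ Bv ∧ ∀ (n : ℕ) (j : Fin n),
      (condLaw P n)[fun o => (out j o - G.eta n j (trt o) (cov o) (med o)) ^ 2 |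
        sigmaACM K 𝒳 𝒱 n] ≤ᵐ[condLaw P n] fun _ => Bv :=
    ⟨max B₀ 0, le_max_right _ _, fun n j => (hB₀ n j).trans (ae_of_all _ fun _ => le_max_left _ _)⟩
  refine ⟨NNReal.sqrt (Real.toNNReal Bv), fun n j g hg ⟨B, hB⟩ => eLpNorm_two_le_of_sq ?_⟩
  rw [← ENNReal.coe_pow, NNReal.sq_sqrt]
  have hgt : Measurable fun o : Dat K 𝒳 𝒱 n => g (trt o, cov o, med o) := hg.comp measurable_tcm
  have hgm : StronglyMeasurable[sigmaACM K 𝒳 𝒱 n]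
      fun o : Dat K 𝒳 𝒱 n => g (trt o, cov o, med o) ^ 2 :=
    ((hg.comp (comap_measurable _)).pow_const 2).stronglyMeasurable
  have hB2 : ∀ᵐ o ∂(condLaw P n), ‖g (trt o, cov o, med o) ^ 2‖ ≤ B ^ 2 := by
    filter_upwards [hB] with o ho
    rw [Real.norm_of_nonneg (sq_nonneg _), ← sq_abs]
    exact pow_le_pow_left₀ (abs_nonneg _) ho 2
  have hr2 : Integrable (fun o : Dat K 𝒳 𝒱 n => resid G j o ^ 2) (condLaw P n) :=
    (memLp_resid hD hG j).integrable_sq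
  have hg2 : Integrable (fun o : Dat K 𝒳 𝒱 n => g (trt o, cov o, med o) ^ 2) (condLaw P n) :=
    Integrable.of_bound (hgt.pow_const 2).aestronglyMeasurable _ hB2
  have hgr : Integrable (fun o : Dat K 𝒳 𝒱 n => g (trt o, cov o, med o) ^ 2 * resid G j o ^ 2)
      (condLaw P n) := hr2.bdd_mul (hgt.pow_const 2).aestronglyMeasurable hB2
  have hsq : ∀ x : ℝ, ‖x‖ₑ ^ 2 = ENNReal.ofReal (x ^ 2) := fun x => by
    rw [← ofReal_norm, ← ENNReal.ofReal_pow (norm_nonneg _), Real.norm_eq_abs, sq_abs]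
  simp only [hsq, mul_pow]
  rw [← ofReal_integral_eq_lintegral_ofReal hgr
      (ae_of_all _ fun o => mul_nonneg (sq_nonneg _) (sq_nonneg _)),
    ← ofReal_integral_eq_lintegral_ofReal hg2 (ae_of_all _ fun o => sq_nonneg _)]
  change _ ≤ ENNReal.ofReal Bv * _
  rw [← ENNReal.ofReal_mul hneg]
  refine ENNReal.ofReal_le_ofReal ?_
  rw [← integral_condExp sigmaACM_le, ← integral_const_mul]
  refine integral_mono_ae integrable_condExp (hg2.const_mul _) ?_
  have h1 := condExp_stronglyMeasurable_mul_of_bound (sigmaACM_le) hgm hr2 (B ^ 2) hB2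
  filter_upwards [h1, hBv n j] with o ho hv
  refine ho.le.trans ?_
  rw [Pi.mul_apply, mul_comm Bv]
  exact mul_le_mul_of_nonneg_left hv (sq_nonneg _)

end Residuals

/-! ### Terms of the influence functions -/

section Terms

/-- The weighted outcome residual `𝓘(A = a) / Pr(A = a) r(C, M) {Y_j - e(C, M)}`. -/
def resTerm {K n : ℕ} {𝒳 𝒱 : Type*} (D : Design K 𝒱) (a : Bool) (j : Fin n)
    (r e : Cov 𝒳 𝒱 n × Med K n → ℝ)
    (o : Dat K 𝒳 𝒱 n) : ℝ :=
  ipw D a (trt o) * (r (covMed o) * (out j o - e (covMed o)))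

/-- A weighted residual splits into the part due to the outcome, which has conditional mean zero,
and the part due to the error of `e`. -/
lemma resTerm_eq {K n : ℕ} {𝒳 𝒱 : Type*} {D : Design K 𝒱} (G : Nuis K 𝒳 𝒱) (a : Bool)
    (j : Fin n) (r e : Cov 𝒳 𝒱 n × Med K n → ℝ) (o : Dat K 𝒳 𝒱 n) :
    resTerm D a j r e o = ipw D a (trt o) * r (covMed o) * resid G j o
      + ipw D a (trt o) * (r (covMed o) * (G.eta n j a (cov o) (med o) - e (covMed o))) := by
  unfold resTerm resid
  by_cases h : trt o = a
  · rw [h]; ring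
  · simp [ipw, h]

/-- The measurability requirements on nuisance functions. -/
structure MeasNuis {K : ℕ} {𝒳 𝒱 : Type*} [MeasurableSpace 𝒳] [MeasurableSpace 𝒱]
    (G : Nuis K 𝒳 𝒱) : Prop where
  measurable_eta : ∀ (n : ℕ) (j : Fin n) (a : Bool),
    Measurable fun x : Cov 𝒳 𝒱 n × Med K n => G.eta n j a x.1 x.2
  measurable_dens : ∀ (n : ℕ) (a : Bool),
    Measurable fun x : Cov 𝒳 𝒱 n × Med K n => G.dens n a x.1 x.2
  measurable_sub : ∀ (n : ℕ) (U : Finset (Fin K × Fin n)) (a : Bool),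
    Measurable fun x : Cov 𝒳 𝒱 n × (U → ℝ) => G.sub n U a x.1 x.2

variable {K : ℕ} {𝒳 𝒱 : Type*} [MeasurableSpace 𝒳] [MeasurableSpace 𝒱] {n : ℕ}
variable {D : Design K 𝒱} {P : Measure (Obs K 𝒳 𝒱)} {G : Nuis K 𝒳 𝒱} {b : ℝ}

lemma IsNuisOf.measNuis (hG : IsNuisOf D P G) : MeasNuis G :=
  ⟨hG.measurable_eta, hG.measurable_dens, hG.measurable_sub⟩

/-- Measurable functions of covariates and mediators that are bounded on the support. -/
def Tame (D : Design K 𝒱) (P : Measure (Obs K 𝒳 𝒱)) (k : Cov 𝒳 𝒱 n × Med K n → ℝ) : Prop :=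
  Measurable k ∧ ∃ B : ℝ, ∀ᵐ z ∂(refLaw D P n), |k z| ≤ B

namespace Tame

variable {k l : Cov 𝒳 𝒱 n × Med K n → ℝ}

lemma mul (hk : Tame D P k) (hl : Tame D P l) : Tame D P fun z => k z * l z := by
  obtain ⟨hk, B, hB⟩ := hk
  obtain ⟨hl, C, hC⟩ := hl
  refine ⟨hk.mul hl, B * C, ?_⟩
  filter_upwards [hB, hC] with z h1 h2
  rw [abs_mul]
  exact mul_le_mul h1 h2 (abs_nonneg _) ((abs_nonneg _).trans h1)

lemma sub (hk : Tame D P k) (hl : Tame D P l) : Tame D P fun z => k z - l z := by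
  obtain ⟨hk, B, hB⟩ := hk
  obtain ⟨hl, C, hC⟩ := hl
  refine ⟨hk.sub hl, B + C, ?_⟩
  filter_upwards [hB, hC] with z h1 h2
  exact (abs_sub _ _).trans (add_le_add h1 h2)

lemma div (hk : Tame D P k) (hl : Measurable l) {b : ℝ} (hb : 0 < b)
    (hlb : ∀ᵐ z ∂(refLaw D P n), b ≤ l z) : Tame D P fun z => k z / l z := by
  obtain ⟨hk, B, hB⟩ := hk
  refine ⟨hk.div hl, B / b, ?_⟩
  filter_upwards [hB, hlb] with z h1 h2
  rw [abs_div, abs_of_pos (hb.trans_le h2)]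
  exact div_le_div₀ ((abs_nonneg _).trans h1) h1 hb h2

lemma integrable [IsProbabilityMeasure P] (hD : Standing D P)
    (hG : IsNuisOf D P G) (hb : IsDensLB D P G b) (hk : Tame D P k) :
    Integrable k (refLaw D P n) := by
  obtain ⟨hk, B, hB⟩ := hk
  exact integrable_refLaw hD hG hb hk hB

lemma memLp_covMed [IsProbabilityMeasure P] (hD : Standing D P)
    (hG : IsNuisOf D P G) (hk : Tame D P k) :
    MemLp (fun o => k (covMed o)) 2 (condLaw P n) := by
  obtain ⟨hk, B, hB⟩ := hk
  exact MemLp.of_bound (hk.comp measurable_covMed).aestronglyMeasurable B (ae_covMed hD hG hB)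

lemma memLp_integral_ref [IsProbabilityMeasure P] (hD : Standing D P)
    (hG : IsNuisOf D P G) (hb : IsDensLB D P G b) (hn : P {o | o.1 = n} ≠ 0)
    (hk : Tame D P k) :
    MemLp (fun o => ∫ m, k (cov o, m) ∂(ref D n)) 2 (condLaw P n) := by
  refine ⟨((measurable_integral_ref hD hk.1).comp measurable_cov).aestronglyMeasurable, ?_⟩
  exact (eLpNorm_integral_ref_le hD hG hb hn hk.1).trans_lt
    (ENNReal.mul_lt_top ENNReal.coe_lt_top (hk.memLp_covMed hD hG).2)

lemma memLp_ipw_blockInt [IsProbabilityMeasure P] (hD : Standing D P)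
    (hG : IsNuisOf D P G) (hb : IsDensLB D P G b) (V : Finset (Fin K × Fin n)) (a : Bool) {B : ℝ}
    (hB0 : 0 ≤ B) (hB : ∀ᵐ z ∂(refLaw D P n), |G.sub n Vᶜ a z.1 (Vᶜ.restrict z.2)| ≤ B)
    (hk : Tame D P k) :
    MemLp (fun o => ipw D a (trt o) * blockInt D V k (covMed o)) 2 (condLaw P n) := by
  obtain ⟨c, hc⟩ := eLpNorm_ipw_blockInt_le hD hG hb V a hB0 hB
  refine ⟨((measurable_ipw a).comp measurable_trt |>.mul
    ((measurable_blockInt hD V hk.1).comp measurable_covMed)).aestronglyMeasurable, ?_⟩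
  exact (hc k hk.1).trans_lt (ENNReal.mul_lt_top ENNReal.coe_lt_top (hk.memLp_covMed hD hG).2)

end Tame

lemma memLp_bdd_mul {α : Type*} [MeasurableSpace α] {ν : Measure α} {f g : α → ℝ}
    (hg : MemLp g 2 ν) (hf : Measurable f) {B : ℝ} (hB : ∀ᵐ x ∂ν, |f x| ≤ B) :
    MemLp (fun x => f x * g x) 2 ν := by
  refine MemLp.of_le_mul (c := B) hg (hf.aestronglyMeasurable.mul hg.1) ?_
  filter_upwards [hB] with x hx
  rw [norm_mul]
  exact mul_le_mul_of_nonneg_right hx (norm_nonneg _)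

lemma abs_ipw_le (hD : Standing D P) (a A : Bool) : |ipw D a A| ≤ 1 / prob D a := by
  rw [abs_of_nonneg (ipw_nonneg hD a A)]
  exact ipw_le hD a A

lemma memLp_ipw_mul (hD : Standing D P) (a : Bool) {F : Dat K 𝒳 𝒱 n → ℝ}
    (hF : MemLp F 2 (condLaw P n)) :
    MemLp (fun o => ipw D a (trt o) * F o) 2 (condLaw P n) :=
  memLp_bdd_mul hF ((measurable_ipw a).comp measurable_trt)
    (ae_of_all _ fun _ => abs_ipw_le hD a _)

lemma memLp_resTerm [IsProbabilityMeasure P] (hD : Standing D P) (hG : IsNuisOf D P G)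
    (a : Bool) (j : Fin n) {r e : Cov 𝒳 𝒱 n × Med K n → ℝ} (hr : Tame D P r)
    (he : Tame D P e) : MemLp (resTerm D a j r e) 2 (condLaw P n) := by
  refine memLp_ipw_mul hD a ?_
  obtain ⟨hr, B, hB⟩ := hr
  exact memLp_bdd_mul ((hD.second_moment n j).sub (he.memLp_covMed hD hG))
    (hr.comp measurable_covMed) (ae_covMed hD hG hB)

/-- Weighted outcome residuals have the mean that results from replacing the outcome by its
conditional mean. -/
lemma integral_resTerm [IsProbabilityMeasure P] (hD : Standing D P) (hG : IsNuisOf D P G)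
    (a : Bool) (j : Fin n) {r e : Cov 𝒳 𝒱 n × Med K n → ℝ} (hr : Tame D P r)
    (he : Tame D P e) (hη : Tame D P fun z => G.eta n j a z.1 z.2) {ω : Cov 𝒳 𝒱 n → ℝ}
    (hω : Tame D P fun z : Cov 𝒳 𝒱 n × Med K n => ω z.1) :
    ∫ o, ω (cov o) * resTerm D a j r e o ∂(condLaw P n) =
      ∫ z, ω z.1 * (r z * (G.eta n j a z.1 z.2 - e z) * G.dens n a z.1 z.2) ∂(refLaw D P n) := by
  have hωr := hω.mul hr
  obtain ⟨hm, B, hB⟩ := hωr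
  have hB1 : ∀ᵐ o ∂(condLaw P n),
      |ipw D a (trt o) * (ω (cov o) * r (cov o, med o))| ≤ 1 / prob D a * B := by
    filter_upwards [ae_covMed hD hG hB] with o ho
    rw [abs_mul]
    exact mul_le_mul (abs_ipw_le hD a _) ho (abs_nonneg _) (one_div_pos.2 (prob_pos hD a)).le
  have hm1 : Measurable fun x : Bool × Cov 𝒳 𝒱 n × Med K n =>
      ipw D a x.1 * (ω x.2.1 * r x.2) :=
    ((measurable_ipw a).comp measurable_fst).mul (hm.comp measurable_snd)
  have h0 := integral_mul_resid hD hG j hm1 hB1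
  have hT := hω.mul (hr.mul (hη.sub he))
  have h1 : ∀ o : Dat K 𝒳 𝒱 n, ω (cov o) * resTerm D a j r e o =
      ipw D a (trt o) * (ω (cov o) * r (cov o, med o)) * resid G j o
      + ipw D a (trt o) *
        (ω (cov o) * (r (covMed o) * (G.eta n j a (cov o) (med o) - e (covMed o)))) := by
    intro o
    rw [resTerm_eq G]
    simp only [covMed]
    ring
  rw [integral_congr_ae (ae_of_all _ h1), integral_add, h0, zero_add, ← integral_armLaw hD]
  · refine (integral_covMed_armLaw hD hG a hT.1).trans ?_
    refine integral_congr_ae (ae_of_all _ fun z => ?_)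
    dsimp only
    ring
  · exact (memLp_bdd_mul (memLp_resid hD hG j) (hm1.comp measurable_tcm) hB1).integrable
      (by norm_num)
  · exact (memLp_ipw_mul hD a (hT.memLp_covMed hD hG)).integrable (by norm_num)

lemma integral_weight_blockInt [IsProbabilityMeasure P] (hD : Standing D P) (hG : IsNuisOf D P G)
    (hb : IsDensLB D P G b) (V : Finset (Fin K × Fin n)) (a : Bool)
    {k : Cov 𝒳 𝒱 n × Med K n → ℝ} (hk : Tame D P k)
    (hs : Tame D P fun z => G.sub n Vᶜ a z.1 (Vᶜ.restrict z.2)) {ω : Cov 𝒳 𝒱 n → ℝ}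
    (hω : Tame D P fun z : Cov 𝒳 𝒱 n × Med K n => ω z.1) :
    ∫ o, ω (cov o) * (ipw D a (trt o) * blockInt D V k (covMed o)) ∂(condLaw P n) =
      ∫ z, ω z.1 * (k z * G.sub n Vᶜ a z.1 (Vᶜ.restrict z.2)) ∂(refLaw D P n) := by
  have h1 : ∀ o : Dat K 𝒳 𝒱 n, ω (cov o) * (ipw D a (trt o) * blockInt D V k (covMed o)) =
      ipw D a (trt o) * blockInt D V (fun z => ω z.1 * k z) (covMed o) := by
    intro o
    rw [mul_left_comm]
    congr 1
    exact (integral_const_mul _ _).symm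
  rw [integral_congr_ae (ae_of_all _ h1), ← integral_armLaw hD,
    integral_blockInt hD hG V a (hω.mul hk).1 (((hω.mul hk).mul hs).integrable hD hG hb)]
  simp only [mul_assoc]

lemma integral_weight_ipw [IsProbabilityMeasure P] (hD : Standing D P) (hG : IsNuisOf D P G)
    (a : Bool) {k : Cov 𝒳 𝒱 n × Med K n → ℝ} (hk : Tame D P k) {ω : Cov 𝒳 𝒱 n → ℝ}
    (hω : Tame D P fun z : Cov 𝒳 𝒱 n × Med K n => ω z.1) :
    ∫ o, ω (cov o) * (ipw D a (trt o) * k (covMed o)) ∂(condLaw P n) =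
      ∫ z, ω z.1 * (k z * G.dens n a z.1 z.2) ∂(refLaw D P n) := by
  have h1 : ∀ o : Dat K 𝒳 𝒱 n, ω (cov o) * (ipw D a (trt o) * k (covMed o)) =
      ipw D a (trt o) * (ω (cov o) * k (covMed o)) := fun o => mul_left_comm _ _ _
  rw [integral_congr_ae (ae_of_all _ h1), ← integral_armLaw hD]
  refine (integral_covMed_armLaw hD hG a (hω.mul hk).1).trans ?_
  simp only [mul_assoc]

lemma integral_weight_ref [IsProbabilityMeasure P] (hD : Standing D P) (hG : IsNuisOf D P G)
    (hb : IsDensLB D P G b) {k : Cov 𝒳 𝒱 n × Med K n → ℝ} (hk : Tame D P k)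
    {ω : Cov 𝒳 𝒱 n → ℝ} (hω : Tame D P fun z : Cov 𝒳 𝒱 n × Med K n => ω z.1) :
    ∫ o, ω (cov o) * ∫ m, k (cov o, m) ∂(ref D n) ∂(condLaw P n) =
      ∫ z, ω z.1 * k z ∂(refLaw D P n) := by
  rw [← integral_cov_eq hD (hω.mul hk).1 ((hω.mul hk).integrable hD hG hb)]
  simp only [integral_const_mul]

lemma integral_weight_ipw_ref [IsProbabilityMeasure P] (hD : Standing D P) (hG : IsNuisOf D P G)
    (hb : IsDensLB D P G b) (a : Bool) {k : Cov 𝒳 𝒱 n × Med K n → ℝ} (hk : Tame D P k)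
    {ω : Cov 𝒳 𝒱 n → ℝ} (hωm : Measurable ω)
    (hω : Tame D P fun z : Cov 𝒳 𝒱 n × Med K n => ω z.1) :
    ∫ o, ω (cov o) * (ipw D a (trt o) * ∫ m, k (cov o, m) ∂(ref D n)) ∂(condLaw P n) =
      ∫ z, ω z.1 * k z ∂(refLaw D P n) := by
  rw [← integral_weight_ref hD hG hb hk hω]
  simp only [mul_left_comm (ω _) (ipw D a _)]
  rw [← integral_armLaw hD]
  exact integral_cov_armLaw hD a (hωm.mul (measurable_integral_ref hD hk.1))

/-! ### Differences of the terms in `L²` -/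

/-- The `L²` size of a function of covariates and mediators given `N = n`. -/
def nrm (P : Measure (Obs K 𝒳 𝒱)) (k : Cov 𝒳 𝒱 n × Med K n → ℝ) : ℝ≥0∞ :=
  eLpNorm (fun o => k (covMed o)) 2 (condLaw P n)

lemma nrm_le_sum [IsProbabilityMeasure P] (hD : Standing D P) (hG : IsNuisOf D P G)
    {ι : Type*} [Fintype ι] {B : ℝ} {k : Cov 𝒳 𝒱 n × Med K n → ℝ}
    {h : ι → Cov 𝒳 𝒱 n × Med K n → ℝ} (hm : ∀ i, Measurable (h i))
    (hk : ∀ᵐ z ∂(refLaw D P n), |k z| ≤ B * ∑ i, |h i z|) :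
    nrm P k ≤ B.toNNReal * ∑ i, nrm P (h i) := by
  unfold nrm
  have h1 : eLpNorm (fun o => k (covMed o)) 2 (condLaw P n) ≤
      B.toNNReal * eLpNorm (∑ i, fun o => |h i (covMed o)|) 2 (condLaw P n) := by
    refine eLpNorm_le_nnreal_smul_eLpNorm_of_ae_le_mul ?_ 2
    filter_upwards [ae_covMed hD hG hk] with o ho
    rw [← NNReal.coe_le_coe, NNReal.coe_mul, coe_nnnorm, coe_nnnorm, Real.norm_eq_abs,
      Finset.sum_apply, Real.norm_of_nonneg (Finset.sum_nonneg fun i _ => abs_nonneg _)]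
    exact ho.trans (mul_le_mul_of_nonneg_right (Real.le_coe_toNNReal _)
      (Finset.sum_nonneg fun i _ => abs_nonneg _))
  refine h1.trans ?_
  gcongr
  refine (eLpNorm_sum_le (fun i _ => ((hm i).comp measurable_covMed).abs.aestronglyMeasurable)
    (by norm_num)).trans (le_of_eq ?_)
  exact Finset.sum_congr rfl fun i _ => eLpNorm_norm fun o => h i (covMed o)

/-- In `L²`, the weighted residuals depend Lipschitz continuously on the weight `r` and on the
regression function `e`, at the true regression function. The outcome may be unbounded: only its
conditional variance enters. -/
lemma eLpNorm_resTerm_sub_le [IsProbabilityMeasure P] (hD : Standing D P) (hG : IsNuisOf D P G)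
    (hvar : CondVarBdd P G) (a : Bool) (j : Fin n) (B : ℝ)
    {r : Cov 𝒳 𝒱 n × Med K n → ℝ} (hr : Tame D P r) :
    ∃ C : ℝ≥0, ∀ r' e' : Cov 𝒳 𝒱 n × Med K n → ℝ, Measurable r' → Measurable e' →
      (∀ᵐ z ∂(refLaw D P n), |r' z| ≤ B) →
      eLpNorm (fun o => resTerm D a j r' e' o -
          resTerm D a j r (fun z => G.eta n j a z.1 z.2) o) 2 (condLaw P n) ≤
        C * (nrm P (fun z => r' z - r z) + nrm P (fun z => e' z - G.eta n j a z.1 z.2)) := by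
  obtain ⟨cv, hcv⟩ := eLpNorm_mul_resid_le hD hG hvar
  set c₁ : ℝ≥0 := Real.toNNReal (1 / prob D a)
  refine ⟨c₁ * (cv + B.toNNReal), fun r' e' hr' he' hB => ?_⟩
  have hηm := hG.measurable_eta n j a
  have h1 : (fun o => resTerm D a j r' e' o -
      resTerm D a j r (fun z => G.eta n j a z.1 z.2) o) =
      fun o => ipw D a (trt o) * ((r' (covMed o) - r (covMed o)) * resid G j o
        - r' (covMed o) * (e' (covMed o) - G.eta n j a (cov o) (med o))) := by
    funext o
    rw [resTerm_eq G, resTerm_eq G]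
    simp only [covMed]
    ring
  rw [h1]
  refine (eLpNorm_ipw_mul_le hD a).trans ?_
  rw [ENNReal.coe_mul, mul_assoc]
  refine mul_le_mul_right ?_ _
  have hm1 : Measurable fun o : Dat K 𝒳 𝒱 n => (r' (covMed o) - r (covMed o)) * resid G j o :=
    ((hr'.sub hr.1).comp measurable_covMed).mul (measurable_resid hG j)
  have hm2 : Measurable fun o : Dat K 𝒳 𝒱 n =>
      r' (covMed o) * (e' (covMed o) - G.eta n j a (cov o) (med o)) :=
    (hr'.mul (he'.sub hηm)).comp measurable_covMed
  refine (eLpNorm_sub_le hm1.aestronglyMeasurable hm2.aestronglyMeasurable (by norm_num)).trans ?_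
  have hT : Tame D P fun z => r' z - r z := Tame.sub ⟨hr', B, hB⟩ hr
  obtain ⟨hTm, B₂, hB₂⟩ := hT
  have h2 : eLpNorm (fun o => (r' (covMed o) - r (covMed o)) * resid G j o) 2 (condLaw P n) ≤
      cv * eLpNorm (fun o => r' (covMed o) - r (covMed o)) 2 (condLaw P n) :=
    hcv n j (fun x => r' x.2 - r x.2) (hTm.comp measurable_snd) ⟨B₂, ae_covMed hD hG hB₂⟩
  have h3 : eLpNorm (fun o => r' (covMed o) * (e' (covMed o) - G.eta n j a (cov o) (med o))) 2
      (condLaw P n) ≤ B.toNNReal *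
        eLpNorm (fun o => e' (covMed o) - G.eta n j a (cov o) (med o)) 2 (condLaw P n) := by
    refine eLpNorm_le_nnreal_smul_eLpNorm_of_ae_le_mul ?_ 2
    filter_upwards [ae_covMed hD hG hB] with o ho
    rw [nnnorm_mul]
    gcongr
    rw [← NNReal.coe_le_coe, coe_nnnorm]
    exact (Real.norm_eq_abs _).le.trans (ho.trans (Real.le_coe_toNNReal _))
  calc _ ≤ _ := add_le_add h2 h3
    _ ≤ _ := by
      rw [ENNReal.coe_add, add_mul]
      gcongr
      · exact le_self_add
      · exact le_add_self

lemma eLpNorm_blockInt_sub_le [IsProbabilityMeasure P] (hD : Standing D P) (hG : IsNuisOf D P G)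
    (hb : IsDensLB D P G b) (V : Finset (Fin K × Fin n)) (a : Bool) {B : ℝ} (hB0 : 0 ≤ B)
    (hB : ∀ᵐ z ∂(refLaw D P n), |G.sub n Vᶜ a z.1 (Vᶜ.restrict z.2)| ≤ B) :
    ∃ C : ℝ≥0, ∀ k k' : Cov 𝒳 𝒱 n × Med K n → ℝ, Tame D P k → Tame D P k' →
      eLpNorm (fun o => ipw D a (trt o) * blockInt D V k' (covMed o) -
          ipw D a (trt o) * blockInt D V k (covMed o)) 2 (condLaw P n) ≤
        C * nrm P (fun z => k' z - k z) := by
  obtain ⟨C, hC⟩ := eLpNorm_ipw_blockInt_le hD hG hb V a hB0 hB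
  refine ⟨C, fun k k' ⟨hk, B₁, hB₁⟩ ⟨hk', B₂, hB₂⟩ => ?_⟩
  refine (eLpNorm_congr_ae ?_).trans_le (hC (fun z => k' z - k z) (hk'.sub hk))
  have h1 := blockInt_sub hD hG hb V a hk' hk hB₂ hB₁
  rw [armLaw, ae_withDensity_iff (measurable_weight a)] at h1
  filter_upwards [h1] with o ho
  rw [← mul_sub]
  by_cases h : ipw D a (trt o) = 0
  · rw [h, zero_mul, zero_mul]
  · rw [ho (by simpa using lt_of_le_of_ne (ipw_nonneg hD _ _) (Ne.symm h))]

lemma eLpNorm_integral_ref_sub_le [IsProbabilityMeasure P] (hD : Standing D P)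
    (hG : IsNuisOf D P G) (hb : IsDensLB D P G b) (hn : P {o | o.1 = n} ≠ 0)
    {k k' : Cov 𝒳 𝒱 n × Med K n → ℝ} (hk : Tame D P k) (hk' : Tame D P k') :
    eLpNorm (fun o => ∫ m, k' (cov o, m) ∂(ref D n) - ∫ m, k (cov o, m) ∂(ref D n)) 2
      (condLaw P n) ≤
      refConst D b * nrm P (fun z => k' z - k z) := by
  obtain ⟨hk, B₁, hB₁⟩ := hk
  obtain ⟨hk', B₂, hB₂⟩ := hk'
  refine (eLpNorm_congr_ae ?_).trans_le
    (eLpNorm_integral_ref_le hD hG hb hn (k := fun z => k' z - k z) (hk'.sub hk))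
  filter_upwards [ae_integrable_ref hD hG hb hn hk hB₁,
    ae_integrable_ref hD hG hb hn hk' hB₂] with o h1 h2
  exact (integral_sub h2 h1).symm

end Terms

/-! ### Influence functions at a fixed cluster size -/

section Defs

variable {K n : ℕ} {𝒳 𝒱 : Type*}

/-- `η_j(a, ·)` as a function of covariates and mediators. -/
def etaFn (G : Nuis K 𝒳 𝒱) (j : Fin n) (a : Bool) (z : Cov 𝒳 𝒱 n × Med K n) : ℝ :=
  G.eta n j a z.1 z.2

/-- `f(· | a, ·)` as a function of covariates and mediators. -/
def densFn (G : Nuis K 𝒳 𝒱) (a : Bool) (z : Cov 𝒳 𝒱 n × Med K n) : ℝ := G.dens n a z.1 z.2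

/-- `f(m_U | a, ·)` as a function of covariates and mediators. -/
def subFn (G : Nuis K 𝒳 𝒱) (U : Finset (Fin K × Fin n)) (a : Bool)
    (z : Cov 𝒳 𝒱 n × Med K n) : ℝ :=
  G.sub n U a z.1 (U.restrict z.2)

/-- The contribution of individual `j` to the influence function of a split functional. -/
def psiSplit (D : Design K 𝒱) (G : Nuis K 𝒳 𝒱) (j : Fin n) (U : Finset (Fin K × Fin n))
    (o : Dat K 𝒳 𝒱 n) : ℝ :=
  ipw D false (trt o) * blockInt D Uᶜ (fun z => etaFn G j true z * subFn G Uᶜ true z) (covMed o)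
    + (1 - ∑ a : Bool, ipw D a (trt o)) *
      (∫ m, etaFn G j true (cov o, m) * subFn G U false (cov o, m) * subFn G Uᶜ true (cov o, m)
        ∂(ref D n))
    + resTerm D true j
      (fun z => subFn G U false z * subFn G Uᶜ true z / densFn G true z) (etaFn G j true) o
    + ipw D true (trt o) *
      blockInt D U (fun z => etaFn G j true z * subFn G U false z) (covMed o)

/-- The contribution of individual `j` to the influence function of `θ₁(a*, a', …, a')`. -/
def psiI (D : Design K 𝒱) (G : Nuis K 𝒳 𝒱) (j : Fin n) (aStar a' : Bool)
    (o : Dat K 𝒳 𝒱 n) : ℝ :=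
  resTerm D aStar j (fun z => densFn G a' z / densFn G aStar z) (etaFn G j aStar) o
    + ipw D a' (trt o) * etaFn G j aStar (covMed o)
    + (1 - ipw D a' (trt o)) *
      (∫ m, etaFn G j aStar (cov o, m) * densFn G a' (cov o, m) ∂(ref D n))

lemma lam2_eq_blockInt (D : Design K 𝒱) (G : Nuis K 𝒳 𝒱) (j : Fin n)
    (V : Finset (Fin K × Fin n)) (a : Bool) (c : Cov 𝒳 𝒱 n) (m : Med K n) :
    lam2 D G j V a c m = blockInt D V (fun z => etaFn G j true z * subFn G V a z) (c, m) := by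
  simp only [lam2, blockInt, etaFn, subFn, restrict_updateFinset]

lemma phiSplit_mk (D : Design K 𝒱) (G : Nuis K 𝒳 𝒱) (U : Split K) (o : Dat K 𝒳 𝒱 n) :
    phiSplit D G U ⟨n, o⟩ = D.w (cov o).2 n / n * ∑ j, psiSplit D G j (U n j) o := by
  simp only [phiSplit, lam2_eq_blockInt]
  congr 1
  refine Finset.sum_congr rfl fun j _ => ?_
  unfold psiSplit resTerm
  simp only [lam1, lam1Kernel, lam3, etaFn, subFn, densFn, covMed]
  ring

lemma phiI_mk (D : Design K 𝒱) (G : Nuis K 𝒳 𝒱) (aStar a' : Bool) (o : Dat K 𝒳 𝒱 n) :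
    phiI D G aStar a' ⟨n, o⟩ = D.w (cov o).2 n / n * ∑ j, psiI D G j aStar a' o := by
  simp only [phiI]
  congr 1
  refine Finset.sum_congr rfl fun j _ => ?_
  unfold psiI resTerm
  simp only [etaStar, etaStarKernel, etaFn, densFn, covMed]
  ring

lemma subFn_compl_compl (G : Nuis K 𝒳 𝒱) (U : Finset (Fin K × Fin n)) (a : Bool) :
    subFn G Uᶜᶜ a = subFn G U a := by rw [compl_compl]

end Defs

section Stratum

variable {K : ℕ} {𝒳 𝒱 : Type*} [MeasurableSpace 𝒳] [MeasurableSpace 𝒱] {n : ℕ}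
variable {D : Design K 𝒱} {P : Measure (Obs K 𝒳 𝒱)} {G : Nuis K 𝒳 𝒱} {b : ℝ}

lemma MeasNuis.measurable_etaFn (hG : MeasNuis G) (j : Fin n) (a : Bool) :
    Measurable (etaFn G j a) := hG.measurable_eta n j a

lemma MeasNuis.measurable_densFn (hG : MeasNuis G) (a : Bool) :
    Measurable (densFn G a : Cov 𝒳 𝒱 n × Med K n → ℝ) := hG.measurable_dens n a

lemma MeasNuis.measurable_subFn (hG : MeasNuis G) (U : Finset (Fin K × Fin n)) (a : Bool) :
    Measurable (subFn G U a) := (hG.measurable_sub n U a).comp (measurable_restrict_snd U)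

/-- The bounds on nuisance functions that are used for the split functionals. -/
structure SplitBdd (D : Design K 𝒱) (P : Measure (Obs K 𝒳 𝒱)) (j : Fin n)
    (U : Finset (Fin K × Fin n)) (B b : ℝ) (G : Nuis K 𝒳 𝒱) : Prop where
  meas : MeasNuis G
  eta : ∀ᵐ z ∂(refLaw D P n), |etaFn G j true z| ≤ B
  dens : ∀ᵐ z ∂(refLaw D P n), |densFn G true z| ≤ B
  low : ∀ᵐ z ∂(refLaw D P n), b ≤ densFn G true z
  block : ∀ᵐ z ∂(refLaw D P n), |subFn G U false z| ≤ B
  compl : ∀ᵐ z ∂(refLaw D P n), |subFn G Uᶜ true z| ≤ B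

/-- The bounds on nuisance functions that are used for the functionals `θ₁`. -/
structure ArmBdd (D : Design K 𝒱) (P : Measure (Obs K 𝒳 𝒱)) (j : Fin n)
    (aStar a' : Bool) (B b : ℝ) (G : Nuis K 𝒳 𝒱) : Prop where
  meas : MeasNuis G
  eta : ∀ᵐ z ∂(refLaw D P n), |etaFn G j aStar z| ≤ B
  dens : ∀ᵐ z ∂(refLaw D P n), |densFn G aStar z| ≤ B
  low : ∀ᵐ z ∂(refLaw D P n), b ≤ densFn G aStar z
  dens' : ∀ᵐ z ∂(refLaw D P n), |densFn G a' z| ≤ B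

variable {j : Fin n} {U : Finset (Fin K × Fin n)} {B : ℝ} {G' : Nuis K 𝒳 𝒱}

namespace SplitBdd

lemma tame_eta (h : SplitBdd D P j U B b G) : Tame D P (etaFn G j true) :=
  ⟨h.meas.measurable_etaFn j true, B, h.eta⟩

lemma tame_dens (h : SplitBdd D P j U B b G) : Tame D P (densFn G true : _ × Med K n → ℝ) :=
  ⟨h.meas.measurable_densFn true, B, h.dens⟩

lemma tame_block (h : SplitBdd D P j U B b G) : Tame D P (subFn G U false) :=
  ⟨h.meas.measurable_subFn U false, B, h.block⟩

lemma tame_compl (h : SplitBdd D P j U B b G) : Tame D P (subFn G Uᶜ true) :=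
  ⟨h.meas.measurable_subFn Uᶜ true, B, h.compl⟩

lemma tame_ratio (h : SplitBdd D P j U B b G) (hb : 0 < b) :
    Tame D P fun z => subFn G U false z * subFn G Uᶜ true z / densFn G true z :=
  (h.tame_block.mul h.tame_compl).div h.tame_dens.1 hb h.low

end SplitBdd

lemma abs_one_sub_sum_ipw_le (hD : Standing D P) (A : Bool) :
    |1 - ∑ a : Bool, ipw D a A| ≤ 1 + (1 / prob D true + 1 / prob D false) := by
  rw [Fintype.sum_bool]
  refine (abs_sub _ _).trans ?_
  rw [abs_one]
  gcongr
  exact (abs_add_le _ _).trans (add_le_add (abs_ipw_le hD _ _) (abs_ipw_le hD _ _))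

lemma measurable_one_sub_sum_ipw : Measurable fun o : Dat K 𝒳 𝒱 n =>
    1 - ∑ a : Bool, ipw D a (trt o) := by fun_prop

lemma memLp_psiSplit_terms [IsProbabilityMeasure P] (hD : Standing D P) (hG : IsNuisOf D P G)
    {b₀ : ℝ} (hb₀ : IsDensLB D P G b₀) (hn : P {o | o.1 = n} ≠ 0) (hb : 0 < b) (hB : 0 ≤ B)
    (hGB : SplitBdd D P j U B b G) (h : SplitBdd D P j U B b G') :
    MemLp (fun o => ipw D false (trt o) *
        blockInt D Uᶜ (fun z => etaFn G' j true z * subFn G' Uᶜ true z) (covMed o)) 2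
        (condLaw P n) ∧
      MemLp (fun o => (1 - ∑ a : Bool, ipw D a (trt o)) *
        (∫ m, etaFn G' j true (cov o, m) * subFn G' U false (cov o, m) *
          subFn G' Uᶜ true (cov o, m) ∂(ref D n))) 2 (condLaw P n) ∧
      MemLp (resTerm D true j (fun z => subFn G' U false z * subFn G' Uᶜ true z /
        densFn G' true z) (etaFn G' j true)) 2 (condLaw P n) ∧
      MemLp (fun o => ipw D true (trt o) *
        blockInt D U (fun z => etaFn G' j true z * subFn G' U false z) (covMed o)) 2
        (condLaw P n) := by
  refine ⟨?_, ?_, ?_, ?_⟩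
  · refine Tame.memLp_ipw_blockInt hD hG hb₀ Uᶜ false hB ?_ (h.tame_eta.mul h.tame_compl)
    have h := hGB.block
    rw [← subFn_compl_compl G U false] at h
    exact h
  · exact memLp_bdd_mul (((h.tame_eta.mul h.tame_block).mul h.tame_compl).memLp_integral_ref
      hD hG hb₀ hn) measurable_one_sub_sum_ipw
      (ae_of_all _ fun o => abs_one_sub_sum_ipw_le hD _)
  · exact memLp_resTerm hD hG true j (h.tame_ratio hb) h.tame_eta
  · exact Tame.memLp_ipw_blockInt hD hG hb₀ U true hB hGB.compl (h.tame_eta.mul h.tame_block)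

lemma memLp_psiSplit [IsProbabilityMeasure P] (hD : Standing D P) (hG : IsNuisOf D P G)
    {b₀ : ℝ} (hb₀ : IsDensLB D P G b₀) (hn : P {o | o.1 = n} ≠ 0) (hb : 0 < b) (hB : 0 ≤ B)
    (hGB : SplitBdd D P j U B b G) (h : SplitBdd D P j U B b G') :
    MemLp (psiSplit D G' j U) 2 (condLaw P n) := by
  obtain ⟨h1, h2, h3, h4⟩ := memLp_psiSplit_terms hD hG hb₀ hn hb hB hGB h
  exact ((h1.add h2).add h3).add h4

lemma integral_add_four {α : Type*} [MeasurableSpace α] {ν : Measure α} {f₁ f₂ f₃ f₄ : α → ℝ}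
    (h₁ : Integrable f₁ ν) (h₂ : Integrable f₂ ν) (h₃ : Integrable f₃ ν) (h₄ : Integrable f₄ ν) :
    ∫ x, (f₁ x + f₂ x + f₃ x + f₄ x) ∂ν =
      ∫ x, f₁ x ∂ν + ∫ x, f₂ x ∂ν + ∫ x, f₃ x ∂ν + ∫ x, f₄ x ∂ν := by
  have h := integral_add ((h₁.add h₂).add h₃) h₄
  have h' := integral_add (h₁.add h₂) h₃
  have h'' := integral_add h₁ h₂
  simp only [Pi.add_apply] at h h' h''
  rw [h, h', h'']

/-- The bias of a one-step estimator of a split functional is a sum of products of errors. -/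
lemma integral_psiSplit [IsProbabilityMeasure P] (hD : Standing D P) (hG : IsNuisOf D P G)
    {b₀ : ℝ} (hb₀ : IsDensLB D P G b₀) (hn : P {o | o.1 = n} ≠ 0) (hb : 0 < b) (hB : 0 ≤ B)
    (hGB : SplitBdd D P j U B b G) (h : SplitBdd D P j U B b G') {ω : Cov 𝒳 𝒱 n → ℝ}
    (hωm : Measurable ω) (hω : Tame D P fun z : Cov 𝒳 𝒱 n × Med K n => ω z.1) :
    ∫ o, ω (cov o) * psiSplit D G' j U o ∂(condLaw P n)
      - ∫ o, ω (cov o) * ∫ m, etaFn G j true (cov o, m) * subFn G U false (cov o, m) *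
          subFn G Uᶜ true (cov o, m) ∂(ref D n) ∂(condLaw P n) =
    ∫ z, ω z.1 * ((etaFn G j true z - etaFn G' j true z) *
        (subFn G' U false z * subFn G' Uᶜ true z / densFn G' true z * densFn G true z
          - subFn G U false z * subFn G Uᶜ true z)
      - etaFn G' j true z * (subFn G' U false z - subFn G U false z) *
        (subFn G' Uᶜ true z - subFn G Uᶜ true z)) ∂(refLaw D P n) := by
  obtain ⟨h1, h2, h3, h4⟩ := memLp_psiSplit_terms hD hG hb₀ hn hb hB hGB h
  obtain ⟨W, hW⟩ := hω.2
  have hWc : ∀ᵐ o ∂(condLaw P n), |ω (cov o)| ≤ W := ae_covMed hD hG hW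
  have hωc : Measurable fun o : Dat K 𝒳 𝒱 n => ω (cov o) := hωm.comp measurable_cov
  have int : ∀ {F : Dat K 𝒳 𝒱 n → ℝ}, MemLp F 2 (condLaw P n) →
      Integrable (fun o => ω (cov o) * F o) (condLaw P n) := fun hF =>
    (memLp_bdd_mul hF hωc hWc).integrable (by norm_num)
  have e1 := integral_weight_blockInt hD hG hb₀ Uᶜ false (h.tame_eta.mul h.tame_compl)
    (show Tame D P (subFn G Uᶜᶜ false) by rw [subFn_compl_compl]; exact hGB.tame_block) hω
  have e4 := integral_weight_blockInt hD hG hb₀ U true (h.tame_eta.mul h.tame_block)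
    hGB.tame_compl hω
  have e3 := integral_resTerm hD hG true j (h.tame_ratio hb) h.tame_eta hGB.tame_eta hω
  have hk := (h.tame_eta.mul h.tame_block).mul h.tame_compl
  have hk0 := (hGB.tame_eta.mul hGB.tame_block).mul hGB.tame_compl
  have m2 := hk.memLp_integral_ref hD hG hb₀ hn
  have e2 : ∫ o, ω (cov o) * ((1 - ∑ a : Bool, ipw D a (trt o)) *
        (∫ m, etaFn G' j true (cov o, m) * subFn G' U false (cov o, m) *
          subFn G' Uᶜ true (cov o, m) ∂(ref D n))) ∂(condLaw P n) =
      - ∫ z, ω z.1 * (etaFn G' j true z * subFn G' U false z * subFn G' Uᶜ true z)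
        ∂(refLaw D P n) := by
    have f0 := integral_weight_ref hD hG hb₀ hk hω
    have f1 := fun a => integral_weight_ipw_ref hD hG hb₀ a hk hωm hω
    have : ∀ o : Dat K 𝒳 𝒱 n, ω (cov o) * ((1 - ∑ a : Bool, ipw D a (trt o)) *
        (∫ m, etaFn G' j true (cov o, m) * subFn G' U false (cov o, m) *
          subFn G' Uᶜ true (cov o, m) ∂(ref D n))) =
        ω (cov o) * (∫ m, etaFn G' j true (cov o, m) * subFn G' U false (cov o, m) *
          subFn G' Uᶜ true (cov o, m) ∂(ref D n))
        - ω (cov o) * (ipw D true (trt o) * ∫ m, etaFn G' j true (cov o, m) *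
          subFn G' U false (cov o, m) * subFn G' Uᶜ true (cov o, m) ∂(ref D n))
        - ω (cov o) * (ipw D false (trt o) * ∫ m, etaFn G' j true (cov o, m) *
          subFn G' U false (cov o, m) * subFn G' Uᶜ true (cov o, m) ∂(ref D n)) := by
      intro o
      rw [Fintype.sum_bool]
      ring
    rw [integral_congr_ae (ae_of_all _ this), integral_sub, integral_sub, f0, f1, f1]
    · ring
    · exact int m2
    · exact int (memLp_ipw_mul hD true m2)
    · exact (int m2).sub (int (memLp_ipw_mul hD true m2))
    · exact int (memLp_ipw_mul hD false m2)
  have e5 := integral_weight_ref hD hG hb₀ hk0 hω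
  have hsum := integral_add_four (int h1) (int h2) (int h3) (int h4)
  simp only [← mul_add] at hsum
  change ∫ o, ω (cov o) * psiSplit D G' j U o ∂(condLaw P n) = _ at hsum
  rw [hsum, e1, e2, e3, e4, e5]
  have hu : ∀ z, G.sub n Uᶜᶜ false z.1 (Uᶜᶜ.restrict z.2) = subFn G U false z := fun z =>
    congrFun (subFn_compl_compl G U false) z
  simp only [hu]
  have i1 := (hω.mul ((h.tame_eta.mul h.tame_compl).mul hGB.tame_block)).integrable hD hG hb₀
  have i2 := (hω.mul hk).integrable hD hG hb₀
  have i3 := (hω.mul (((h.tame_ratio hb).mul (hGB.tame_eta.sub h.tame_eta)).mul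
    hGB.tame_dens)).integrable hD hG hb₀
  have i4 := (hω.mul ((h.tame_eta.mul h.tame_block).mul hGB.tame_compl)).integrable hD hG hb₀
  have i5 := (hω.mul hk0).integrable hD hG hb₀
  rw [← sub_eq_add_neg]
  refine Eq.trans (congrArg₂ _ (congrArg₂ _ (congrArg₂ _ (integral_sub i1 i2).symm rfl) rfl) rfl) ?_
  refine Eq.trans (congrArg₂ _ (congrArg₂ _ (integral_add (i1.sub i2) i3).symm rfl) rfl) ?_
  refine Eq.trans (congrArg₂ _ (integral_add ((i1.sub i2).add i3) i4).symm rfl) ?_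
  refine Eq.trans (integral_sub (((i1.sub i2).add i3).add i4) i5).symm ?_
  refine integral_congr_ae (ae_of_all _ fun z => ?_)
  simp only [Pi.add_apply, Pi.sub_apply, etaFn, densFn, subFn]
  ring

end Stratum

/-! ### Split functionals: bias and consistency of the estimated influence function -/

section SplitStratum

/-- The errors of the nuisance functions that enter a split functional. -/
def splitErr {K n : ℕ} {𝒳 𝒱 : Type*} (G' G : Nuis K 𝒳 𝒱) (j : Fin n) (U : Finset (Fin K × Fin n)) :
    Fin 4 → Cov 𝒳 𝒱 n × Med K n → ℝ :=
  ![fun z => etaFn G' j true z - etaFn G j true z, fun z => densFn G' true z - densFn G true z,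
    fun z => subFn G' Uᶜ true z - subFn G Uᶜ true z,
    fun z => subFn G' U false z - subFn G U false z]

lemma sum_abs_splitErr {K n : ℕ} {𝒳 𝒱 : Type*} (G' G : Nuis K 𝒳 𝒱) (j : Fin n)
    (U : Finset (Fin K × Fin n)) (z : Cov 𝒳 𝒱 n × Med K n) : ∑ i, |splitErr G' G j U i z| =
      |etaFn G' j true z - etaFn G j true z| + |densFn G' true z - densFn G true z| +
      |subFn G' Uᶜ true z - subFn G Uᶜ true z| + |subFn G' U false z - subFn G U false z| := by
  rw [Fin.sum_univ_four]
  rfl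

variable {K : ℕ} {𝒳 𝒱 : Type*} [MeasurableSpace 𝒳] [MeasurableSpace 𝒱] {n : ℕ}
variable {D : Design K 𝒱} {P : Measure (Obs K 𝒳 𝒱)} {G G' : Nuis K 𝒳 𝒱} {b B : ℝ}
variable {j : Fin n} {U : Finset (Fin K × Fin n)}

lemma SplitBdd.measurable_splitErr (h : SplitBdd D P j U B b G) (h' : SplitBdd D P j U B b G')
    (i : Fin 4) : Measurable (splitErr G' G j U i) := by
  fin_cases i
  · exact h'.tame_eta.1.sub h.tame_eta.1
  · exact h'.tame_dens.1.sub h.tame_dens.1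
  · exact h'.tame_compl.1.sub h.tame_compl.1
  · exact h'.tame_block.1.sub h.tame_block.1

lemma abs_mul_sub_mul_le {B x x' y y' : ℝ} (hx' : |x'| ≤ B) (hy : |y| ≤ B) :
    |x' * y' - x * y| ≤ B * (|x' - x| + |y' - y|) := by
  have h : x' * y' - x * y = x' * (y' - y) + (x' - x) * y := by ring
  rw [h]
  refine (abs_add_le _ _).trans ?_
  rw [abs_mul, abs_mul]
  nlinarith [abs_nonneg (y' - y), abs_nonneg (x' - x)]

lemma abs_div_sub_div_le {B b x x' f f' : ℝ} (hb : 0 < b) (hx : |x| ≤ B) (hf : b ≤ f)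
    (hf' : b ≤ f') : |x' / f' - x / f| ≤ b⁻¹ * |x' - x| + B / b ^ 2 * |f' - f| := by
  have hf0 : 0 < f := hb.trans_le hf
  have hf0' : 0 < f' := hb.trans_le hf'
  have h : x' / f' - x / f = f'⁻¹ * (x' - x) - x / (f' * f) * (f' - f) := by
    field_simp
    ring
  rw [h]
  refine (abs_sub _ _).trans ?_
  rw [abs_mul, abs_mul, abs_div, abs_of_pos (inv_pos.2 hf0'), abs_of_pos (mul_pos hf0' hf0)]
  have hB : 0 ≤ B := (abs_nonneg x).trans hx
  rw [pow_two]
  gcongr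

namespace SplitBdd

lemma nrm_eta_le : nrm P (fun z => etaFn G' j true z - etaFn G j true z) ≤
    ∑ i, nrm P (splitErr G' G j U i) := by
  rw [Fin.sum_univ_four, add_assoc, add_assoc]
  exact le_self_add

lemma nrm_eta_compl_le [IsProbabilityMeasure P] (hD : Standing D P)
    (hG : IsNuisOf D P G) (hB : 0 ≤ B) (hGB : SplitBdd D P j U B b G)
    (h : SplitBdd D P j U B b G') :
    nrm P (fun z => etaFn G' j true z * subFn G' Uᶜ true z
      - etaFn G j true z * subFn G Uᶜ true z) ≤ B.toNNReal * ∑ i, nrm P (splitErr G' G j U i) := by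
  refine nrm_le_sum hD hG (hGB.measurable_splitErr h) ?_
  filter_upwards [h.eta, hGB.compl] with z z1 z2
  rw [sum_abs_splitErr]
  refine (abs_mul_sub_mul_le z1 z2).trans (mul_le_mul_of_nonneg_left ?_ hB)
  linarith [abs_nonneg (densFn G' true z - densFn G true z),
    abs_nonneg (subFn G' U false z - subFn G U false z)]

lemma nrm_eta_block_le [IsProbabilityMeasure P] (hD : Standing D P)
    (hG : IsNuisOf D P G) (hB : 0 ≤ B) (hGB : SplitBdd D P j U B b G)
    (h : SplitBdd D P j U B b G') :
    nrm P (fun z => etaFn G' j true z * subFn G' U false z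
      - etaFn G j true z * subFn G U false z) ≤ B.toNNReal * ∑ i, nrm P (splitErr G' G j U i) := by
  refine nrm_le_sum hD hG (hGB.measurable_splitErr h) ?_
  filter_upwards [h.eta, hGB.block] with z z1 z2
  rw [sum_abs_splitErr]
  refine (abs_mul_sub_mul_le z1 z2).trans (mul_le_mul_of_nonneg_left ?_ hB)
  linarith [abs_nonneg (densFn G' true z - densFn G true z),
    abs_nonneg (subFn G' Uᶜ true z - subFn G Uᶜ true z)]

lemma nrm_product_le [IsProbabilityMeasure P] (hD : Standing D P)
    (hG : IsNuisOf D P G) (hB : 0 ≤ B) (hGB : SplitBdd D P j U B b G)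
    (h : SplitBdd D P j U B b G') :
    nrm P (fun z => etaFn G' j true z * subFn G' U false z * subFn G' Uᶜ true z
      - etaFn G j true z * subFn G U false z * subFn G Uᶜ true z) ≤
      (B * B + B).toNNReal * ∑ i, nrm P (splitErr G' G j U i) := by
  refine nrm_le_sum hD hG (hGB.measurable_splitErr h) ?_
  filter_upwards [h.eta, hGB.block, hGB.compl, h.block] with z z1 z2 z3 z4
  rw [sum_abs_splitErr]
  have e1 := abs_mul_sub_mul_le (x := etaFn G j true z) (y' := subFn G' U false z) z1 z2
  have e2 : |etaFn G' j true z * subFn G' U false z| ≤ B * B := by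
    rw [abs_mul]
    exact mul_le_mul z1 z4 (abs_nonneg _) hB
  have e3 : etaFn G' j true z * subFn G' U false z * subFn G' Uᶜ true z
      - etaFn G j true z * subFn G U false z * subFn G Uᶜ true z =
      etaFn G' j true z * subFn G' U false z * (subFn G' Uᶜ true z - subFn G Uᶜ true z) +
      (etaFn G' j true z * subFn G' U false z - etaFn G j true z * subFn G U false z) *
        subFn G Uᶜ true z := by ring
  rw [e3]
  refine (abs_add_le _ _).trans ?_
  rw [abs_mul _ (subFn G' Uᶜ true z - _), abs_mul _ (subFn G Uᶜ true z)]
  have t1 := mul_le_mul_of_nonneg_right e2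
    (abs_nonneg (subFn G' Uᶜ true z - subFn G Uᶜ true z))
  have t2 := mul_le_mul e1 z3 (abs_nonneg _) (by positivity)
  refine (add_le_add t1 t2).trans ?_
  have p1 := abs_nonneg (densFn G' true z - densFn G true z)
  have p2 := abs_nonneg (subFn G' Uᶜ true z - subFn G Uᶜ true z)
  have p3 := abs_nonneg (subFn G' U false z - subFn G U false z)
  have p4 := abs_nonneg (etaFn G' j true z - etaFn G j true z)
  have hBB := mul_nonneg hB hB
  nlinarith [mul_nonneg hBB p1, mul_nonneg hB p1, mul_nonneg hB p2, mul_nonneg hB p3,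
    mul_nonneg hB p4]

lemma nrm_ratio_le [IsProbabilityMeasure P] (hD : Standing D P)
    (hG : IsNuisOf D P G) (hB : 0 ≤ B) (hb : 0 < b) (hGB : SplitBdd D P j U B b G)
    (h : SplitBdd D P j U B b G') :
    nrm P (fun z => subFn G' U false z * subFn G' Uᶜ true z / densFn G' true z
      - subFn G U false z * subFn G Uᶜ true z / densFn G true z) ≤
      (b⁻¹ * B + B * B / b ^ 2).toNNReal * ∑ i, nrm P (splitErr G' G j U i) := by
  refine nrm_le_sum hD hG (hGB.measurable_splitErr h) ?_
  filter_upwards [hGB.block, hGB.compl, h.block, hGB.low, h.low] with z z1 z2 z3 z4 z5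
  rw [sum_abs_splitErr]
  have e2 : |subFn G U false z * subFn G Uᶜ true z| ≤ B * B := by
    rw [abs_mul]
    exact mul_le_mul z1 z2 (abs_nonneg _) hB
  refine (abs_div_sub_div_le hb e2 z4 z5).trans ?_
  have e1 := abs_mul_sub_mul_le (x := subFn G U false z) (y' := subFn G' Uᶜ true z) z3 z2
  have hb1 : 0 ≤ b⁻¹ := (inv_pos.2 hb).le
  have hb2 : 0 ≤ B * B / b ^ 2 := by positivity
  have t1 := mul_le_mul_of_nonneg_left e1 hb1
  refine (add_le_add t1 le_rfl).trans ?_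
  have p1 := abs_nonneg (densFn G' true z - densFn G true z)
  have p2 := abs_nonneg (subFn G' Uᶜ true z - subFn G Uᶜ true z)
  have p3 := abs_nonneg (subFn G' U false z - subFn G U false z)
  have p4 := abs_nonneg (etaFn G' j true z - etaFn G j true z)
  have hbB := mul_nonneg hb1 hB
  change _ ≤ (b⁻¹ * B + B * B / b ^ 2) * _
  nlinarith [mul_nonneg hbB p1, mul_nonneg hb2 p2, mul_nonneg hb2 p3, mul_nonneg hb2 p4,
    mul_nonneg hbB p4]

end SplitBdd

lemma eLpNorm_psiSplit_sub_le [IsProbabilityMeasure P] (hD : Standing D P)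
    (hG : IsNuisOf D P G) (hvar : CondVarBdd P G)
    {b₀ : ℝ} (hb₀ : IsDensLB D P G b₀) (hn : P {o | o.1 = n} ≠ 0) (hb : 0 < b) (hB : 0 ≤ B)
    (hGB : SplitBdd D P j U B b G) :
    ∃ C : ℝ≥0, ∀ G', SplitBdd D P j U B b G' →
      eLpNorm (fun o => psiSplit D G' j U o - psiSplit D G j U o) 2 (condLaw P n) ≤
        C * ∑ i, nrm P (splitErr G' G j U i) := by
  obtain ⟨C₁, hC₁⟩ := eLpNorm_blockInt_sub_le (B := B) hD hG hb₀ Uᶜ false hB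
    (by have h := hGB.block
        rw [← subFn_compl_compl G U false] at h
        exact h)
  obtain ⟨C₄, hC₄⟩ := eLpNorm_blockInt_sub_le hD hG hb₀ U true hB hGB.compl
  obtain ⟨C₃, hC₃⟩ := eLpNorm_resTerm_sub_le hD hG hvar true j (B * B / b) (hGB.tame_ratio hb)
  set c₂ : ℝ≥0 := Real.toNNReal (1 + (1 / prob D true + 1 / prob D false))
  set cr : ℝ := b⁻¹ * B + B * B / b ^ 2
  refine ⟨C₁ * B.toNNReal + c₂ * (refConst D b₀ * (B * B + B).toNNReal)
    + C₃ * (cr.toNNReal + 1) + C₄ * B.toNNReal, fun G' h => ?_⟩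
  set T : ℝ≥0∞ := ∑ i, nrm P (splitErr G' G j U i) with hT
  obtain ⟨g1, g2, g3, g4⟩ := memLp_psiSplit_terms hD hG hb₀ hn hb hB hGB hGB
  obtain ⟨h1, h2, h3, h4⟩ := memLp_psiSplit_terms hD hG hb₀ hn hb hB hGB h
  have de : nrm P (fun z => etaFn G' j true z - etaFn G j true z) ≤ T := SplitBdd.nrm_eta_le
  have d1 := SplitBdd.nrm_eta_compl_le hD hG hB hGB h
  have d4 := SplitBdd.nrm_eta_block_le hD hG hB hGB h
  have d2 := SplitBdd.nrm_product_le hD hG hB hGB h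
  have d3 := SplitBdd.nrm_ratio_le hD hG hB hb hGB h
  rw [← hT] at d1 d2 d3 d4
  have b1 := (hC₁ _ _ (hGB.tame_eta.mul hGB.tame_compl) (h.tame_eta.mul h.tame_compl)).trans
    (mul_le_mul_right d1 _)
  have b4 := (hC₄ _ _ (hGB.tame_eta.mul hGB.tame_block) (h.tame_eta.mul h.tame_block)).trans
    (mul_le_mul_right d4 _)
  have b3 := (hC₃ _ _ (h.tame_ratio hb).1 h.tame_eta.1 (by
    filter_upwards [h.block, h.compl, h.low] with z z1 z2 z3
    rw [abs_div, abs_mul, abs_of_pos (hb.trans_le z3)]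
    exact div_le_div₀ (mul_nonneg hB hB) (mul_le_mul z1 z2 (abs_nonneg _) hB) hb z3)).trans
    (mul_le_mul_right (add_le_add d3 de) _)
  have b2 : eLpNorm (fun o => (1 - ∑ a : Bool, ipw D a (trt o)) *
        (∫ m, etaFn G' j true (cov o, m) * subFn G' U false (cov o, m) *
          subFn G' Uᶜ true (cov o, m) ∂(ref D n))
      - (1 - ∑ a : Bool, ipw D a (trt o)) *
        (∫ m, etaFn G j true (cov o, m) * subFn G U false (cov o, m) *
          subFn G Uᶜ true (cov o, m) ∂(ref D n))) 2 (condLaw P n) ≤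
      c₂ * (refConst D b₀ * ((B * B + B).toNNReal * T)) := by
    have e := (eLpNorm_integral_ref_sub_le hD hG hb₀ hn
      ((hGB.tame_eta.mul hGB.tame_block).mul hGB.tame_compl)
      ((h.tame_eta.mul h.tame_block).mul h.tame_compl)).trans (mul_le_mul_right d2 _)
    refine le_trans ?_ (mul_le_mul_right e _)
    refine eLpNorm_le_nnreal_smul_eLpNorm_of_ae_le_mul (ae_of_all _ fun o => ?_) 2
    rw [← mul_sub, nnnorm_mul]
    gcongr
    rw [← NNReal.coe_le_coe, coe_nnnorm]
    exact (abs_one_sub_sum_ipw_le hD _).trans (Real.le_coe_toNNReal _)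
  have hsplit : (fun o => psiSplit D G' j U o - psiSplit D G j U o) =
      ((((fun o => ipw D false (trt o) *
        blockInt D Uᶜ (fun z => etaFn G' j true z * subFn G' Uᶜ true z) (covMed o)
        - ipw D false (trt o) *
        blockInt D Uᶜ (fun z => etaFn G j true z * subFn G Uᶜ true z) (covMed o)) +
      fun o => (1 - ∑ a : Bool, ipw D a (trt o)) *
        (∫ m, etaFn G' j true (cov o, m) * subFn G' U false (cov o, m) *
          subFn G' Uᶜ true (cov o, m) ∂(ref D n))
      - (1 - ∑ a : Bool, ipw D a (trt o)) *
        (∫ m, etaFn G j true (cov o, m) * subFn G U false (cov o, m) *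
          subFn G Uᶜ true (cov o, m) ∂(ref D n))) +
      fun o => resTerm D true j (fun z => subFn G' U false z * subFn G' Uᶜ true z /
        densFn G' true z) (etaFn G' j true) o -
        resTerm D true j (fun z => subFn G U false z * subFn G Uᶜ true z /
        densFn G true z) (etaFn G j true) o) +
      fun o => ipw D true (trt o) *
        blockInt D U (fun z => etaFn G' j true z * subFn G' U false z) (covMed o) -
        ipw D true (trt o) *
        blockInt D U (fun z => etaFn G j true z * subFn G U false z) (covMed o)) := by
    funext o
    simp only [psiSplit, Pi.add_apply]
    ring
  have m1 := h1.1.sub g1.1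
  have m2 := h2.1.sub g2.1
  have m3 := h3.1.sub g3.1
  have m4 := h4.1.sub g4.1
  rw [hsplit]
  refine (eLpNorm_add_le ((m1.add m2).add m3) m4 (by norm_num)).trans ?_
  refine (add_le_add ((eLpNorm_add_le (m1.add m2) m3 (by norm_num)).trans
    (add_le_add ((eLpNorm_add_le m1 m2 (by norm_num)).trans (add_le_add b1 b2)) b3)) b4).trans ?_
  refine le_of_eq ?_
  simp only [ENNReal.coe_add, ENNReal.coe_mul, ENNReal.coe_one]
  ring

end SplitStratum

/-! ### Joint measurability of the influence functions in data and parameters -/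

section Joint

variable {K : ℕ} {𝒳 𝒱 : Type*} [MeasurableSpace 𝒳] [MeasurableSpace 𝒱] {n : ℕ}
variable {D : Design K 𝒱} {P : Measure (Obs K 𝒳 𝒱)}

/-- Nuisance functions that depend measurably on a parameter. -/
structure JointMeas {X : Type*} [MeasurableSpace X] (H : X → Nuis K 𝒳 𝒱) : Prop where
  measurable_eta : ∀ (n : ℕ) (j : Fin n) (a : Bool),
    Measurable fun x : X × Cov 𝒳 𝒱 n × Med K n => (H x.1).eta n j a x.2.1 x.2.2
  measurable_dens : ∀ (n : ℕ) (a : Bool),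
    Measurable fun x : X × Cov 𝒳 𝒱 n × Med K n => (H x.1).dens n a x.2.1 x.2.2
  measurable_sub : ∀ (n : ℕ) (U : Finset (Fin K × Fin n)) (a : Bool),
    Measurable fun x : X × Cov 𝒳 𝒱 n × (U → ℝ) => (H x.1).sub n U a x.2.1 x.2.2

lemma MeasNuis.jointMeas {G : Nuis K 𝒳 𝒱} (hG : MeasNuis G) : JointMeas fun _ : Unit => G :=
  ⟨fun n j a => (hG.measurable_eta n j a).comp measurable_snd,
    fun n a => (hG.measurable_dens n a).comp measurable_snd,
    fun n U a => (hG.measurable_sub n U a).comp measurable_snd⟩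

variable {X : Type*} [MeasurableSpace X] {H : X → Nuis K 𝒳 𝒱}

lemma JointMeas.measNuis (hH : JointMeas H) (x : X) : MeasNuis (H x) :=
  ⟨fun n j a => (hH.measurable_eta n j a).comp measurable_prodMk_left,
    fun n a => (hH.measurable_dens n a).comp measurable_prodMk_left,
    fun n U a => (hH.measurable_sub n U a).comp measurable_prodMk_left⟩

lemma JointMeas.measurable_etaFn (hH : JointMeas H) (j : Fin n) (a : Bool) :
    Measurable fun p : X × Cov 𝒳 𝒱 n × Med K n => etaFn (H p.1) j a p.2 :=
  hH.measurable_eta n j a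

lemma JointMeas.measurable_densFn (hH : JointMeas H) (a : Bool) :
    Measurable fun p : X × Cov 𝒳 𝒱 n × Med K n => densFn (H p.1) a p.2 :=
  hH.measurable_dens n a

lemma JointMeas.measurable_subFn (hH : JointMeas H) (U : Finset (Fin K × Fin n)) (a : Bool) :
    Measurable fun p : X × Cov 𝒳 𝒱 n × Med K n => subFn (H p.1) U a p.2 :=
  (hH.measurable_sub n U a).comp
    (measurable_fst.prodMk ((measurable_restrict_snd U).comp measurable_snd))

lemma measurable_blockInt_param (hD : Standing D P) (V : Finset (Fin K × Fin n))
    {k : X × Cov 𝒳 𝒱 n × Med K n → ℝ} (hk : Measurable k) :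
    Measurable fun p : X × Cov 𝒳 𝒱 n × Med K n => blockInt D V (fun z => k (p.1, z)) p.2 := by
  have := sigmaFinite_refSub hD V
  have hu : Measurable fun q : (X × Cov 𝒳 𝒱 n × Med K n) × (V → ℝ) =>
      Function.updateFinset q.1.2.2 V q.2 :=
    measurable_updateFinset'.comp
      ((measurable_snd.comp (measurable_snd.comp measurable_fst)).prodMk measurable_snd)
  have hS : MeasurableSet {q : (X × Cov 𝒳 𝒱 n × Med K n) × (V → ℝ) |
      Function.updateFinset q.1.2.2 V q.2 ∈ D.supp n} := hu (hD.measurable_supp n)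
  have hF : Measurable fun q : (X × Cov 𝒳 𝒱 n × Med K n) × (V → ℝ) =>
      k (q.1.1, q.1.2.1, Function.updateFinset q.1.2.2 V q.2) :=
    hk.comp ((measurable_fst.comp measurable_fst).prodMk
      ((measurable_fst.comp (measurable_snd.comp measurable_fst)).prodMk hu))
  have h := (hF.indicator hS).stronglyMeasurable.integral_prod_right' (ν := refSub D V)
  convert h.measurable using 2 with p
  have hs : MeasurableSet {u : V → ℝ | Function.updateFinset p.2.2 V u ∈ D.supp n} :=
    measurable_updateFinset (hD.measurable_supp n)
  rw [blockInt, ← integral_indicator hs]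
  rfl

lemma measurable_integral_ref_param (hD : Standing D P)
    {k : X × Cov 𝒳 𝒱 n × Med K n → ℝ} (hk : Measurable k) :
    Measurable fun p : X × Cov 𝒳 𝒱 n => ∫ m, k (p.1, p.2, m) ∂(ref D n) := by
  have := sigmaFinite_ref (n := n) hD
  have hF : Measurable fun q : (X × Cov 𝒳 𝒱 n) × Med K n => k (q.1.1, q.1.2, q.2) := by
    fun_prop
  exact hF.stronglyMeasurable.integral_prod_right'.measurable

lemma measurable_snd_covMed : Measurable fun p : X × Dat K 𝒳 𝒱 n => (p.1, covMed p.2) :=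
  measurable_fst.prodMk (measurable_covMed.comp measurable_snd)

lemma measurable_snd_cov : Measurable fun p : X × Dat K 𝒳 𝒱 n => (p.1, cov p.2) :=
  measurable_fst.prodMk (measurable_cov.comp measurable_snd)

lemma measurable_snd_ipw (a : Bool) :
    Measurable fun p : X × Dat K 𝒳 𝒱 n => ipw D a (trt p.2) :=
  (measurable_ipw a).comp (measurable_trt.comp measurable_snd)

lemma measurable_resTerm_param (a : Bool) (j : Fin n)
    {r e : X × Cov 𝒳 𝒱 n × Med K n → ℝ} (hr : Measurable r) (he : Measurable e) :
    Measurable fun p : X × Dat K 𝒳 𝒱 n =>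
      resTerm D a j (fun z => r (p.1, z)) (fun z => e (p.1, z)) p.2 :=
  (measurable_snd_ipw a).mul ((hr.comp measurable_snd_covMed).mul
    (((measurable_out j).comp measurable_snd).sub (he.comp measurable_snd_covMed)))

lemma measurable_psiSplit (hD : Standing D P) (hH : JointMeas H) (j : Fin n)
    (U : Finset (Fin K × Fin n)) :
    Measurable fun p : X × Dat K 𝒳 𝒱 n => psiSplit D (H p.1) j U p.2 := by
  have he := hH.measurable_etaFn j true
  have hf := hH.measurable_densFn (n := n) true
  have hu := hH.measurable_subFn U false
  have hv := hH.measurable_subFn Uᶜ true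
  have hev : Measurable fun p : X × Cov 𝒳 𝒱 n × Med K n =>
    etaFn (H p.1) j true p.2 * subFn (H p.1) Uᶜ true p.2 := he.mul hv
  have heu : Measurable fun p : X × Cov 𝒳 𝒱 n × Med K n =>
    etaFn (H p.1) j true p.2 * subFn (H p.1) U false p.2 := he.mul hu
  have heuv : Measurable fun p : X × Cov 𝒳 𝒱 n × Med K n => etaFn (H p.1) j true p.2 *
    subFn (H p.1) U false p.2 * subFn (H p.1) Uᶜ true p.2 := heu.mul hv
  have hr : Measurable fun p : X × Cov 𝒳 𝒱 n × Med K n => subFn (H p.1) U false p.2 *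
    subFn (H p.1) Uᶜ true p.2 / densFn (H p.1) true p.2 := (hu.mul hv).div hf
  have h1 := (measurable_blockInt_param hD Uᶜ hev).comp
    (measurable_snd_covMed (K := K) (𝒳 := 𝒳) (𝒱 := 𝒱) (n := n) (X := X))
  have h4 := (measurable_blockInt_param hD U heu).comp
    (measurable_snd_covMed (K := K) (𝒳 := 𝒳) (𝒱 := 𝒱) (n := n) (X := X))
  have h2 := (measurable_integral_ref_param hD heuv).comp
    (measurable_snd_cov (K := K) (𝒳 := 𝒳) (𝒱 := 𝒱) (n := n) (X := X))
  have h3 := measurable_resTerm_param (D := D) true j hr he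
  exact ((((measurable_snd_ipw false).mul h1).add
    ((measurable_one_sub_sum_ipw.comp measurable_snd).mul h2)).add h3).add
    ((measurable_snd_ipw true).mul h4)

lemma measurable_psiI (hD : Standing D P) (hH : JointMeas H) (j : Fin n) (aStar a' : Bool) :
    Measurable fun p : X × Dat K 𝒳 𝒱 n => psiI D (H p.1) j aStar a' p.2 := by
  have he := hH.measurable_etaFn j aStar
  have hf := hH.measurable_densFn (n := n) aStar
  have hf' := hH.measurable_densFn (n := n) a'
  have hef : Measurable fun p : X × Cov 𝒳 𝒱 n × Med K n =>
    etaFn (H p.1) j aStar p.2 * densFn (H p.1) a' p.2 := he.mul hf'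
  have hr : Measurable fun p : X × Cov 𝒳 𝒱 n × Med K n =>
    densFn (H p.1) a' p.2 / densFn (H p.1) aStar p.2 := hf'.div hf
  have h1 := measurable_resTerm_param (D := D) aStar j hr he
  have h2 := he.comp (measurable_snd_covMed (K := K) (𝒳 := 𝒳) (𝒱 := 𝒱) (n := n) (X := X))
  have h3 := (measurable_integral_ref_param hD hef).comp
    (measurable_snd_cov (K := K) (𝒳 := 𝒳) (𝒱 := 𝒱) (n := n) (X := X))
  exact (h1.add ((measurable_snd_ipw a').mul h2)).add
    ((measurable_const.sub (measurable_snd_ipw a')).mul h3)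

lemma measurable_weight_div (hD : Standing D P) :
    Measurable fun c : Cov 𝒳 𝒱 n => D.w c.2 n / n :=
  ((hD.measurable_w n).comp measurable_snd).div_const _

lemma measurable_phiSplit (hD : Standing D P) (hH : JointMeas H) (U : Split K) :
    Measurable fun p : X × Obs K 𝒳 𝒱 => phiSplit D (H p.1) U p.2 := by
  refine measurable_prod_sigma fun n => ?_
  simp only [phiSplit_mk]
  exact ((measurable_weight_div hD).comp (measurable_cov.comp measurable_snd)).mul
    (Finset.measurable_sum _ fun j _ => measurable_psiSplit hD hH j (U n j))

lemma measurable_phiI (hD : Standing D P) (hH : JointMeas H) (aStar a' : Bool) :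
    Measurable fun p : X × Obs K 𝒳 𝒱 => phiI D (H p.1) aStar a' p.2 := by
  refine measurable_prod_sigma fun n => ?_
  simp only [phiI_mk]
  exact ((measurable_weight_div hD).comp (measurable_cov.comp measurable_snd)).mul
    (Finset.measurable_sum _ fun j _ => measurable_psiI hD hH j aStar a')

end Joint

/-! ### From fixed cluster sizes to the law of a cluster -/

section Mixture

variable {K : ℕ} {𝒳 𝒱 : Type*} [MeasurableSpace 𝒳] [MeasurableSpace 𝒱]
variable {D : Design K 𝒱} {P : Measure (Obs K 𝒳 𝒱)}

lemma sum_sq_le_sq_sum {ι : Type*} (s : Finset ι) (f : ι → ℝ≥0∞) :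
    ∑ i ∈ s, f i ^ 2 ≤ (∑ i ∈ s, f i) ^ 2 := by
  rw [pow_two (∑ i ∈ s, f i), Finset.sum_mul]
  refine Finset.sum_le_sum fun i hi => ?_
  rw [pow_two]
  exact mul_le_mul_right (Finset.single_le_sum (f := f) (fun _ _ => zero_le) hi) _

lemma eLpNorm_law_le [IsProbabilityMeasure P] {Nmax : ℕ} (h : ∀ᵐ o ∂P, o.1 ≤ Nmax)
    (F : Obs K 𝒳 𝒱 → ℝ) :
    eLpNorm F 2 P ≤ ∑ n ∈ Finset.range (Nmax + 1), eLpNorm (fun o => F ⟨n, o⟩) 2 (condLaw P n) := by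
  rw [← ENNReal.pow_le_pow_left_iff (two_ne_zero), eLpNorm_two_sq, lintegral_law P h]
  refine le_trans (Finset.sum_le_sum fun n _ => ?_) (sum_sq_le_sq_sum _ _)
  rw [eLpNorm_two_sq]
  exact mul_le_of_le_one_left (zero_le) prob_le_one

lemma memLp_law [IsProbabilityMeasure P] (hb : ∃ Nmax : ℕ, ∀ᵐ o ∂P, o.1 ≤ Nmax)
    {F : Obs K 𝒳 𝒱 → ℝ} (hm : Measurable F)
    (hF : ∀ n, P {o | o.1 = n} ≠ 0 → MemLp (fun o => F ⟨n, o⟩) 2 (condLaw P n)) :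
    MemLp F 2 P := by
  obtain ⟨Nmax, h⟩ := hb
  refine ⟨hm.aestronglyMeasurable, (eLpNorm_law_le h F).trans_lt ?_⟩
  refine ENNReal.sum_lt_top.2 fun n _ => ?_
  by_cases hn : P {o | o.1 = n} = 0
  · rw [condLaw_eq_zero P hn, eLpNorm_measure_zero]
    exact ENNReal.zero_lt_top
  · exact (hF n hn).2

lemma enorm_integral_sub_law_le [IsProbabilityMeasure P] (hb : ∃ Nmax : ℕ, ∀ᵐ o ∂P, o.1 ≤ Nmax)
    {F F' : Obs K 𝒳 𝒱 → ℝ} (hF : Integrable F P) (hF' : Integrable F' P) {C : ℝ≥0∞}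
    {H : Obs K 𝒳 𝒱 → ℝ≥0∞}
    (h : ∀ n, P {o | o.1 = n} ≠ 0 →
      ‖∫ o, F ⟨n, o⟩ ∂(condLaw P n) - ∫ o, F' ⟨n, o⟩ ∂(condLaw P n)‖ₑ ≤
        C * ∫⁻ o, H ⟨n, o⟩ ∂(condLaw P n)) :
    ‖∫ o, F o ∂P - ∫ o, F' o ∂P‖ₑ ≤ C * ∫⁻ o, H o ∂P := by
  obtain ⟨Nmax, hN⟩ := hb
  rw [integral_law P hN hF, integral_law P hN hF', ← Finset.sum_sub_distrib, lintegral_law P hN,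
    Finset.mul_sum]
  refine (enorm_sum_le _ _).trans (Finset.sum_le_sum fun n _ => ?_)
  rw [← mul_sub, enorm_mul, mul_left_comm]
  by_cases hn : P {o | o.1 = n} = 0
  · simp [Measure.real, hn]
  · refine mul_le_mul' (le_of_eq ?_) (h n hn)
    rw [Real.enorm_of_nonneg measureReal_nonneg, ofReal_measureReal]

variable {n : ℕ}

lemma eLpNorm_weighted_sum_le {Q : Measure (Dat K 𝒳 𝒱 n)} {ω : Dat K 𝒳 𝒱 n → ℝ} {W : ℝ}
    (hW : ∀ᵐ o ∂Q, |ω o| ≤ W) {F : Fin n → Dat K 𝒳 𝒱 n → ℝ}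
    (hF : ∀ j, AEStronglyMeasurable (F j) Q) :
    eLpNorm (fun o => ω o * ∑ j, F j o) 2 Q ≤ W.toNNReal * ∑ j, eLpNorm (F j) 2 Q := by
  have h1 : eLpNorm (fun o => ω o * ∑ j, F j o) 2 Q ≤ W.toNNReal * eLpNorm (∑ j, F j) 2 Q := by
    refine eLpNorm_le_nnreal_smul_eLpNorm_of_ae_le_mul ?_ 2
    filter_upwards [hW] with o ho
    rw [nnnorm_mul, Finset.sum_apply]
    gcongr
    rw [← NNReal.coe_le_coe, coe_nnnorm]
    exact ho.trans (Real.le_coe_toNNReal _)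
  refine h1.trans ?_
  gcongr
  exact eLpNorm_sum_le (fun j _ => hF j) (by norm_num)

/-- Hölder's inequality for `L²`. -/
lemma lintegral_ofReal_mul_le {α : Type*} [MeasurableSpace α] {ν : Measure α} {f g : α → ℝ}
    (hf : Measurable f) (hg : Measurable g) (hf0 : ∀ x, 0 ≤ f x) (hg0 : ∀ x, 0 ≤ g x) :
    ∫⁻ x, ENNReal.ofReal (f x * g x) ∂ν ≤ eLpNorm f 2 ν * eLpNorm g 2 ν := by
  have h := ENNReal.lintegral_mul_le_Lp_mul_Lq ν Real.HolderConjugate.two_two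
    hf.enorm.aemeasurable hg.enorm.aemeasurable
  rw [eLpNorm_eq_lintegral_rpow_enorm_toReal (by norm_num) (by norm_num),
    eLpNorm_eq_lintegral_rpow_enorm_toReal (by norm_num) (by norm_num)]
  refine le_trans (le_of_eq (lintegral_congr fun x => ?_)) h
  rw [ENNReal.ofReal_mul (hf0 x), Pi.mul_apply, Real.enorm_of_nonneg (hf0 x),
    Real.enorm_of_nonneg (hg0 x)]

end Mixture

/-! ### Split functionals: from the individual to the cluster -/

section SplitLaw

lemma integrandSplit_mk {K n : ℕ} {𝒳 𝒱 : Type*} {D : Design K 𝒱} {G : Nuis K 𝒳 𝒱} (U : Split K)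
    (o : Dat K 𝒳 𝒱 n) :
    integrandSplit D G U ⟨n, o⟩ = ∑ j, D.w (cov o).2 n / n *
      ∫ m, etaFn G j true (cov o, m) * subFn G (U n j) false (cov o, m) *
        subFn G (U n j)ᶜ true (cov o, m) ∂(ref D n) := by
  rw [← Finset.mul_sum]
  rfl

lemma phiSplit_mk_sum {K n : ℕ} {𝒳 𝒱 : Type*} {D : Design K 𝒱} {G : Nuis K 𝒳 𝒱} (U : Split K)
    (o : Dat K 𝒳 𝒱 n) :
    phiSplit D G U ⟨n, o⟩ = ∑ j, D.w (cov o).2 n / n * psiSplit D G j (U n j) o := by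
  rw [phiSplit_mk, Finset.mul_sum]

variable {K : ℕ} {𝒳 𝒱 : Type*} [MeasurableSpace 𝒳] [MeasurableSpace 𝒱]
variable {D : Design K 𝒱} {P : Measure (Obs K 𝒳 𝒱)} {G G' : Nuis K 𝒳 𝒱} {b b₀ B W : ℝ}

lemma tame_weight {n : ℕ} (hD : Standing D P)
    (hW : ∀ n, ∀ᵐ z ∂(refLaw D P n), |D.w z.1.2 n| ≤ W) :
    Tame D P fun z : Cov 𝒳 𝒱 n × Med K n => D.w z.1.2 n / n := by
  refine ⟨(measurable_weight_div hD).comp measurable_fst, W / n, ?_⟩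
  filter_upwards [hW n] with z hz
  rw [abs_div, Nat.abs_cast]
  gcongr

/-- The second-order term that bounds the bias of a split functional. -/
def biasTerm (E F V U : ℝ) : ℝ := E * (F + V + U) + V * U

lemma biasTerm_mono {E F V U E' F' V' U' : ℝ} (hE : 0 ≤ E) (hF : 0 ≤ F) (hV : 0 ≤ V) (hU : 0 ≤ U)
    (hE' : E ≤ E') (hF' : F ≤ F') (hV' : V ≤ V') (hU' : U ≤ U') :
    biasTerm E F V U ≤ biasTerm E' F' V' U' := by
  unfold biasTerm
  have : 0 ≤ E' := hE.trans hE'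
  have : 0 ≤ V' := hV.trans hV'
  gcongr

/-- The integrand of `integral_psiSplit` is of second order, because the weight error
`u' v' / f' f - u v` is linear in the errors of `f`, `u` and `v`. -/
lemma abs_bias_le {e e' f f' u u' v v' B b : ℝ} (hb : 0 < b) (hf' : b ≤ f') (he' : |e'| ≤ B)
    (hu' : |u'| ≤ B) (hv' : |v'| ≤ B) (hv : |v| ≤ B) :
    |(e - e') * (u' * v' / f' * f - u * v) - e' * (u' - u) * (v' - v)| ≤
      (B * B / b + B) * biasTerm |e' - e| |f' - f| |v' - v| |u' - u| := by
  have hf0 : 0 < f' := hb.trans_le hf'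
  have hB : 0 ≤ B := (abs_nonneg _).trans he'
  have h1 : u' * v' / f' * f - u * v =
      -(u' * v' / f' * (f' - f)) + u' * (v' - v) + (u' - u) * v := by
    field_simp
    ring
  have h2 : |u' * v' / f'| ≤ B * B / b := by
    rw [abs_div, abs_mul, abs_of_pos hf0]
    exact div_le_div₀ (mul_nonneg hB hB) (mul_le_mul hu' hv' (abs_nonneg _) hB) hb hf'
  have hBb : 0 ≤ B * B / b := by positivity
  have p1 := abs_nonneg (f' - f)
  have p2 := abs_nonneg (v' - v)
  have p3 := abs_nonneg (u' - u)
  have p4 := abs_nonneg (e' - e)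
  have h3 : |u' * v' / f' * f - u * v| ≤ (B * B / b + B) * (|f' - f| + |v' - v| + |u' - u|) := by
    rw [h1]
    refine (abs_add_le _ _).trans ((add_le_add (abs_add_le _ _) le_rfl).trans ?_)
    rw [abs_neg, abs_mul _ (f' - f), abs_mul _ (v' - v), abs_mul _ v]
    have t1 := mul_le_mul_of_nonneg_right h2 p1
    have t2 := mul_le_mul_of_nonneg_right hu' p2
    have t3 := mul_le_mul_of_nonneg_left hv p3
    nlinarith [mul_nonneg hBb p2, mul_nonneg hBb p3, mul_nonneg hB p1]
  refine (abs_sub _ _).trans ?_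
  rw [abs_mul, abs_mul, abs_mul, abs_sub_comm e e']
  have t4 := mul_le_mul_of_nonneg_left h3 p4
  have t5 : |e'| * |u' - u| * |v' - v| ≤ (B * B / b + B) * (|v' - v| * |u' - u|) := by
    rw [mul_assoc, mul_comm |u' - u|]
    exact mul_le_mul_of_nonneg_right (he'.trans (le_add_of_nonneg_left hBb)) (mul_nonneg p2 p3)
  unfold biasTerm
  nlinarith [t4, t5]

/-- The maximum over the individuals of the error of a nuisance component. -/
def maxErr {K : ℕ} {𝒳 𝒱 : Type*} (q r : CompJ K 𝒳 𝒱) (n : ℕ) (z : Cov 𝒳 𝒱 n × Med K n) : ℝ :=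
  ⨆ j : Fin n, |q n j z.1 z.2 - r n j z.1 z.2|

lemma le_maxErr {K n : ℕ} {𝒳 𝒱 : Type*} (q r : CompJ K 𝒳 𝒱) (z : Cov 𝒳 𝒱 n × Med K n)
    (j : Fin n) : |q n j z.1 z.2 - r n j z.1 z.2| ≤ maxErr q r n z :=
  le_ciSup (f := fun j : Fin n => |q n j z.1 z.2 - r n j z.1 z.2|) (Set.finite_range _).bddAbove j

lemma maxErr_nonneg {K n : ℕ} {𝒳 𝒱 : Type*} (q r : CompJ K 𝒳 𝒱) (z : Cov 𝒳 𝒱 n × Med K n) :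
    0 ≤ maxErr q r n z := Real.iSup_nonneg fun _ => abs_nonneg _

lemma measurable_maxErr {n : ℕ} {q r : CompJ K 𝒳 𝒱}
    (hq : ∀ j : Fin n, Measurable fun z : Cov 𝒳 𝒱 n × Med K n => q n j z.1 z.2)
    (hr : ∀ j : Fin n, Measurable fun z : Cov 𝒳 𝒱 n × Med K n => r n j z.1 z.2) :
    Measurable (maxErr q r n) :=
  Measurable.iSup fun j => ((hq j).sub (hr j)).abs

/-- The integrand of the bound on the bias of a split functional. -/
def splitBias (G' G : Nuis K 𝒳 𝒱) (U : Split K) (n : ℕ) (z : Cov 𝒳 𝒱 n × Med K n) : ℝ :=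
  biasTerm (maxErr (etaAt true G') (etaAt true G) n z)
    |densFn G' true z - densFn G true z|
    (maxErr (subAtJ (complSplit U) true G') (subAtJ (complSplit U) true G) n z)
    (maxErr (subAtJ U false G') (subAtJ U false G) n z)

lemma measurable_splitBias (hG : MeasNuis G) (hG' : MeasNuis G') (U : Split K) (n : ℕ) :
    Measurable (splitBias G' G U n) := by
  have h1 : Measurable (maxErr (etaAt true G') (etaAt true G) n) :=
    measurable_maxErr (fun j => hG'.measurable_etaFn j true) fun j => hG.measurable_etaFn j true
  have h2 : Measurable fun z : Cov 𝒳 𝒱 n × Med K n => |densFn G' true z - densFn G true z| :=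
    ((hG'.measurable_densFn true).sub (hG.measurable_densFn true)).abs
  have h3 : Measurable (maxErr (subAtJ (complSplit U) true G')
      (subAtJ (complSplit U) true G) n) :=
    measurable_maxErr (fun j => hG'.measurable_subFn _ true) fun j => hG.measurable_subFn _ true
  have h4 : Measurable (maxErr (subAtJ U false G') (subAtJ U false G) n) :=
    measurable_maxErr (fun j => hG'.measurable_subFn _ false) fun j => hG.measurable_subFn _ false
  exact (h1.mul ((h2.add h3).add h4)).add (h3.mul h4)

lemma integrable_weight_mul [IsProbabilityMeasure P] (hD : Standing D P) (hG : IsNuisOf D P G)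
    {n : ℕ} {ω : Cov 𝒳 𝒱 n → ℝ} (hωm : Measurable ω)
    (hω : Tame D P fun z : Cov 𝒳 𝒱 n × Med K n => ω z.1) {F : Dat K 𝒳 𝒱 n → ℝ}
    (hF : MemLp F 2 (condLaw P n)) : Integrable (fun o => ω (cov o) * F o) (condLaw P n) := by
  obtain ⟨W, hW⟩ := hω.2
  exact (memLp_bdd_mul hF (hωm.comp measurable_cov) (ae_covMed hD hG hW)).integrable (by norm_num)

lemma integrable_integrandSplit [IsProbabilityMeasure P] (hD : Standing D P)
    (hG : IsNuisOf D P G) (hb₀ : IsDensLB D P G b₀)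
    (hW : ∀ n, ∀ᵐ z ∂(refLaw D P n), |D.w z.1.2 n| ≤ W) {U : Split K}
    (hGB : ∀ n j, SplitBdd D P j (U n j) B b G) : Integrable (integrandSplit D G U) P := by
  refine integrable_law P hD.bounded_size fun n hn => ?_
  simp only [integrandSplit_mk]
  refine integrable_finsetSum _ fun j _ => integrable_weight_mul hD hG
    (measurable_weight_div hD) (tame_weight hD hW) ?_
  exact (((hGB n j).tame_eta.mul (hGB n j).tame_block).mul (hGB n j).tame_compl).memLp_integral_ref
    hD hG hb₀ hn

lemma ae_integrable_lam1Kernel [IsProbabilityMeasure P] (hD : Standing D P)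
    (hG : IsNuisOf D P G) (hb₀ : IsDensLB D P G b₀) {U : Split K}
    (hGB : ∀ n j, SplitBdd D P j (U n j) B b G) :
    ∀ᵐ o ∂P, ∀ j, Integrable (lam1Kernel G j (U o.1 j) true false true (cov o.2))
      (ref D o.1) := by
  refine ae_law_iff P hD.bounded_size fun n hn => ?_
  refine (ae_all_iff (ι := Fin n)).2 fun j => ?_
  obtain ⟨hk, C, hC⟩ := ((hGB n j).tame_eta.mul (hGB n j).tame_block).mul (hGB n j).tame_compl
  exact ae_integrable_ref hD hG hb₀ hn hk hC

lemma memLp_phiSplit [IsProbabilityMeasure P] (hD : Standing D P) (hG : IsNuisOf D P G)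
    (hb₀ : IsDensLB D P G b₀) (hb : 0 < b) (hB : 0 ≤ B)
    (hW : ∀ n, ∀ᵐ z ∂(refLaw D P n), |D.w z.1.2 n| ≤ W) {U : Split K} (hm' : MeasNuis G')
    (hGB : ∀ n j, SplitBdd D P j (U n j) B b G) (h : ∀ n j, SplitBdd D P j (U n j) B b G') :
    MemLp (phiSplit D G' U) 2 P := by
  refine memLp_law hD.bounded_size
    ((measurable_phiSplit hD hm'.jointMeas U).comp (measurable_const (a := ()) |>.prodMk
      measurable_id)) fun n hn => ?_
  simp only [phiSplit_mk_sum]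
  refine memLp_finsetSum _ fun j _ => ?_
  obtain ⟨C, hC⟩ := (tame_weight (n := n) hD hW).2
  exact memLp_bdd_mul (memLp_psiSplit hD hG hb₀ hn hb hB (hGB n j) (h n j))
    ((measurable_weight_div hD).comp measurable_cov) (ae_covMed hD hG hC)

lemma splitBias_stratum [IsProbabilityMeasure P] (hD : Standing D P) (hG : IsNuisOf D P G)
    (hb₀ : IsDensLB D P G b₀) (hb : 0 < b) (hB : 0 ≤ B) (hW0 : 0 ≤ W)
    (hW : ∀ n, ∀ᵐ z ∂(refLaw D P n), |D.w z.1.2 n| ≤ W) {U : Split K} (hm' : MeasNuis G')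
    (hGB : ∀ n j, SplitBdd D P j (U n j) B b G) (h : ∀ n j, SplitBdd D P j (U n j) B b G')
    {n : ℕ} (hn : P {o | o.1 = n} ≠ 0) :
    ‖∫ o, phiSplit D G' U ⟨n, o⟩ ∂(condLaw P n) - ∫ o, integrandSplit D G U ⟨n, o⟩ ∂(condLaw P n)‖ₑ
      ≤ ENNReal.ofReal (W * (B * B / b + B)) * refConst D b₀ *
        ∫⁻ o, ENNReal.ofReal (splitBias G' G U n (covMed o)) ∂(condLaw P n) := by
  set C : ℝ := B * B / b + B with hCdef
  have hC : 0 ≤ C := by positivity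
  have hωm := measurable_weight_div (K := K) (𝒳 := 𝒳) (n := n) hD
  have hω := tame_weight (K := K) (𝒳 := 𝒳) (n := n) hD hW
  have hmb := measurable_splitBias (n := n) hG.measNuis hm' U
  have hmL : Measurable fun z : Cov 𝒳 𝒱 n × Med K n => ENNReal.ofReal (splitBias G' G U n z) :=
    hmb.ennreal_ofReal
  simp only [phiSplit_mk_sum, integrandSplit_mk]
  rw [integral_finsetSum _ fun j _ => integrable_weight_mul hD hG hωm hω
      (memLp_psiSplit hD hG hb₀ hn hb hB (hGB n j) (h n j)),
    integral_finsetSum _ fun j _ => integrable_weight_mul hD hG hωm hω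
      ((((hGB n j).tame_eta.mul (hGB n j).tame_block).mul
        (hGB n j).tame_compl).memLp_integral_ref hD hG hb₀ hn), ← Finset.sum_sub_distrib]
  have key : ∀ j : Fin n, ‖∫ o, D.w (cov o).2 n / n * psiSplit D G' j (U n j) o ∂(condLaw P n) -
      ∫ o, D.w (cov o).2 n / n * ∫ m, etaFn G j true (cov o, m) * subFn G (U n j) false (cov o, m) *
        subFn G (U n j)ᶜ true (cov o, m) ∂(ref D n) ∂(condLaw P n)‖ₑ ≤
      ENNReal.ofReal (W / n * C) *
        ∫⁻ z, ENNReal.ofReal (splitBias G' G U n z) ∂(refLaw D P n) := by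
    intro j
    rw [integral_psiSplit hD hG hb₀ hn hb hB (hGB n j) (h n j) hωm hω]
    refine (enorm_integral_le_lintegral_enorm _).trans ?_
    rw [← lintegral_const_mul' _ _ ENNReal.ofReal_ne_top]
    refine lintegral_mono_ae ?_
    filter_upwards [hW n, (h n j).low, (h n j).eta, (h n j).block, (h n j).compl,
      (hGB n j).compl] with z w1 z1 z2 z3 z4 z5
    rw [← ENNReal.ofReal_mul (by positivity), ← ofReal_norm, Real.norm_eq_abs]
    refine ENNReal.ofReal_le_ofReal ?_
    have hwn : |D.w z.1.2 n / n| ≤ W / n := by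
      rw [abs_div, Nat.abs_cast]
      gcongr
    refine (abs_mul _ _).le.trans (le_trans ?_ (mul_assoc (W / n) C _).ge)
    refine mul_le_mul hwn ?_ (abs_nonneg _) (by positivity)
    refine (abs_bias_le hb z1 z2 z3 z4 z5).trans ?_
    refine mul_le_mul_of_nonneg_left ?_ hC
    refine biasTerm_mono (abs_nonneg _) (abs_nonneg _) (abs_nonneg _) (abs_nonneg _) ?_ le_rfl ?_ ?_
    · exact le_maxErr (etaAt true G') (etaAt true G) z j
    · exact le_maxErr (subAtJ (complSplit U) true G') (subAtJ (complSplit U) true G) z j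
    · exact le_maxErr (subAtJ U false G') (subAtJ U false G) z j
  refine (enorm_sum_le _ _).trans ((Finset.sum_le_sum fun j _ => key j).trans ?_)
  rw [Finset.sum_const, Finset.card_univ, Fintype.card_fin, nsmul_eq_mul, ← mul_assoc]
  have hn' : (n : ℝ≥0∞) * ENNReal.ofReal (W / n * C) ≤ ENNReal.ofReal (W * C) := by
    rw [← ENNReal.ofReal_natCast, ← ENNReal.ofReal_mul (Nat.cast_nonneg n)]
    refine ENNReal.ofReal_le_ofReal ?_
    rcases Nat.eq_zero_or_pos n with rfl | hpos
    · simp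
      positivity
    · have : (0 : ℝ) < n := by exact_mod_cast hpos
      refine le_of_eq ?_
      field_simp
  rw [mul_assoc (ENNReal.ofReal (W * C))]
  exact mul_le_mul' hn' (lintegral_refLaw_le hD hG hb₀ hmL)

/-- The rate of the bias of a split functional. -/
def splitRate (P : Measure (Obs K 𝒳 𝒱)) (U : Split K) (G' G : Nuis K 𝒳 𝒱) : ℝ≥0∞ :=
  d2 P (etaAt true G') (etaAt true G) *
      (dist2 P (densAt true G') (densAt true G)
        + d2 P (subAtJ (complSplit U) true G') (subAtJ (complSplit U) true G)
        + d2 P (subAtJ U false G') (subAtJ U false G))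
    + d2 P (subAtJ (complSplit U) true G') (subAtJ (complSplit U) true G) *
      d2 P (subAtJ U false G') (subAtJ U false G)

lemma lintegral_splitBias_le (hG : MeasNuis G) (hG' : MeasNuis G') (U : Split K) :
    ∫⁻ o : Obs K 𝒳 𝒱, ENNReal.ofReal (splitBias G' G U o.1 (covMed o.2)) ∂P ≤
      splitRate P U G' G := by
  have lift : ∀ {k : ∀ n, Cov 𝒳 𝒱 n × Med K n → ℝ}, (∀ n, Measurable (k n)) →
      Measurable fun o : Obs K 𝒳 𝒱 => k o.1 (covMed o.2) := fun hk =>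
    measurable_sigma_iff.2 fun n => (hk n).comp measurable_covMed
  set E : Obs K 𝒳 𝒱 → ℝ := fun o => maxErr (etaAt true G') (etaAt true G) o.1 (covMed o.2)
  set F : Obs K 𝒳 𝒱 → ℝ := fun o =>
    |densFn G' true (covMed o.2) - densFn G true (covMed o.2)| with hFdef
  set V : Obs K 𝒳 𝒱 → ℝ := fun o =>
    maxErr (subAtJ (complSplit U) true G') (subAtJ (complSplit U) true G) o.1 (covMed o.2)
  set Y : Obs K 𝒳 𝒱 → ℝ := fun o =>
    maxErr (subAtJ U false G') (subAtJ U false G) o.1 (covMed o.2)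
  have hE : Measurable E := lift (k := maxErr _ _) fun n =>
    measurable_maxErr (fun j => hG'.measurable_etaFn j true) fun j => hG.measurable_etaFn j true
  have hF : Measurable F := lift (k := fun n z => |densFn G' true z - densFn G true z|) fun n =>
    ((hG'.measurable_densFn true).sub (hG.measurable_densFn true)).abs
  have hV : Measurable V := lift (k := maxErr _ _) fun n =>
    measurable_maxErr (fun j => hG'.measurable_subFn _ true) fun j => hG.measurable_subFn _ true
  have hY : Measurable Y := lift (k := maxErr _ _) fun n =>
    measurable_maxErr (fun j => hG'.measurable_subFn _ false) fun j => hG.measurable_subFn _ false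
  have hE0 : ∀ o, 0 ≤ E o := fun o => maxErr_nonneg _ _ _
  have hF0 : ∀ o, 0 ≤ F o := fun o => abs_nonneg _
  have hV0 : ∀ o, 0 ≤ V o := fun o => maxErr_nonneg _ _ _
  have hY0 : ∀ o, 0 ≤ Y o := fun o => maxErr_nonneg _ _ _
  have hFd : eLpNorm F 2 P = dist2 P (densAt true G') (densAt true G) :=
    eLpNorm_norm fun o : Obs K 𝒳 𝒱 => densFn G' true (covMed o.2) - densFn G true (covMed o.2)
  have e : ∀ o : Obs K 𝒳 𝒱, ENNReal.ofReal (splitBias G' G U o.1 (covMed o.2)) =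
      ENNReal.ofReal (E o * F o) + ENNReal.ofReal (E o * V o) + ENNReal.ofReal (E o * Y o)
        + ENNReal.ofReal (V o * Y o) := by
    intro o
    rw [← ENNReal.ofReal_add (mul_nonneg (hE0 o) (hF0 o)) (mul_nonneg (hE0 o) (hV0 o)),
      ← ENNReal.ofReal_add (add_nonneg (mul_nonneg (hE0 o) (hF0 o)) (mul_nonneg (hE0 o) (hV0 o)))
        (mul_nonneg (hE0 o) (hY0 o)),
      ← ENNReal.ofReal_add (add_nonneg (add_nonneg (mul_nonneg (hE0 o) (hF0 o))
        (mul_nonneg (hE0 o) (hV0 o))) (mul_nonneg (hE0 o) (hY0 o))) (mul_nonneg (hV0 o) (hY0 o)),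
      ← mul_add, ← mul_add]
    rfl
  have mVY : Measurable fun o => ENNReal.ofReal (V o * Y o) := (hV.mul hY).ennreal_ofReal
  have mEY : Measurable fun o => ENNReal.ofReal (E o * Y o) := (hE.mul hY).ennreal_ofReal
  have mEV : Measurable fun o => ENNReal.ofReal (E o * V o) := (hE.mul hV).ennreal_ofReal
  rw [lintegral_congr e, lintegral_add_right _ mVY, lintegral_add_right _ mEY,
    lintegral_add_right _ mEV]
  refine (add_le_add (add_le_add (add_le_add (lintegral_ofReal_mul_le hE hF hE0 hF0)
    (lintegral_ofReal_mul_le hE hV hE0 hV0)) (lintegral_ofReal_mul_le hE hY hE0 hY0))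
    (lintegral_ofReal_mul_le hV hY hV0 hY0)).trans (le_of_eq ?_)
  rw [hFd, ← mul_add, ← mul_add]
  rfl

/-- The bias of a one-step estimator of a split functional is of second order in the errors of the
nuisance functions. -/
lemma bias_phiSplit_le [IsProbabilityMeasure P] (hD : Standing D P) (hG : IsNuisOf D P G)
    (hb₀ : IsDensLB D P G b₀) (hb : 0 < b) (hB : 0 ≤ B) (hW0 : 0 ≤ W)
    (hW : ∀ n, ∀ᵐ z ∂(refLaw D P n), |D.w z.1.2 n| ≤ W) {U : Split K} (hm' : MeasNuis G')
    (hGB : ∀ n j, SplitBdd D P j (U n j) B b G) (h : ∀ n j, SplitBdd D P j (U n j) B b G') :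
    ‖∫ o, phiSplit D G' U o ∂P - thetaSplit D P G U‖ₑ ≤
      ENNReal.ofReal (W * (B * B / b + B)) * refConst D b₀ * splitRate P U G' G := by
  unfold thetaSplit
  refine (enorm_integral_sub_law_le hD.bounded_size
    (C := ENNReal.ofReal (W * (B * B / b + B)) * refConst D b₀)
    ((memLp_phiSplit hD hG hb₀ hb hB hW hm' hGB h).integrable (by norm_num))
    (integrable_integrandSplit hD hG hb₀ hW hGB)
    (H := fun o => ENNReal.ofReal (splitBias G' G U o.1 (covMed o.2))) fun n hn => ?_).trans ?_
  · exact splitBias_stratum hD hG hb₀ hb hB hW0 hW hm' hGB h hn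
  · exact mul_le_mul_right (lintegral_splitBias_le hG.measNuis hm' U) _

/-- Bounds on the differences of individual contributions add up over individuals and cluster
sizes. -/
lemma eLpNorm_sum_strata_le [IsProbabilityMeasure P] (hD : Standing D P) (hG : IsNuisOf D P G)
    (hW : ∀ n, ∀ᵐ z ∂(refLaw D P n), |D.w z.1.2 n| ≤ W) {Nmax : ℕ} (hN : ∀ᵐ o ∂P, o.1 ≤ Nmax)
    {Φ Φ' : Obs K 𝒳 𝒱 → ℝ} {ψ ψ' : ∀ n, Fin n → Dat K 𝒳 𝒱 n → ℝ}
    (hΦ' : ∀ {n} (o : Dat K 𝒳 𝒱 n), Φ' ⟨n, o⟩ = D.w (cov o).2 n / n * ∑ j, ψ' n j o)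
    (hΦ : ∀ {n} (o : Dat K 𝒳 𝒱 n), Φ ⟨n, o⟩ = D.w (cov o).2 n / n * ∑ j, ψ n j o)
    (hm : ∀ n, P {o | o.1 = n} ≠ 0 → ∀ j, AEStronglyMeasurable (ψ' n j) (condLaw P n) ∧
      AEStronglyMeasurable (ψ n j) (condLaw P n))
    {C : ∀ n, Fin n → ℝ≥0} {e : ∀ n, Fin n → ℝ≥0∞}
    (h : ∀ n j, eLpNorm (fun o => ψ' n j o - ψ n j o) 2 (condLaw P n) ≤ C n j * e n j) :
    eLpNorm (fun o => Φ' o - Φ o) 2 P ≤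
      (W.toNNReal * ∑ n ∈ Finset.range (Nmax + 1), ∑ j, C n j : ℝ≥0) *
        ∑ n ∈ Finset.range (Nmax + 1), ∑ j, e n j := by
  refine (eLpNorm_law_le hN _).trans ?_
  rw [Finset.mul_sum (Finset.range _) _ ((_ : ℝ≥0) : ℝ≥0∞)]
  refine Finset.sum_le_sum fun n hnr => ?_
  by_cases hn : P {o | o.1 = n} = 0
  · rw [condLaw_eq_zero P hn, eLpNorm_measure_zero]
    exact zero_le
  have h1 : ∀ o : Dat K 𝒳 𝒱 n, Φ' ⟨n, o⟩ - Φ ⟨n, o⟩ =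
      D.w (cov o).2 n / n * ∑ j, (ψ' n j o - ψ n j o) := fun o => by
    rw [hΦ', hΦ, ← mul_sub, Finset.sum_sub_distrib]
  simp only [h1]
  have hWn : ∀ᵐ o ∂(condLaw P n), |D.w (cov o).2 n / n| ≤ W := by
    filter_upwards [ae_covMed hD hG (hW n)] with o ho
    rw [abs_div, Nat.abs_cast]
    have hw : |D.w (cov o).2 n| ≤ W := ho
    rcases Nat.eq_zero_or_pos n with rfl | hpos
    · simpa using (abs_nonneg _).trans hw
    · exact (div_le_self (abs_nonneg _) (by exact_mod_cast hpos)).trans hw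
  refine (eLpNorm_weighted_sum_le hWn fun j => (hm n hn j).1.sub (hm n hn j).2).trans ?_
  refine (mul_le_mul_right (Finset.sum_le_sum fun j _ => h n j) _).trans ?_
  rw [ENNReal.coe_mul, mul_assoc]
  refine mul_le_mul_right ?_ _
  rw [Finset.mul_sum]
  refine Finset.sum_le_sum fun j _ => mul_le_mul_left ?_ _
  refine ENNReal.coe_le_coe.2 ((Finset.single_le_sum (f := fun j => C n j)
    (fun _ _ => zero_le) (Finset.mem_univ j)).trans ?_)
  exact Finset.single_le_sum (f := fun n => ∑ j : Fin n, C n j) (fun _ _ => zero_le) hnr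

/-- The estimated influence function of a split functional is as close to the true one as the
nuisance functions are. -/
lemma eLpNorm_phiSplit_sub_le [IsProbabilityMeasure P] (hD : Standing D P) (hG : IsNuisOf D P G)
    (hvar : CondVarBdd P G) (hb₀ : IsDensLB D P G b₀) (hb : 0 < b) (hB : 0 ≤ B)
    (hW : ∀ n, ∀ᵐ z ∂(refLaw D P n), |D.w z.1.2 n| ≤ W) {U : Split K}
    (hGB : ∀ n j, SplitBdd D P j (U n j) B b G) {Nmax : ℕ} (hN : ∀ᵐ o ∂P, o.1 ≤ Nmax) :
    ∃ C : ℝ≥0, ∀ G', (∀ n j, SplitBdd D P j (U n j) B b G') →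
      eLpNorm (fun o => phiSplit D G' U o - phiSplit D G U o) 2 P ≤
        C * ∑ n ∈ Finset.range (Nmax + 1), ∑ j : Fin n, ∑ i,
          nrm P (splitErr G' G j (U n j) i) := by
  have hex : ∀ n (j : Fin n), ∃ C : ℝ≥0, ∀ G', SplitBdd D P j (U n j) B b G' →
      eLpNorm (fun o => psiSplit D G' j (U n j) o - psiSplit D G j (U n j) o) 2 (condLaw P n) ≤
        C * ∑ i, nrm P (splitErr G' G j (U n j) i) := by
    intro n j
    by_cases hn : P {o | o.1 = n} = 0
    · refine ⟨0, fun G' _ => ?_⟩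
      rw [condLaw_eq_zero P hn, eLpNorm_measure_zero]
      exact zero_le
    · exact eLpNorm_psiSplit_sub_le hD hG hvar hb₀ hn hb hB (hGB n j)
  choose C hC using hex
  refine ⟨W.toNNReal * ∑ n ∈ Finset.range (Nmax + 1), ∑ j : Fin n, C n j,
    fun G' h => eLpNorm_sum_strata_le hD hG hW hN (phiSplit_mk D G' U)
      (phiSplit_mk D G U) (fun n hn j =>
        ⟨(memLp_psiSplit hD hG hb₀ hn hb hB (hGB n j) (h n j)).1,
          (memLp_psiSplit hD hG hb₀ hn hb hB (hGB n j) (hGB n j)).1⟩)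
      fun n j => hC n j G' (h n j)⟩

end SplitLaw

/-! ### The functionals with all mediators under one arm -/

section ArmLaw

lemma integrandI_mk {K n : ℕ} {𝒳 𝒱 : Type*} {D : Design K 𝒱} {G : Nuis K 𝒳 𝒱} (aStar a' : Bool)
    (o : Dat K 𝒳 𝒱 n) : integrandI D G aStar a' ⟨n, o⟩ = ∑ j, D.w (cov o).2 n / n *
      ∫ m, etaFn G j aStar (cov o, m) * densFn G a' (cov o, m) ∂(ref D n) := by
  rw [← Finset.mul_sum]
  rfl

lemma phiI_mk_sum {K n : ℕ} {𝒳 𝒱 : Type*} {D : Design K 𝒱} {G : Nuis K 𝒳 𝒱} (aStar a' : Bool)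
    (o : Dat K 𝒳 𝒱 n) :
    phiI D G aStar a' ⟨n, o⟩ = ∑ j, D.w (cov o).2 n / n * psiI D G j aStar a' o := by
  rw [phiI_mk, Finset.mul_sum]

/-- The errors of the nuisance functions that enter a functional `θ₁`. -/
def armErr {K n : ℕ} {𝒳 𝒱 : Type*} (G' G : Nuis K 𝒳 𝒱) (j : Fin n) (aStar a' : Bool) :
    Fin 3 → Cov 𝒳 𝒱 n × Med K n → ℝ :=
  ![fun z => etaFn G' j aStar z - etaFn G j aStar z,
    fun z => densFn G' aStar z - densFn G aStar z, fun z => densFn G' a' z - densFn G a' z]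

lemma sum_abs_armErr {K n : ℕ} {𝒳 𝒱 : Type*} (G' G : Nuis K 𝒳 𝒱) (j : Fin n)
    (aStar a' : Bool) (z : Cov 𝒳 𝒱 n × Med K n) : ∑ i, |armErr G' G j aStar a' i z| =
      |etaFn G' j aStar z - etaFn G j aStar z| + |densFn G' aStar z - densFn G aStar z| +
      |densFn G' a' z - densFn G a' z| := by
  rw [Fin.sum_univ_three]
  rfl

variable {K : ℕ} {𝒳 𝒱 : Type*} [MeasurableSpace 𝒳] [MeasurableSpace 𝒱]
variable {D : Design K 𝒱} {P : Measure (Obs K 𝒳 𝒱)} {G G' : Nuis K 𝒳 𝒱} {b b₀ B W : ℝ}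
variable {aStar a' : Bool}

namespace ArmBdd

variable {n : ℕ} {j : Fin n}

lemma tame_eta (h : ArmBdd D P j aStar a' B b G) : Tame D P (etaFn G j aStar) :=
  ⟨h.meas.measurable_etaFn j aStar, B, h.eta⟩

lemma tame_dens (h : ArmBdd D P j aStar a' B b G) :
    Tame D P (densFn G aStar : _ × Med K n → ℝ) :=
  ⟨h.meas.measurable_densFn aStar, B, h.dens⟩

lemma tame_dens' (h : ArmBdd D P j aStar a' B b G) : Tame D P (densFn G a' : _ × Med K n → ℝ) :=
  ⟨h.meas.measurable_densFn a', B, h.dens'⟩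

lemma tame_ratio (h : ArmBdd D P j aStar a' B b G) (hb : 0 < b) :
    Tame D P fun z : Cov 𝒳 𝒱 n × Med K n => densFn G a' z / densFn G aStar z :=
  h.tame_dens'.div h.tame_dens.1 hb h.low

lemma measurable_armErr (h : ArmBdd D P j aStar a' B b G) (h' : ArmBdd D P j aStar a' B b G')
    (i : Fin 3) : Measurable (armErr G' G j aStar a' i) := by
  fin_cases i
  · exact h'.tame_eta.1.sub h.tame_eta.1
  · exact h'.tame_dens.1.sub h.tame_dens.1
  · exact h'.tame_dens'.1.sub h.tame_dens'.1

lemma nrm_eta_le : nrm P (fun z => etaFn G' j aStar z - etaFn G j aStar z) ≤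
    ∑ i, nrm P (armErr G' G j aStar a' i) := by
  rw [Fin.sum_univ_three, add_assoc]
  exact le_self_add

lemma nrm_product_le [IsProbabilityMeasure P] (hD : Standing D P) (hG : IsNuisOf D P G)
    (hB : 0 ≤ B) (hGB : ArmBdd D P j aStar a' B b G) (h : ArmBdd D P j aStar a' B b G') :
    nrm P (fun z => etaFn G' j aStar z * densFn G' a' z - etaFn G j aStar z * densFn G a' z) ≤
      B.toNNReal * ∑ i, nrm P (armErr G' G j aStar a' i) := by
  refine nrm_le_sum hD hG (hGB.measurable_armErr h) ?_
  filter_upwards [h.eta, hGB.dens'] with z z1 z2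
  rw [sum_abs_armErr]
  refine (abs_mul_sub_mul_le z1 z2).trans (mul_le_mul_of_nonneg_left ?_ hB)
  linarith [abs_nonneg (densFn G' aStar z - densFn G aStar z)]

lemma nrm_ratio_le [IsProbabilityMeasure P] (hD : Standing D P) (hG : IsNuisOf D P G)
    (hB : 0 ≤ B) (hb : 0 < b) (hGB : ArmBdd D P j aStar a' B b G)
    (h : ArmBdd D P j aStar a' B b G') :
    nrm P (fun z : Cov 𝒳 𝒱 n × Med K n =>
      densFn G' a' z / densFn G' aStar z - densFn G a' z / densFn G aStar z) ≤
      (b⁻¹ + B / b ^ 2).toNNReal * ∑ i, nrm P (armErr G' G j aStar a' i) := by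
  refine nrm_le_sum hD hG (hGB.measurable_armErr h) ?_
  filter_upwards [hGB.dens', hGB.low, h.low] with z z1 z2 z3
  rw [sum_abs_armErr]
  refine (abs_div_sub_div_le hb z1 z2 z3).trans ?_
  have hb1 : 0 ≤ b⁻¹ := (inv_pos.2 hb).le
  have hb2 : 0 ≤ B / b ^ 2 := by positivity
  have p1 := abs_nonneg (etaFn G' j aStar z - etaFn G j aStar z)
  have p2 := abs_nonneg (densFn G' aStar z - densFn G aStar z)
  have p3 := abs_nonneg (densFn G' a' z - densFn G a' z)
  nlinarith [mul_nonneg hb1 p1, mul_nonneg hb1 p2, mul_nonneg hb2 p1, mul_nonneg hb2 p3]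

end ArmBdd

section Stratum

variable {n : ℕ} {j : Fin n}

lemma memLp_psiI_terms [IsProbabilityMeasure P] (hD : Standing D P) (hG : IsNuisOf D P G)
    (hb₀ : IsDensLB D P G b₀) (hn : P {o | o.1 = n} ≠ 0) (hb : 0 < b)
    (h : ArmBdd D P j aStar a' B b G') :
    MemLp (resTerm D aStar j (fun z => densFn G' a' z / densFn G' aStar z)
        (etaFn G' j aStar)) 2 (condLaw P n) ∧
      MemLp (fun o => ipw D a' (trt o) * etaFn G' j aStar (covMed o)) 2 (condLaw P n) ∧
      MemLp (fun o => (1 - ipw D a' (trt o)) *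
        ∫ m, etaFn G' j aStar (cov o, m) * densFn G' a' (cov o, m) ∂(ref D n)) 2
        (condLaw P n) := by
  refine ⟨memLp_resTerm hD hG aStar j (h.tame_ratio hb) h.tame_eta,
    memLp_ipw_mul hD a' (h.tame_eta.memLp_covMed hD hG), ?_⟩
  refine memLp_bdd_mul (B := 1 + 1 / prob D a')
    ((h.tame_eta.mul h.tame_dens').memLp_integral_ref hD hG hb₀ hn)
    (measurable_const.sub ((measurable_ipw a').comp measurable_trt)) (ae_of_all _ fun o => ?_)
  refine (abs_sub _ _).trans ?_
  rw [abs_one]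
  gcongr
  exact abs_ipw_le hD _ _

lemma memLp_psiI [IsProbabilityMeasure P] (hD : Standing D P) (hG : IsNuisOf D P G)
    (hb₀ : IsDensLB D P G b₀) (hn : P {o | o.1 = n} ≠ 0) (hb : 0 < b)
    (h : ArmBdd D P j aStar a' B b G') : MemLp (psiI D G' j aStar a') 2 (condLaw P n) := by
  obtain ⟨h1, h2, h3⟩ := memLp_psiI_terms hD hG hb₀ hn hb h
  exact (h1.add h2).add h3

/-- The bias of a one-step estimator of `θ₁` is a product of errors. -/
lemma integral_psiI [IsProbabilityMeasure P] (hD : Standing D P) (hG : IsNuisOf D P G)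
    (hb₀ : IsDensLB D P G b₀) (hn : P {o | o.1 = n} ≠ 0) (hb : 0 < b)
    (hGB : ArmBdd D P j aStar a' B b G) (h : ArmBdd D P j aStar a' B b G') {ω : Cov 𝒳 𝒱 n → ℝ}
    (hωm : Measurable ω) (hω : Tame D P fun z : Cov 𝒳 𝒱 n × Med K n => ω z.1) :
    ∫ o, ω (cov o) * psiI D G' j aStar a' o ∂(condLaw P n)
      - ∫ o, ω (cov o) * ∫ m, etaFn G j aStar (cov o, m) * densFn G a' (cov o, m) ∂(ref D n)
          ∂(condLaw P n) =
    ∫ z, ω z.1 * ((etaFn G j aStar z - etaFn G' j aStar z) *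
        (densFn G' a' z / densFn G' aStar z * densFn G aStar z - densFn G a' z))
          ∂(refLaw D P n) := by
  obtain ⟨h1, h2, h3⟩ := memLp_psiI_terms hD hG hb₀ hn hb h
  obtain ⟨W, hW⟩ := hω.2
  have hWc : ∀ᵐ o ∂(condLaw P n), |ω (cov o)| ≤ W := ae_covMed hD hG hW
  have hωc : Measurable fun o : Dat K 𝒳 𝒱 n => ω (cov o) := hωm.comp measurable_cov
  have int : ∀ {F : Dat K 𝒳 𝒱 n → ℝ}, MemLp F 2 (condLaw P n) →
      Integrable (fun o => ω (cov o) * F o) (condLaw P n) := fun hF =>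
    (memLp_bdd_mul hF hωc hWc).integrable (by norm_num)
  have hk := h.tame_eta.mul h.tame_dens'
  have hk0 := hGB.tame_eta.mul hGB.tame_dens'
  have m3 := hk.memLp_integral_ref hD hG hb₀ hn
  have e1 := integral_resTerm hD hG aStar j (h.tame_ratio hb) h.tame_eta hGB.tame_eta hω
  have e2 := integral_weight_ipw hD hG a' h.tame_eta hω
  have e3 : ∫ o, ω (cov o) * ((1 - ipw D a' (trt o)) *
      ∫ m, etaFn G' j aStar (cov o, m) * densFn G' a' (cov o, m) ∂(ref D n))
        ∂(condLaw P n) = 0 := by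
    have : ∀ o : Dat K 𝒳 𝒱 n, ω (cov o) * ((1 - ipw D a' (trt o)) *
        ∫ m, etaFn G' j aStar (cov o, m) * densFn G' a' (cov o, m) ∂(ref D n)) =
        ω (cov o) * (∫ m, etaFn G' j aStar (cov o, m) * densFn G' a' (cov o, m) ∂(ref D n))
        - ω (cov o) * (ipw D a' (trt o) *
          ∫ m, etaFn G' j aStar (cov o, m) * densFn G' a' (cov o, m) ∂(ref D n)) := by
      intro o
      ring
    rw [integral_congr_ae (ae_of_all _ this), integral_sub (int m3)
      (int (memLp_ipw_mul hD a' m3)), integral_weight_ref hD hG hb₀ hk hω,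
      integral_weight_ipw_ref hD hG hb₀ a' hk hωm hω, sub_self]
  have hs : ∀ o : Dat K 𝒳 𝒱 n, ω (cov o) * psiI D G' j aStar a' o =
      ω (cov o) * resTerm D aStar j (fun z => densFn G' a' z / densFn G' aStar z)
        (etaFn G' j aStar) o
      + ω (cov o) * (ipw D a' (trt o) * etaFn G' j aStar (covMed o))
      + ω (cov o) * ((1 - ipw D a' (trt o)) *
        ∫ m, etaFn G' j aStar (cov o, m) * densFn G' a' (cov o, m) ∂(ref D n)) := by
    intro o
    rw [← mul_add, ← mul_add]
    rfl
  have i12 : Integrable (fun o => ω (cov o) * resTerm D aStar j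
      (fun z => densFn G' a' z / densFn G' aStar z) (etaFn G' j aStar) o
      + ω (cov o) * (ipw D a' (trt o) * etaFn G' j aStar (covMed o))) (condLaw P n) :=
    (int h1).add (int h2)
  rw [integral_congr_ae (ae_of_all _ hs), integral_add i12 (int h3), integral_add (int h1) (int h2),
    e1, e2, e3, add_zero, integral_weight_ref hD hG hb₀ hk0 hω]
  have i1 := (hω.mul (((h.tame_ratio hb).mul (hGB.tame_eta.sub h.tame_eta)).mul
    hGB.tame_dens)).integrable hD hG hb₀
  have i2 := (hω.mul (h.tame_eta.mul hGB.tame_dens')).integrable hD hG hb₀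
  have i5 := (hω.mul hk0).integrable hD hG hb₀
  refine Eq.trans (congrArg₂ _ (integral_add i1 i2).symm rfl) ?_
  refine Eq.trans (integral_sub (i1.add i2) i5).symm ?_
  refine integral_congr_ae (ae_of_all _ fun z => ?_)
  simp only [Pi.add_apply, etaFn, densFn]
  ring

lemma eLpNorm_psiI_sub_le [IsProbabilityMeasure P] (hD : Standing D P)
    (hG : IsNuisOf D P G) (hvar : CondVarBdd P G) (hb₀ : IsDensLB D P G b₀)
    (hn : P {o | o.1 = n} ≠ 0) (hb : 0 < b) (hB : 0 ≤ B)
    (hGB : ArmBdd D P j aStar a' B b G) :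
    ∃ C : ℝ≥0, ∀ G', ArmBdd D P j aStar a' B b G' →
      eLpNorm (fun o => psiI D G' j aStar a' o - psiI D G j aStar a' o) 2 (condLaw P n) ≤
        C * ∑ i, nrm P (armErr G' G j aStar a' i) := by
  obtain ⟨C₁, hC₁⟩ := eLpNorm_resTerm_sub_le hD hG hvar aStar j (B / b) (hGB.tame_ratio hb)
  set c₂ : ℝ≥0 := Real.toNNReal (1 / prob D a')
  set c₃ : ℝ≥0 := Real.toNNReal (1 + 1 / prob D a')
  set cr : ℝ := b⁻¹ + B / b ^ 2
  refine ⟨C₁ * (cr.toNNReal + 1) + c₂ + c₃ * (refConst D b₀ * B.toNNReal), fun G' h => ?_⟩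
  set T : ℝ≥0∞ := ∑ i, nrm P (armErr G' G j aStar a' i) with hT
  obtain ⟨g1, g2, g3⟩ := memLp_psiI_terms hD hG hb₀ hn hb hGB
  obtain ⟨h1, h2, h3⟩ := memLp_psiI_terms hD hG hb₀ hn hb h
  have de : nrm P (fun z => etaFn G' j aStar z - etaFn G j aStar z) ≤ T := ArmBdd.nrm_eta_le
  have dp := ArmBdd.nrm_product_le hD hG hB hGB h
  have dr := ArmBdd.nrm_ratio_le hD hG hB hb hGB h
  rw [← hT] at dp dr
  have b1 := (hC₁ _ _ (h.tame_ratio hb).1 h.tame_eta.1 (by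
    filter_upwards [h.dens', h.low] with z z1 z2
    rw [abs_div, abs_of_pos (hb.trans_le z2)]
    exact div_le_div₀ hB z1 hb z2)).trans (mul_le_mul_right (add_le_add dr de) _)
  have b2 : eLpNorm (fun o => ipw D a' (trt o) * etaFn G' j aStar (covMed o) -
      ipw D a' (trt o) * etaFn G j aStar (covMed o)) 2 (condLaw P n) ≤ c₂ * T := by
    refine le_trans ?_ (mul_le_mul_right de _)
    refine eLpNorm_le_nnreal_smul_eLpNorm_of_ae_le_mul (ae_of_all _ fun o => ?_) 2
    rw [← mul_sub, nnnorm_mul]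
    gcongr
    rw [← NNReal.coe_le_coe, coe_nnnorm]
    exact (abs_ipw_le hD _ _).trans (Real.le_coe_toNNReal _)
  have b3 : eLpNorm (fun o => (1 - ipw D a' (trt o)) *
        (∫ m, etaFn G' j aStar (cov o, m) * densFn G' a' (cov o, m) ∂(ref D n))
      - (1 - ipw D a' (trt o)) *
        (∫ m, etaFn G j aStar (cov o, m) * densFn G a' (cov o, m) ∂(ref D n))) 2 (condLaw P n) ≤
      c₃ * (refConst D b₀ * (B.toNNReal * T)) := by
    have e := (eLpNorm_integral_ref_sub_le hD hG hb₀ hn (hGB.tame_eta.mul hGB.tame_dens')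
      (h.tame_eta.mul h.tame_dens')).trans (mul_le_mul_right dp _)
    refine le_trans ?_ (mul_le_mul_right e _)
    refine eLpNorm_le_nnreal_smul_eLpNorm_of_ae_le_mul (ae_of_all _ fun o => ?_) 2
    rw [← mul_sub, nnnorm_mul]
    gcongr
    rw [← NNReal.coe_le_coe, coe_nnnorm]
    refine le_trans ?_ (Real.le_coe_toNNReal _)
    refine (abs_sub _ _).trans ?_
    rw [abs_one]
    gcongr
    exact abs_ipw_le hD _ _
  have hsplit : (fun o => psiI D G' j aStar a' o - psiI D G j aStar a' o) =
      (((fun o => resTerm D aStar j (fun z => densFn G' a' z / densFn G' aStar z)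
          (etaFn G' j aStar) o - resTerm D aStar j (fun z => densFn G a' z / densFn G aStar z)
          (etaFn G j aStar) o) +
      fun o => ipw D a' (trt o) * etaFn G' j aStar (covMed o) -
        ipw D a' (trt o) * etaFn G j aStar (covMed o)) +
      fun o => (1 - ipw D a' (trt o)) *
        (∫ m, etaFn G' j aStar (cov o, m) * densFn G' a' (cov o, m) ∂(ref D n))
      - (1 - ipw D a' (trt o)) *
        (∫ m, etaFn G j aStar (cov o, m) * densFn G a' (cov o, m) ∂(ref D n))) := by
    funext o
    simp only [psiI, Pi.add_apply]
    ring
  have m1 := h1.1.sub g1.1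
  have m2 := h2.1.sub g2.1
  have m3 := h3.1.sub g3.1
  rw [hsplit]
  refine (eLpNorm_add_le (m1.add m2) m3 (by norm_num)).trans ?_
  refine (add_le_add ((eLpNorm_add_le m1 m2 (by norm_num)).trans (add_le_add b1 b2)) b3).trans ?_
  refine le_of_eq ?_
  simp only [ENNReal.coe_add, ENNReal.coe_mul, ENNReal.coe_one]
  ring

end Stratum

lemma integrable_integrandI [IsProbabilityMeasure P] (hD : Standing D P)
    (hG : IsNuisOf D P G) (hb₀ : IsDensLB D P G b₀)
    (hW : ∀ n, ∀ᵐ z ∂(refLaw D P n), |D.w z.1.2 n| ≤ W)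
    (hGB : ∀ n (j : Fin n), ArmBdd D P j aStar a' B b G) :
    Integrable (integrandI D G aStar a') P := by
  refine integrable_law P hD.bounded_size fun n hn => ?_
  simp only [integrandI_mk]
  exact integrable_finsetSum _ fun j _ => integrable_weight_mul hD hG
    (measurable_weight_div hD) (tame_weight hD hW)
    (((hGB n j).tame_eta.mul (hGB n j).tame_dens').memLp_integral_ref hD hG hb₀ hn)

lemma ae_integrable_etaStarKernel [IsProbabilityMeasure P] (hD : Standing D P)
    (hG : IsNuisOf D P G) (hb₀ : IsDensLB D P G b₀)
    (hGB : ∀ n (j : Fin n), ArmBdd D P j aStar a' B b G) :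
    ∀ᵐ o ∂P, ∀ j, Integrable (etaStarKernel G j aStar a' (cov o.2)) (ref D o.1) := by
  refine ae_law_iff P hD.bounded_size fun n hn => ?_
  refine (ae_all_iff (ι := Fin n)).2 fun j => ?_
  obtain ⟨hk, C, hC⟩ := (hGB n j).tame_eta.mul (hGB n j).tame_dens'
  exact ae_integrable_ref hD hG hb₀ hn hk hC

lemma memLp_phiI [IsProbabilityMeasure P] (hD : Standing D P) (hG : IsNuisOf D P G)
    (hb₀ : IsDensLB D P G b₀) (hb : 0 < b)
    (hW : ∀ n, ∀ᵐ z ∂(refLaw D P n), |D.w z.1.2 n| ≤ W) (hm' : MeasNuis G')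
    (h : ∀ n (j : Fin n), ArmBdd D P j aStar a' B b G') : MemLp (phiI D G' aStar a') 2 P := by
  refine memLp_law hD.bounded_size
    ((measurable_phiI hD hm'.jointMeas aStar a').comp (measurable_const (a := ()) |>.prodMk
      measurable_id)) fun n hn => ?_
  simp only [phiI_mk_sum]
  refine memLp_finsetSum _ fun j _ => ?_
  obtain ⟨C, hC⟩ := (tame_weight (n := n) hD hW).2
  exact memLp_bdd_mul (memLp_psiI hD hG hb₀ hn hb (h n j))
    ((measurable_weight_div hD).comp measurable_cov) (ae_covMed hD hG hC)

/-- The integrand of the bound on the bias for `θ₁`. -/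
def armBias (G' G : Nuis K 𝒳 𝒱) (aStar a' : Bool) (n : ℕ) (z : Cov 𝒳 𝒱 n × Med K n) : ℝ :=
  |etaBarAt aStar G' n z.1 z.2 - etaBarAt aStar G n z.1 z.2| *
    (|densFn G' aStar z - densFn G aStar z| + |densFn G' a' z - densFn G a' z|)

lemma measurable_etaBarAt (hG : MeasNuis G) (a : Bool) (n : ℕ) :
    Measurable fun z : Cov 𝒳 𝒱 n × Med K n => etaBarAt a G n z.1 z.2 :=
  (Finset.measurable_sum _ fun j _ => hG.measurable_etaFn j a).const_mul _

lemma measurable_armBias (hG : MeasNuis G) (hG' : MeasNuis G') (aStar a' : Bool) (n : ℕ) :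
    Measurable (armBias G' G aStar a' n) :=
  ((measurable_etaBarAt hG' aStar n).sub (measurable_etaBarAt hG aStar n)).abs.mul
    (((hG'.measurable_densFn aStar).sub (hG.measurable_densFn aStar)).abs.add
      ((hG'.measurable_densFn a').sub (hG.measurable_densFn a')).abs)

lemma abs_ratio_mul_sub_le {f f' g g' : ℝ} (hb : 0 < b) (hf' : b ≤ f') (hg' : |g'| ≤ B) :
    |g' / f' * f - g| ≤ (B / b + 1) * (|f' - f| + |g' - g|) := by
  have hf0 : 0 < f' := hb.trans_le hf'
  have hB : 0 ≤ B := (abs_nonneg _).trans hg'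
  have h1 : g' / f' * f - g = -(g' / f' * (f' - f)) + (g' - g) := by
    field_simp
    ring
  have h2 : |g' / f'| ≤ B / b := by
    rw [abs_div, abs_of_pos hf0]
    exact div_le_div₀ hB hg' hb hf'
  rw [h1]
  refine (abs_add_le _ _).trans ?_
  rw [abs_neg, abs_mul]
  have t1 := mul_le_mul_of_nonneg_right h2 (abs_nonneg (f' - f))
  have hBb : 0 ≤ B / b := by positivity
  nlinarith [mul_nonneg hBb (abs_nonneg (g' - g)), abs_nonneg (f' - f)]

lemma armBias_stratum [IsProbabilityMeasure P] (hD : Standing D P) (hG : IsNuisOf D P G)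
    (hb₀ : IsDensLB D P G b₀) (hb : 0 < b) (hB : 0 ≤ B) (hW0 : 0 ≤ W)
    (hW : ∀ n, ∀ᵐ z ∂(refLaw D P n), |D.w z.1.2 n| ≤ W) (hm' : MeasNuis G')
    (hGB : ∀ n (j : Fin n), ArmBdd D P j aStar a' B b G)
    (h : ∀ n (j : Fin n), ArmBdd D P j aStar a' B b G')
    {n : ℕ} (hn : P {o | o.1 = n} ≠ 0) :
    ‖∫ o, phiI D G' aStar a' ⟨n, o⟩ ∂(condLaw P n)
        - ∫ o, integrandI D G aStar a' ⟨n, o⟩ ∂(condLaw P n)‖ₑ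
      ≤ ENNReal.ofReal (W * (B / b + 1)) * refConst D b₀ *
        ∫⁻ o, ENNReal.ofReal (armBias G' G aStar a' n (covMed o)) ∂(condLaw P n) := by
  set C : ℝ := B / b + 1 with hCdef
  have hC : 0 ≤ C := by positivity
  have hωm := measurable_weight_div (K := K) (𝒳 := 𝒳) (n := n) hD
  have hω := tame_weight (K := K) (𝒳 := 𝒳) (n := n) hD hW
  have hmL : Measurable fun z : Cov 𝒳 𝒱 n × Med K n =>
      ENNReal.ofReal (armBias G' G aStar a' n z) :=
    (measurable_armBias hG.measNuis hm' aStar a' n).ennreal_ofReal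
  -- an empty cluster contributes the empty sum
  rcases Nat.eq_zero_or_pos n with hn0 | hpos
  · subst hn0
    simp only [phiI_mk_sum, integrandI_mk, Finset.univ_eq_empty, Finset.sum_empty, integral_zero,
      sub_self, enorm_zero]
    exact zero_le
  simp only [phiI_mk_sum, integrandI_mk]
  rw [integral_finsetSum _ fun j _ => integrable_weight_mul hD hG hωm hω
      (memLp_psiI hD hG hb₀ hn hb (h n j)),
    integral_finsetSum _ fun j _ => integrable_weight_mul hD hG hωm hω
      (((hGB n j).tame_eta.mul (hGB n j).tame_dens').memLp_integral_ref hD hG hb₀ hn),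
    ← Finset.sum_sub_distrib, Finset.sum_congr rfl fun j _ =>
      integral_psiI hD hG hb₀ hn hb (hGB n j) (h n j) hωm hω, ← integral_finsetSum]
  · rw [mul_assoc]
    refine le_trans ?_ (mul_le_mul_right (lintegral_refLaw_le hD hG hb₀ hmL) _)
    rw [← lintegral_const_mul' _ _ ENNReal.ofReal_ne_top]
    refine (enorm_integral_le_lintegral_enorm _).trans (lintegral_mono_ae ?_)
    filter_upwards [hW n, (h n ⟨0, hpos⟩).low, (h n ⟨0, hpos⟩).dens'] with z w1 z1 z2
    rw [← ENNReal.ofReal_mul (by positivity), ← ofReal_norm, Real.norm_eq_abs]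
    refine ENNReal.ofReal_le_ofReal ?_
    set H : ℝ := densFn G' a' z / densFn G' aStar z * densFn G aStar z - densFn G a' z with hH
    have e : ∑ j : Fin n, D.w z.1.2 n / n * ((etaFn G j aStar z - etaFn G' j aStar z) * H) =
        D.w z.1.2 n * (-(etaBarAt aStar G' n z.1 z.2 - etaBarAt aStar G n z.1 z.2) * H) := by
      rw [← Finset.mul_sum, ← Finset.sum_mul, Finset.sum_sub_distrib]
      simp only [etaBarAt, etaFn]
      ring
    rw [e, abs_mul, abs_mul, abs_neg, mul_assoc]
    refine mul_le_mul w1 ?_ (by positivity) hW0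
    rw [armBias, mul_left_comm]
    exact mul_le_mul_of_nonneg_left (abs_ratio_mul_sub_le hb z1 z2) (abs_nonneg _)
  · intro j _
    exact (hω.mul (((hGB n j).tame_eta.sub (h n j).tame_eta).mul
      ((((h n j).tame_ratio hb).mul (hGB n j).tame_dens).sub (hGB n j).tame_dens'))).integrable
      hD hG hb₀

/-- The rate of the bias for `θ₁`. -/
def armRate (P : Measure (Obs K 𝒳 𝒱)) (aStar a' : Bool) (G' G : Nuis K 𝒳 𝒱) : ℝ≥0∞ :=
  dist2 P (etaBarAt aStar G') (etaBarAt aStar G) *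
    (dist2 P (densAt aStar G') (densAt aStar G) + dist2 P (densAt a' G') (densAt a' G))

lemma lintegral_armBias_le (hG : MeasNuis G) (hG' : MeasNuis G') (aStar a' : Bool) :
    ∫⁻ o : Obs K 𝒳 𝒱, ENNReal.ofReal (armBias G' G aStar a' o.1 (covMed o.2)) ∂P ≤
      armRate P aStar a' G' G := by
  have lift : ∀ {k : ∀ n, Cov 𝒳 𝒱 n × Med K n → ℝ}, (∀ n, Measurable (k n)) →
      Measurable fun o : Obs K 𝒳 𝒱 => k o.1 (covMed o.2) := fun hk =>
    measurable_sigma_iff.2 fun n => (hk n).comp measurable_covMed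
  set E : Obs K 𝒳 𝒱 → ℝ := fun o => |etaBarAt aStar G' o.1 (cov o.2) (med o.2)
    - etaBarAt aStar G o.1 (cov o.2) (med o.2)|
  set F : Bool → Obs K 𝒳 𝒱 → ℝ := fun a o =>
    |densFn G' a (covMed o.2) - densFn G a (covMed o.2)|
  have hE : Measurable E := lift
    (k := fun n z => |etaBarAt aStar G' n z.1 z.2 - etaBarAt aStar G n z.1 z.2|) fun n =>
    ((measurable_etaBarAt hG' aStar n).sub (measurable_etaBarAt hG aStar n)).abs
  have hF : ∀ a, Measurable (F a) := fun a =>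
    lift (k := fun n z => |densFn G' a z - densFn G a z|) fun n =>
      ((hG'.measurable_densFn a).sub (hG.measurable_densFn a)).abs
  have hE0 : ∀ o, 0 ≤ E o := fun o => abs_nonneg _
  have hF0 : ∀ a o, 0 ≤ F a o := fun a o => abs_nonneg _
  have hEd : eLpNorm E 2 P = dist2 P (etaBarAt aStar G') (etaBarAt aStar G) :=
    eLpNorm_norm fun o : Obs K 𝒳 𝒱 => etaBarAt aStar G' o.1 (cov o.2) (med o.2)
      - etaBarAt aStar G o.1 (cov o.2) (med o.2)
  have hFd : ∀ a, eLpNorm (F a) 2 P = dist2 P (densAt a G') (densAt a G) := fun a =>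
    eLpNorm_norm fun o : Obs K 𝒳 𝒱 => densFn G' a (covMed o.2) - densFn G a (covMed o.2)
  have e : ∀ o : Obs K 𝒳 𝒱, ENNReal.ofReal (armBias G' G aStar a' o.1 (covMed o.2)) =
      ENNReal.ofReal (E o * F aStar o) + ENNReal.ofReal (E o * F a' o) := by
    intro o
    rw [← ENNReal.ofReal_add (mul_nonneg (hE0 o) (hF0 aStar o)) (mul_nonneg (hE0 o) (hF0 a' o)),
      ← mul_add]
    rfl
  have mEF : Measurable fun o => ENNReal.ofReal (E o * F a' o) := (hE.mul (hF a')).ennreal_ofReal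
  rw [lintegral_congr e, lintegral_add_right _ mEF]
  refine (add_le_add (lintegral_ofReal_mul_le hE (hF aStar) hE0 (hF0 aStar))
    (lintegral_ofReal_mul_le hE (hF a') hE0 (hF0 a'))).trans (le_of_eq ?_)
  rw [hFd, hFd, hEd, ← mul_add]
  rfl

/-- The bias of a one-step estimator of `θ₁` is of second order in the errors of the nuisance
functions. -/
lemma bias_phiI_le [IsProbabilityMeasure P] (hD : Standing D P) (hG : IsNuisOf D P G)
    (hb₀ : IsDensLB D P G b₀) (hb : 0 < b) (hB : 0 ≤ B) (hW0 : 0 ≤ W)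
    (hW : ∀ n, ∀ᵐ z ∂(refLaw D P n), |D.w z.1.2 n| ≤ W) (hm' : MeasNuis G')
    (hGB : ∀ n (j : Fin n), ArmBdd D P j aStar a' B b G)
    (h : ∀ n (j : Fin n), ArmBdd D P j aStar a' B b G') :
    ‖∫ o, phiI D G' aStar a' o ∂P - thetaI D P G aStar a'‖ₑ ≤
      ENNReal.ofReal (W * (B / b + 1)) * refConst D b₀ * armRate P aStar a' G' G := by
  unfold thetaI
  refine (enorm_integral_sub_law_le hD.bounded_size
    (C := ENNReal.ofReal (W * (B / b + 1)) * refConst D b₀)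
    ((memLp_phiI hD hG hb₀ hb hW hm' h).integrable (by norm_num))
    (integrable_integrandI hD hG hb₀ hW hGB)
    (H := fun o => ENNReal.ofReal (armBias G' G aStar a' o.1 (covMed o.2))) fun n hn => ?_).trans ?_
  · exact armBias_stratum hD hG hb₀ hb hB hW0 hW hm' hGB h hn
  · exact mul_le_mul_right (lintegral_armBias_le hG.measNuis hm' aStar a') _

/-- The estimated influence function of `θ₁` is as close to the true one as the nuisance functions
are. -/
lemma eLpNorm_phiI_sub_le [IsProbabilityMeasure P] (hD : Standing D P) (hG : IsNuisOf D P G)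
    (hvar : CondVarBdd P G) (hb₀ : IsDensLB D P G b₀) (hb : 0 < b) (hB : 0 ≤ B)
    (hW : ∀ n, ∀ᵐ z ∂(refLaw D P n), |D.w z.1.2 n| ≤ W)
    (hGB : ∀ n (j : Fin n), ArmBdd D P j aStar a' B b G) {Nmax : ℕ}
    (hN : ∀ᵐ o ∂P, o.1 ≤ Nmax) :
    ∃ C : ℝ≥0, ∀ G', (∀ n (j : Fin n), ArmBdd D P j aStar a' B b G') →
      eLpNorm (fun o => phiI D G' aStar a' o - phiI D G aStar a' o) 2 P ≤
        C * ∑ n ∈ Finset.range (Nmax + 1), ∑ j : Fin n, ∑ i,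
          nrm P (armErr G' G j aStar a' i) := by
  have hex : ∀ n (j : Fin n), ∃ C : ℝ≥0, ∀ G', ArmBdd D P j aStar a' B b G' →
      eLpNorm (fun o => psiI D G' j aStar a' o - psiI D G j aStar a' o) 2 (condLaw P n) ≤
        C * ∑ i, nrm P (armErr G' G j aStar a' i) := by
    intro n j
    by_cases hn : P {o | o.1 = n} = 0
    · refine ⟨0, fun G' _ => ?_⟩
      rw [condLaw_eq_zero P hn, eLpNorm_measure_zero]
      exact zero_le
    · exact eLpNorm_psiI_sub_le hD hG hvar hb₀ hn hb hB (hGB n j)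
  choose C hC using hex
  refine ⟨W.toNNReal * ∑ n ∈ Finset.range (Nmax + 1), ∑ j : Fin n, C n j,
    fun G' h => eLpNorm_sum_strata_le hD hG hW hN (phiI_mk D G' aStar a')
      (phiI_mk D G aStar a') (fun n hn j => ⟨(memLp_psiI hD hG hb₀ hn hb (h n j)).1,
        (memLp_psiI hD hG hb₀ hn hb (hGB n j)).1⟩) fun n j => hC n j G' (h n j)⟩

end ArmLaw

/-! ### Bounds on the true nuisance functions -/

section Bounds

variable {K S : ℕ} {𝒳 𝒱 Ω : Type*} [MeasurableSpace 𝒳] [MeasurableSpace 𝒱] [MeasurableSpace Ω]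
variable {Pr : Measure Ω} {D : Design K 𝒱} {P : Measure (Obs K 𝒳 𝒱)} {G : Nuis K 𝒳 𝒱}
variable {Gh : RandNuis Ω K 𝒳 𝒱 S} {b : ℝ}

lemma exists_weight_bound [IsProbabilityMeasure P] (hD : Standing D P) (hw : WeightBdd D P) :
    ∃ W : ℝ, 0 ≤ W ∧ ∀ n, ∀ᵐ z ∂(refLaw D P n), |D.w z.1.2 n| ≤ W := by
  obtain ⟨B, hB⟩ := hw
  refine ⟨max B 0, le_max_right _ _, fun n => ?_⟩
  have hm : Measurable fun z : Cov 𝒳 𝒱 n × Med K n => |D.w z.1.2 n| :=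
    ((hD.measurable_w n).comp (measurable_snd.comp measurable_fst)).abs
  refine (ae_refLaw_iff hD (measurableSet_le hm measurable_const)).2 ?_
  filter_upwards [ae_condLaw P hB n] with o ho
  exact ae_of_all _ fun m => ho.trans (le_max_left _ _)

/-- Limits in probability of uniformly bounded functions are bounded by the same constant. -/
lemma ae_abs_le_of_isLittleOP [IsProbabilityMeasure Pr] [IsProbabilityMeasure P]
    (hD : Standing D P) (hG : IsNuisOf D P G) (hb : IsDensLB D P G b) {n : ℕ} {B : ℝ}
    {x : ℕ → Ω → Cov 𝒳 𝒱 n × Med K n → ℝ} {g : Cov 𝒳 𝒱 n × Med K n → ℝ} (hg : Measurable g)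
    (hx : ∀ I, ∀ᵐ ω ∂Pr, ∀ᵐ z ∂(refLaw D P n), |x I ω z| ≤ B)
    (hc : IsLittleOP Pr fun I ω => nrm P fun z => x I ω z - g z) :
    ∀ᵐ z ∂(refLaw D P n), |g z| ≤ B := by
  set e : Dat K 𝒳 𝒱 n → ℝ := fun o => max (|g (covMed o)| - B) 0
  have hem : Measurable e :=
    ((hg.comp measurable_covMed).abs.sub measurable_const).max measurable_const
  have he : eLpNorm e 2 (condLaw P n) = 0 := by
    refine le_antisymm (le_of_forall_gt fun ε hε => ?_) zero_le
    obtain ⟨δ, hδ0, hδ⟩ := exists_between hε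
    obtain ⟨I, hI⟩ := ((hc δ hδ0).eventually_lt_const one_pos).exists
    have hex : ∃ ω, (∀ᵐ z ∂(refLaw D P n), |x I ω z| ≤ B) ∧
        nrm P (fun z => x I ω z - g z) < δ := by
      by_contra! hcon
      have h1 : ∀ᵐ ω ∂Pr, ω ∈ {ω | δ ≤ nrm P fun z => x I ω z - g z} :=
        (hx I).mono fun ω h => hcon ω h
      have h2 : Pr {ω | δ ≤ nrm P fun z => x I ω z - g z} = 1 :=
        (measure_congr (eventuallyEq_univ.2 h1)).trans measure_univ
      exact hI.ne h2
    obtain ⟨ω, h1, h2⟩ := hex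
    refine (lt_of_le_of_lt ?_ h2).trans hδ
    refine eLpNorm_mono_ae ?_
    filter_upwards [ae_covMed hD hG h1] with o ho
    rw [Real.norm_eq_abs, Real.norm_eq_abs, abs_of_nonneg (le_max_right _ _)]
    refine max_le ?_ (abs_nonneg _)
    have h3 := abs_sub_abs_le_abs_sub (g (covMed o)) (x I ω (covMed o))
    rw [abs_sub_comm] at h3
    linarith
  rw [eLpNorm_eq_zero_iff hem.aestronglyMeasurable two_ne_zero] at he
  refine ae_refLaw_of_ae_covMed hD hG hb (measurableSet_le hg.abs measurable_const) ?_
  filter_upwards [he] with o ho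
  have := (max_eq_right_iff.1 (show max (|g (covMed o)| - B) 0 = 0 from ho))
  linarith

lemma UnifBddJ.exists_bound [IsProbabilityMeasure Pr] [IsProbabilityMeasure P]
    (hD : Standing D P) (hG : IsNuisOf D P G) (hb : IsDensLB D P G b)
    {q : Nuis K 𝒳 𝒱 → CompJ K 𝒳 𝒱} (h : UnifBddJ Pr D P Gh q) (s : Fin S)
    (hc : ConsistentJ Pr P G Gh q) (hGh : ∀ I s ω, MeasNuis (Gh I s ω))
    (hq : ∀ {g}, MeasNuis g → ∀ n j,
      Measurable fun z : Cov 𝒳 𝒱 n × Med K n => q g n j z.1 z.2) :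
    ∃ B : ℝ, (∀ n j, ∀ᵐ z ∂(refLaw D P n), |q G n j z.1 z.2| ≤ B) ∧
      ∀ I s, ∀ᵐ ω ∂Pr, ∀ n j, ∀ᵐ z ∂(refLaw D P n), |q (Gh I s ω) n j z.1 z.2| ≤ B := by
  obtain ⟨B, hB⟩ := h
  have h2 : ∀ I s, ∀ᵐ ω ∂Pr, ∀ n j, ∀ᵐ z ∂(refLaw D P n), |q (Gh I s ω) n j z.1 z.2| ≤ B := by
    intro I s
    filter_upwards [hB I s] with ω hω n j
    exact (ae_refLaw_iff hD (measurableSet_le (hq (hGh I s ω) n j).abs measurable_const)).2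
      (hω n j)
  refine ⟨B, fun n j => ?_, h2⟩
  exact ae_abs_le_of_isLittleOP hD hG hb (hq hG.measNuis n j)
    (fun I => (h2 I s).mono fun ω hω => hω n j) (hc s n j)

lemma UnifBdd.exists_bound [IsProbabilityMeasure Pr] [IsProbabilityMeasure P]
    (hD : Standing D P) (hG : IsNuisOf D P G) (hb : IsDensLB D P G b)
    {q : Nuis K 𝒳 𝒱 → Comp K 𝒳 𝒱} (h : UnifBdd Pr D P Gh q) (s : Fin S)
    (hc : Consistent Pr P G Gh q) (hGh : ∀ I s ω, MeasNuis (Gh I s ω))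
    (hq : ∀ {g}, MeasNuis g → ∀ n, Measurable fun z : Cov 𝒳 𝒱 n × Med K n => q g n z.1 z.2) :
    ∃ B : ℝ, (∀ n, ∀ᵐ z ∂(refLaw D P n), |q G n z.1 z.2| ≤ B) ∧
      ∀ I s, ∀ᵐ ω ∂Pr, ∀ n, ∀ᵐ z ∂(refLaw D P n), |q (Gh I s ω) n z.1 z.2| ≤ B := by
  obtain ⟨B, hB⟩ := h
  have h2 : ∀ I s, ∀ᵐ ω ∂Pr, ∀ n, ∀ᵐ z ∂(refLaw D P n), |q (Gh I s ω) n z.1 z.2| ≤ B := by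
    intro I s
    filter_upwards [hB I s] with ω hω n
    exact (ae_refLaw_iff hD (measurableSet_le (hq (hGh I s ω) n).abs measurable_const)).2 (hω n)
  refine ⟨B, fun n => ?_, h2⟩
  exact ae_abs_le_of_isLittleOP hD hG hb (hq hG.measNuis n)
    (fun I => (h2 I s).mono fun ω hω => hω n) (hc s n)

lemma UnifBddBelow.exists_bound [IsProbabilityMeasure P] (hD : Standing D P)
    (hG : IsNuisOf D P G) (hb : IsDensLB D P G b) {a : Bool}
    (h : UnifBddBelow Pr D P Gh (densAt a)) (hGh : ∀ I s ω, MeasNuis (Gh I s ω)) :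
    ∃ c : ℝ, 0 < c ∧ (∀ n, ∀ᵐ z ∂(refLaw D P n), c ≤ densFn G a z) ∧
      ∀ I s, ∀ᵐ ω ∂Pr, ∀ n, ∀ᵐ z ∂(refLaw D P n), c ≤ densFn (Gh I s ω) a z := by
  obtain ⟨c, hc0, hc⟩ := h
  refine ⟨min b c, lt_min hb.1 hc0, fun n => ?_, fun I s => ?_⟩
  · filter_upwards [hb.ae_le hD hG a] with z hz
    exact (min_le_left _ _).trans hz
  · filter_upwards [hc I s] with ω hω n
    filter_upwards [(ae_refLaw_iff hD (measurableSet_le measurable_const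
      ((hGh I s ω).measurable_densFn a))).2 (hω n)] with z hz
    exact (min_le_right _ _).trans hz

lemma exists_splitBdd [IsProbabilityMeasure Pr] [IsProbabilityMeasure P]
    (hD : Standing D P) (hG : IsNuisOf D P G) (hb : IsDensLB D P G b) (s : Fin S)
    (hGh : ∀ I s ω, MeasNuis (Gh I s ω)) {U : Split K}
    (bη : UnifBddJ Pr D P Gh (etaAt true)) (bf : UnifBdd Pr D P Gh (densAt true))
    (lf : UnifBddBelow Pr D P Gh (densAt true)) (bu : UnifBddJ Pr D P Gh (subAtJ U false))
    (bv : UnifBddJ Pr D P Gh (subAtJ (complSplit U) true))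
    (cη : ConsistentJ Pr P G Gh (etaAt true)) (cf : Consistent Pr P G Gh (densAt true))
    (cu : ConsistentJ Pr P G Gh (subAtJ U false))
    (cv : ConsistentJ Pr P G Gh (subAtJ (complSplit U) true)) :
    ∃ B c : ℝ, 0 ≤ B ∧ 0 < c ∧ (∀ n j, SplitBdd D P j (U n j) B c G) ∧
      ∀ I s, ∀ᵐ ω ∂Pr, ∀ n j, SplitBdd D P j (U n j) B c (Gh I s ω) := by
  obtain ⟨B₁, h₁, k₁⟩ := bη.exists_bound hD hG hb s cη hGh fun hg n j => hg.measurable_etaFn j true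
  obtain ⟨B₂, h₂, k₂⟩ := bf.exists_bound hD hG hb s cf hGh fun hg n => hg.measurable_densFn true
  obtain ⟨B₃, h₃, k₃⟩ := bu.exists_bound hD hG hb s cu hGh
    fun hg n j => hg.measurable_subFn (U n j) false
  obtain ⟨B₄, h₄, k₄⟩ := bv.exists_bound hD hG hb s cv hGh
    fun hg n j => hg.measurable_subFn (U n j)ᶜ true
  obtain ⟨c, hc, h₅, k₅⟩ := lf.exists_bound hD hG hb hGh
  set B := |B₁| + |B₂| + |B₃| + |B₄|
  have l₁ : B₁ ≤ B := by
    linarith [le_abs_self B₁, abs_nonneg B₂, abs_nonneg B₃, abs_nonneg B₄]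
  have l₂ : B₂ ≤ B := by
    linarith [le_abs_self B₂, abs_nonneg B₁, abs_nonneg B₃, abs_nonneg B₄]
  have l₃ : B₃ ≤ B := by
    linarith [le_abs_self B₃, abs_nonneg B₁, abs_nonneg B₂, abs_nonneg B₄]
  have l₄ : B₄ ≤ B := by
    linarith [le_abs_self B₄, abs_nonneg B₁, abs_nonneg B₂, abs_nonneg B₃]
  refine ⟨B, c, by positivity, hc, fun n j => ⟨hG.measNuis, ?_, ?_, h₅ n, ?_, ?_⟩, fun I s => ?_⟩
  · exact (h₁ n j).mono fun z hz => hz.trans l₁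
  · exact (h₂ n).mono fun z hz => hz.trans l₂
  · exact (h₃ n j).mono fun z hz => hz.trans l₃
  · exact (h₄ n j).mono fun z hz => hz.trans l₄
  · filter_upwards [k₁ I s, k₂ I s, k₃ I s, k₄ I s, k₅ I s] with ω w₁ w₂ w₃ w₄ w₅ n j
    exact ⟨hGh I s ω, (w₁ n j).mono fun z hz => hz.trans l₁, (w₂ n).mono fun z hz => hz.trans l₂,
      w₅ n, (w₃ n j).mono fun z hz => hz.trans l₃, (w₄ n j).mono fun z hz => hz.trans l₄⟩

lemma exists_armBdd [IsProbabilityMeasure Pr] [IsProbabilityMeasure P]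
    (hD : Standing D P) (hG : IsNuisOf D P G) (hb : IsDensLB D P G b) (s : Fin S)
    (hGh : ∀ I s ω, MeasNuis (Gh I s ω)) {aStar a' : Bool}
    (bη : UnifBddJ Pr D P Gh (etaAt aStar)) (bf : UnifBdd Pr D P Gh (densAt aStar))
    (bf' : UnifBdd Pr D P Gh (densAt a')) (lf : UnifBddBelow Pr D P Gh (densAt aStar))
    (cη : ConsistentJ Pr P G Gh (etaAt aStar)) (cf : Consistent Pr P G Gh (densAt aStar))
    (cf' : Consistent Pr P G Gh (densAt a')) :
    ∃ B c : ℝ, 0 ≤ B ∧ 0 < c ∧ (∀ n (j : Fin n), ArmBdd D P j aStar a' B c G) ∧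
      ∀ I s, ∀ᵐ ω ∂Pr, ∀ n (j : Fin n), ArmBdd D P j aStar a' B c (Gh I s ω) := by
  obtain ⟨B₁, h₁, k₁⟩ := bη.exists_bound hD hG hb s cη hGh fun hg n j => hg.measurable_etaFn j aStar
  obtain ⟨B₂, h₂, k₂⟩ := bf.exists_bound hD hG hb s cf hGh fun hg n => hg.measurable_densFn aStar
  obtain ⟨B₃, h₃, k₃⟩ := bf'.exists_bound hD hG hb s cf' hGh fun hg n => hg.measurable_densFn a'
  obtain ⟨c, hc, h₅, k₅⟩ := lf.exists_bound hD hG hb hGh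
  set B := |B₁| + |B₂| + |B₃|
  have l₁ : B₁ ≤ B := by linarith [le_abs_self B₁, abs_nonneg B₂, abs_nonneg B₃]
  have l₂ : B₂ ≤ B := by linarith [le_abs_self B₂, abs_nonneg B₁, abs_nonneg B₃]
  have l₃ : B₃ ≤ B := by linarith [le_abs_self B₃, abs_nonneg B₁, abs_nonneg B₂]
  refine ⟨B, c, by positivity, hc, fun n j => ⟨hG.measNuis, ?_, ?_, h₅ n, ?_⟩, fun I s => ?_⟩
  · exact (h₁ n j).mono fun z hz => hz.trans l₁
  · exact (h₂ n).mono fun z hz => hz.trans l₂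
  · exact (h₃ n).mono fun z hz => hz.trans l₃
  · filter_upwards [k₁ I s, k₂ I s, k₃ I s, k₅ I s] with ω w₁ w₂ w₃ w₅ n j
    exact ⟨hGh I s ω, (w₁ n j).mono fun z hz => hz.trans l₁, (w₂ n).mono fun z hz => hz.trans l₂,
      w₅ n, (w₃ n).mono fun z hz => hz.trans l₃⟩

end Bounds

/-! ### Empirical processes of functions fitted out of fold -/

section EmpiricalProcess

variable {𝒵 : Type*} [MeasurableSpace 𝒵] {P : Measure 𝒵} [IsProbabilityMeasure P]

/-- Chebyshev's inequality for sums of independent copies of a function. -/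
lemma measure_sum_sub_integral_ge_le {ι : Type*} [Fintype ι] {h : 𝒵 → ℝ} (hh : MemLp h 2 P)
    {c : ℝ} (hc : 0 < c) :
    Measure.pi (fun _ : ι => P) {f | c ≤ |∑ i, (h (f i) - ∫ x, h x ∂P)|} ≤
      Fintype.card ι * eLpNorm h 2 P ^ 2 / ENNReal.ofReal c ^ 2 := by
  have hi : ∀ i : ι, MemLp (fun f : ι → 𝒵 => h (f i)) 2 (Measure.pi fun _ : ι => P) := fun i =>
    hh.comp_measurePreserving (measurePreserving_eval (fun _ : ι => P) i)
  have hY : MemLp (∑ i, fun f : ι → 𝒵 => h (f i)) 2 (Measure.pi fun _ : ι => P) :=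
    memLp_finsetSum' _ fun i _ => hi i
  have hint : ∀ i : ι, ∫ f, h (f i) ∂(Measure.pi fun _ : ι => P) = ∫ x, h x ∂P := fun i =>
    integral_comp_eval (μ := fun _ : ι => P) hh.1
  have hmean : ∫ f, (∑ i, fun f : ι → 𝒵 => h (f i)) f ∂(Measure.pi fun _ : ι => P) =
      ∑ _i : ι, ∫ x, h x ∂P := by
    simp only [Finset.sum_apply]
    rw [integral_finsetSum _ fun i _ => (hi i).integrable (by norm_num)]
    exact Finset.sum_congr rfl fun i _ => hint i
  have hset : {f : ι → 𝒵 | c ≤ |∑ i, (h (f i) - ∫ x, h x ∂P)|} =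
      {f | c ≤ |(∑ i, fun f : ι → 𝒵 => h (f i)) f -
        ∫ f, (∑ i, fun f : ι → 𝒵 => h (f i)) f ∂(Measure.pi fun _ : ι => P)|} := by
    ext f
    rw [hmean]
    simp only [Finset.sum_apply, Finset.sum_sub_distrib]
  rw [hset]
  refine (meas_ge_le_variance_div_sq hY hc).trans ?_
  rw [variance_sum_pi fun _ => hh, ENNReal.ofReal_div_of_pos (by positivity),
    ENNReal.ofReal_pow hc.le]
  refine ENNReal.div_le_div_right ?_ _
  rw [Finset.sum_const, Finset.card_univ, nsmul_eq_mul, ENNReal.ofReal_mul (Nat.cast_nonneg _),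
    ENNReal.ofReal_natCast]
  refine mul_le_mul_right ?_ _
  refine (ENNReal.ofReal_le_ofReal (variance_le_expectation_sq hh.1)).trans (le_of_eq ?_)
  simp only [Pi.pow_apply]
  rw [ofReal_integral_eq_lintegral_ofReal hh.integrable_sq (ae_of_all _ fun x => sq_nonneg _),
    eLpNorm_two_sq]
  refine lintegral_congr fun x => ?_
  rw [← sq_abs, ENNReal.ofReal_pow (abs_nonneg _), ← Real.norm_eq_abs, ofReal_norm]

lemma pi_measure_le_of_slices {ι : Type*} [Fintype ι] (p : ι → Prop) [DecidablePred p]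
    {E : Set (ι → 𝒵)} (hE : MeasurableSet E) {c : ℝ≥0∞}
    (h : ∀ e : {i // ¬ p i} → 𝒵, Measure.pi (fun _ : {i // p i} => P)
      {f | (MeasurableEquiv.piEquivPiSubtypeProd (fun _ => 𝒵) p).symm (f, e) ∈ E} ≤ c) :
    Measure.pi (fun _ : ι => P) E ≤ c := by
  have hmp := (measurePreserving_piEquivPiSubtypeProd (fun _ : ι => P) p).symm
  rw [← hmp.measure_preimage hE.nullMeasurableSet,
    Measure.prod_apply_symm ((MeasurableEquiv.measurable _) hE)]
  calc _ ≤ ∫⁻ _e : {i // ¬ p i} → 𝒵, c ∂(Measure.pi fun _ => P) := lintegral_mono fun e => h e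
    _ = c := by rw [lintegral_const, measure_univ, mul_one]

/-- A function that is fitted on the coordinates outside a fold behaves on the coordinates inside
the fold like a fixed function. -/
lemma measure_fold_sum_ge_le {ι : Type*} [Fintype ι] (p : ι → Prop) [DecidablePred p]
    {H : (ι → 𝒵) → 𝒵 → ℝ} (hH : Measurable fun q : (ι → 𝒵) × 𝒵 => H q.1 q.2)
    (hout : ∀ d d', (∀ i, ¬ p i → d i = d' i) → H d = H d') {c : ℝ} (hc : 0 < c) (δ : ℝ≥0∞) :
    Measure.pi (fun _ : ι => P) {d | c ≤ |∑ i with p i, (H d (d i) - ∫ x, H d x ∂P)| ∧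
      eLpNorm (H d) 2 P < δ} ≤ Fintype.card ι * δ ^ 2 / ENNReal.ofReal c ^ 2 := by
  have hHi : ∀ i, Measurable fun d : ι → 𝒵 => H d (d i) := fun i =>
    hH.comp (measurable_id.prodMk (measurable_pi_apply i))
  have hint : Measurable fun d => ∫ x, H d x ∂P :=
    (hH.stronglyMeasurable.integral_prod_right' (ν := P)).measurable
  have hnorm : Measurable fun d => eLpNorm (H d) 2 P := by
    have h2 : ∀ d, eLpNorm (H d) 2 P = (∫⁻ x, ‖H d x‖ₑ ^ 2 ∂P) ^ (1 / 2 : ℝ) := fun d => by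
      rw [← eLpNorm_two_sq, ← ENNReal.rpow_natCast, ← ENNReal.rpow_mul]
      norm_num
    simp only [h2]
    exact (hH.enorm.pow_const 2).lintegral_prod_right'.pow_const _
  refine pi_measure_le_of_slices p ((measurableSet_le measurable_const
    (Finset.measurable_sum _ fun i _ => (hHi i).sub hint).abs).inter
    (measurableSet_lt hnorm measurable_const)) fun e => ?_
  set σ := (MeasurableEquiv.piEquivPiSubtypeProd (fun _ : ι => 𝒵) p).symm with hσ
  have hσp : ∀ f (i : {i // p i}), σ (f, e) i = f i := fun f i => by
    change (Equiv.piEquivPiSubtypeProd p (fun _ : ι => 𝒵)).symm (f, e) i = f i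
    rw [Equiv.piEquivPiSubtypeProd_symm_apply, dif_pos i.2]
  have hσn : ∀ f i (hi : ¬ p i), σ (f, e) i = e ⟨i, hi⟩ := fun f i hi => by
    change (Equiv.piEquivPiSubtypeProd p (fun _ : ι => 𝒵)).symm (f, e) i = _
    rw [Equiv.piEquivPiSubtypeProd_symm_apply, dif_neg hi]
  by_cases hex : ∃ f₀, eLpNorm (H (σ (f₀, e))) 2 P < δ
  · obtain ⟨f₀, hf₀⟩ := hex
    have hcon : ∀ f, H (σ (f, e)) = H (σ (f₀, e)) := fun f =>
      hout _ _ fun i hi => by rw [hσn f i hi, hσn f₀ i hi]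
    have hmem : MemLp (H (σ (f₀, e))) 2 P :=
      ⟨(hH.comp measurable_prodMk_left).aestronglyMeasurable, hf₀.trans_le le_top⟩
    refine (measure_mono fun f hf => ?_).trans
      ((measure_sum_sub_integral_ge_le (ι := {i // p i}) hmem hc).trans ?_)
    · have h1 : c ≤ |∑ i with p i, (H (σ (f, e)) (σ (f, e) i) - ∫ x, H (σ (f, e)) x ∂P)| := hf.1
      rw [hcon f, Finset.sum_subtype (p := p) _ (fun i => by simp)] at h1
      simp only [hσp] at h1
      exact h1
    · refine ENNReal.div_le_div_right (mul_le_mul' ?_ ?_) _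
      · exact_mod_cast Fintype.card_subtype_le p
      · exact pow_le_pow_left' hf₀.le 2
  · push Not at hex
    refine (measure_mono_null (fun f hf => ?_) measure_empty).trans_le zero_le
    exact absurd (show eLpNorm (H (σ (f, e))) 2 P < δ from hf.2) (not_lt.2 (hex f))

variable {Ω : Type*} [MeasurableSpace Ω] {Pr : Measure Ω} [IsProbabilityMeasure Pr] {S : ℕ}

lemma map_sample_eq_pi {𝒵 Ω : Type*} [MeasurableSpace 𝒵] {P : Measure 𝒵} [MeasurableSpace Ω]
    {Pr : Measure Ω} [IsProbabilityMeasure Pr] {O : ℕ → Ω → 𝒵} (hO_meas : ∀ i, Measurable (O i))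
    (hO_indep : iIndepFun O Pr) (hO_law : ∀ i, Pr.map (O i) = P) (I : ℕ) :
    Pr.map (fun ω (i : Fin I) => O i ω) = Measure.pi fun _ => P := by
  have h := (iIndepFun_iff_map_fun_eq_pi_map (f := fun (i : Fin I) => O i)
    fun i => (hO_meas i).aemeasurable).1 (hO_indep.precomp Fin.val_injective)
  rw [h]
  simp only [hO_law]

/-- The previous bound for random folds that are independent of the sample. -/
lemma measure_random_fold_sum_ge_le {O : ℕ → Ω → 𝒵} (hO_meas : ∀ i, Measurable (O i))
    (hO_indep : iIndepFun O Pr) (hO_law : ∀ i, Pr.map (O i) = P) {I : ℕ}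
    {fold : Ω → Fin I → Fin S} (hfold : Measurable fold)
    (hind : IndepFun fold (fun ω (i : Fin I) => O i ω) Pr) (s : Fin S)
    {H : (Fin I → Fin S) → (Fin I → 𝒵) → 𝒵 → ℝ}
    (hH : ∀ p, Measurable fun q : (Fin I → 𝒵) × 𝒵 => H p q.1 q.2)
    (hout : ∀ p d d', (∀ i, p i ≠ s → d i = d' i) → H p d = H p d') {c : ℝ} (hc : 0 < c)
    (δ : ℝ≥0∞) :
    Pr {ω | c ≤ |∑ i with fold ω i = s, (H (fold ω) (fun i => O i ω) (O i ω)
        - ∫ x, H (fold ω) (fun i => O i ω) x ∂P)| ∧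
      eLpNorm (H (fold ω) fun i => O i ω) 2 P < δ} ≤ I * δ ^ 2 / ENNReal.ofReal c ^ 2 := by
  set E : (Fin I → Fin S) → Set (Fin I → 𝒵) := fun p =>
    {d | c ≤ |∑ i with p i = s, (H p d (d i) - ∫ x, H p d x ∂P)| ∧ eLpNorm (H p d) 2 P < δ}
  have hE : ∀ p, Pr {ω | fold ω = p ∧ (fun i : Fin I => O i ω) ∈ E p} ≤
      Pr (fold ⁻¹' {p}) * (I * δ ^ 2 / ENNReal.ofReal c ^ 2) := by
    intro p
    set T := toMeasurable (Measure.pi fun _ : Fin I => P) (E p)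
    have hT : MeasurableSet T := measurableSet_toMeasurable _ _
    have h1 := hind.measure_inter_preimage_eq_mul {p} T (measurableSet_singleton p) hT
    have h2 : Pr ((fun ω (i : Fin I) => O i ω) ⁻¹' T) ≤ I * δ ^ 2 / ENNReal.ofReal c ^ 2 := by
      have hm : Measurable fun ω (i : Fin I) => O i ω := measurable_pi_lambda _ fun i => hO_meas i
      rw [← Measure.map_apply hm hT,
        map_sample_eq_pi hO_meas hO_indep hO_law, measure_toMeasurable]
      have h3 := measure_fold_sum_ge_le (P := P) (fun i => p i = s) (hH p) (hout p) hc δ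
      rwa [Fintype.card_fin] at h3
    refine (measure_mono fun ω hω => ?_).trans (h1.trans_le (mul_le_mul_right h2 _))
    exact ⟨hω.1, subset_toMeasurable _ _ hω.2⟩
  calc _ ≤ Pr (⋃ p, {ω | fold ω = p ∧ (fun i : Fin I => O i ω) ∈ E p}) :=
        measure_mono fun ω hω => Set.mem_iUnion.2 ⟨fold ω, rfl, hω⟩
    _ ≤ ∑ p, Pr {ω | fold ω = p ∧ (fun i : Fin I => O i ω) ∈ E p} :=
        measure_iUnion_fintype_le _ _
    _ ≤ ∑ p, Pr (fold ⁻¹' {p}) * (I * δ ^ 2 / ENNReal.ofReal c ^ 2) :=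
        Finset.sum_le_sum fun p _ => hE p
    _ = I * δ ^ 2 / ENNReal.ofReal c ^ 2 := by
        rw [← Finset.sum_mul, sum_measure_preimage_singleton _ fun p _ =>
          hfold (measurableSet_singleton p), Finset.coe_univ, Set.preimage_univ, measure_univ,
          one_mul]

/-- Functions that are fitted out of fold and tend to zero in `L²` in probability have a negligible
empirical process in the fold. -/
lemma isLittleOP_fold_sum {O : ℕ → Ω → 𝒵} (hO_meas : ∀ i, Measurable (O i))
    (hO_indep : iIndepFun O Pr) (hO_law : ∀ i, Pr.map (O i) = P)
    {fold : ∀ I : ℕ, Ω → Fin I → Fin S} (hfold : ∀ I, Measurable (fold I))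
    (hind : ∀ I, IndepFun (fold I) (fun ω (i : Fin I) => O i ω) Pr) (s : Fin S)
    {H : ∀ I, (Fin I → Fin S) → (Fin I → 𝒵) → 𝒵 → ℝ}
    (hH : ∀ I p, Measurable fun q : (Fin I → 𝒵) × 𝒵 => H I p q.1 q.2)
    (hout : ∀ I p d d', (∀ i, p i ≠ s → d i = d' i) → H I p d = H I p d')
    (hlim : IsLittleOP Pr fun I ω => eLpNorm (H I (fold I ω) fun i => O i ω) 2 P) :
    IsLittleOP Pr fun I ω => ENNReal.ofReal ((√I)⁻¹ *
      |∑ i with fold I ω i = s, (H I (fold I ω) (fun i => O i ω) (O i ω)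
        - ∫ x, H I (fold I ω) (fun i => O i ω) x ∂P)|) := by
  intro ε₀ hε₀
  obtain ⟨ε', hε'0, hε'⟩ := exists_between hε₀
  lift ε' to ℝ≥0 using (hε'.trans_le le_top).ne
  have hε'p : (0 : ℝ) < ε' := by exact_mod_cast hε'0
  rw [ENNReal.tendsto_nhds_zero]
  intro η hη
  -- the choice of `δ` makes Chebyshev's bound `δ ^ 2 / ε' ^ 2` smaller than `η / 2`
  obtain ⟨δ, hδ0, hδ⟩ : ∃ δ : ℝ≥0∞, 0 < δ ∧ δ ^ 2 / (ε' : ℝ≥0∞) ^ 2 ≤ η / 2 := by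
    have hc : Tendsto (fun δ : ℝ≥0∞ => δ ^ 2 / (ε' : ℝ≥0∞) ^ 2) (𝓝[>] 0) (𝓝 0) := by
      have h0 : Tendsto (fun δ : ℝ≥0∞ => δ ^ 2) (𝓝[>] 0) (𝓝 0) := by
        have := ((ENNReal.continuous_pow 2).tendsto (0 : ℝ≥0∞)).mono_left
          (nhdsWithin_le_nhds (s := Set.Ioi 0))
        simpa using this
      have h1 := ENNReal.Tendsto.div_const h0 (b := (ε' : ℝ≥0∞) ^ 2)
        (Or.inr (pow_ne_zero 2 hε'0.ne'))
      simpa using h1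
    obtain ⟨δ, h1, h2⟩ := ((hc.eventually_le_const (ENNReal.half_pos hη.ne')).and
      self_mem_nhdsWithin).exists
    exact ⟨δ, h2, h1⟩
  have hev := (ENNReal.tendsto_nhds_zero.1 (hlim δ hδ0)) (η / 2) (ENNReal.half_pos hη.ne')
  filter_upwards [hev, eventually_gt_atTop 0] with I hI hI0
  have hIr : (0 : ℝ) < I := by exact_mod_cast hI0
  have hs : 0 < √(I : ℝ) := Real.sqrt_pos.2 hIr
  have hb := measure_random_fold_sum_ge_le hO_meas hO_indep hO_law (hfold I) (hind I) s (hH I)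
    (hout I) (mul_pos hs hε'p) δ
  have hbound : (I : ℝ≥0∞) * δ ^ 2 / ENNReal.ofReal (√I * ε') ^ 2 = δ ^ 2 / (ε' : ℝ≥0∞) ^ 2 := by
    rw [ENNReal.ofReal_mul hs.le, mul_pow, ← ENNReal.ofReal_pow hs.le, Real.sq_sqrt hIr.le,
      ENNReal.ofReal_natCast, ENNReal.ofReal_coe_nnreal]
    exact ENNReal.mul_div_mul_left _ _ (by exact_mod_cast hI0.ne') (ENNReal.natCast_ne_top I)
  rw [hbound] at hb
  refine (measure_mono fun ω hω => ?_).trans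
    ((measure_union_le _ _).trans ((add_le_add (hb.trans hδ) hI).trans
      (ENNReal.add_halves η).le))
  by_cases hd : eLpNorm (H I (fold I ω) fun i => O i ω) 2 P < δ
  · left
    refine ⟨?_, hd⟩
    have h1 : (ε' : ℝ≥0∞) ≤ ENNReal.ofReal ((√I)⁻¹ *
      |∑ i with fold I ω i = s, (H I (fold I ω) (fun i => O i ω) (O i ω)
        - ∫ x, H I (fold I ω) (fun i => O i ω) x ∂P)|) := hε'.le.trans hω
    rw [← ENNReal.ofReal_coe_nnreal, ENNReal.ofReal_le_ofReal_iff (by positivity),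
      le_inv_mul_iff₀ hs] at h1
    exact h1
  · right
    exact not_lt.1 hd

end EmpiricalProcess

/-! ### Stochastic orders -/

section Orders

variable {Ω : Type*} [MeasurableSpace Ω] {Pr : Measure Ω}

lemma IsLittleOP.mono {X Y : ℕ → Ω → ℝ≥0∞} (hX : IsLittleOP Pr X)
    (h : ∀ᶠ I in atTop, ∀ᵐ ω ∂Pr, Y I ω ≤ X I ω) : IsLittleOP Pr Y := by
  intro ε hε
  refine tendsto_of_tendsto_of_tendsto_of_le_of_le' tendsto_const_nhds (hX ε hε)
    (Eventually.of_forall fun _ => zero_le) ?_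
  filter_upwards [h] with I hI
  refine measure_mono_ae ?_
  filter_upwards [hI] with ω hω hε
  exact le_trans (show ε ≤ Y I ω from hε) hω

lemma isLittleOP_zero : IsLittleOP Pr fun _ _ => 0 := by
  intro ε hε
  simp [hε.ne']

lemma IsLittleOP.add {X Y : ℕ → Ω → ℝ≥0∞} (hX : IsLittleOP Pr X) (hY : IsLittleOP Pr Y) :
    IsLittleOP Pr fun I ω => X I ω + Y I ω := by
  intro ε hε
  have h2 : (0 : ℝ≥0∞) < ε / 2 := ENNReal.half_pos hε.ne'
  have hsum := (hX (ε / 2) h2).add (hY (ε / 2) h2)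
  rw [add_zero] at hsum
  refine tendsto_of_tendsto_of_tendsto_of_le_of_le tendsto_const_nhds hsum
    (fun _ => zero_le) fun I => ?_
  refine (measure_mono fun ω hω => ?_).trans (measure_union_le _ _)
  by_contra hcon
  have h1 : ¬ ε / 2 ≤ X I ω ∧ ¬ ε / 2 ≤ Y I ω := not_or.1 hcon
  have hlt := ENNReal.add_lt_add (not_le.1 h1.1) (not_le.1 h1.2)
  rw [ENNReal.add_halves] at hlt
  exact absurd hlt (not_lt.2 hω)

lemma IsLittleOP.sum {ι : Type*} {X : ι → ℕ → Ω → ℝ≥0∞} {t : Finset ι}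
    (hX : ∀ i ∈ t, IsLittleOP Pr (X i)) : IsLittleOP Pr fun I ω => ∑ i ∈ t, X i I ω := by
  classical
  induction t using Finset.induction_on with
  | empty => simpa using isLittleOP_zero
  | insert i t hi ih =>
    simp only [Finset.sum_insert hi]
    exact (hX i (Finset.mem_insert_self i t)).add
      (ih fun j hj => hX j (Finset.mem_insert_of_mem hj))

lemma IsLittleOP.const_mul {X : ℕ → Ω → ℝ≥0∞} (hX : IsLittleOP Pr X) (C : ℝ≥0) :
    IsLittleOP Pr fun I ω => C * X I ω := by
  intro ε hε
  have hC : (C : ℝ≥0∞) + 1 ≠ ∞ := ENNReal.add_ne_top.2 ⟨ENNReal.coe_ne_top, ENNReal.one_ne_top⟩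
  refine tendsto_of_tendsto_of_tendsto_of_le_of_le tendsto_const_nhds
    (hX (ε / (C + 1)) (ENNReal.div_pos hε.ne' hC)) (fun _ => zero_le)
    fun I => measure_mono fun ω hω => ?_
  have h1 : ε ≤ C * X I ω := hω
  exact ENNReal.div_le_of_le_mul (h1.trans ((mul_le_mul_left le_self_add _).trans
    (mul_comm _ _).le))

end Orders

/-! ### The expansion of a cross-fitted one-step estimator -/

section Expansion

variable {K S : ℕ} {𝒳 𝒱 Ω : Type*} [MeasurableSpace 𝒳] [MeasurableSpace 𝒱] [MeasurableSpace Ω]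
variable {Pr : Measure Ω} {P : Measure (Obs K 𝒳 𝒱)}

lemma foldAvg_foldMean {K S I : ℕ} {𝒳 𝒱 : Type*} (p : Fin I → Fin S)
    (g : Fin S → Obs K 𝒳 𝒱 → ℝ) (d : Fin I → Obs K 𝒳 𝒱) :
    (foldAvg p fun s => foldMean p s (g s) d) = (I : ℝ)⁻¹ * ∑ s, ∑ i with p i = s, g s (d i) := by
  unfold foldAvg
  congr 1
  refine Finset.sum_congr rfl fun s _ => ?_
  unfold foldMean
  rcases eq_or_ne (foldSize p s) 0 with h | h
  · have he : (Finset.univ.filter fun i => p i = s) = ∅ := Finset.card_eq_zero.1 h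
    rw [he, h]
    simp
  · rw [mul_inv_cancel_left₀ (by exact_mod_cast h)]

lemma ofReal_abs_foldAvg_le {S I : ℕ} (p : Fin I → Fin S) (x : Fin S → ℝ) :
    ENNReal.ofReal |foldAvg p x| ≤ foldAvgE p fun s => ENNReal.ofReal |x s| := by
  unfold foldAvg foldAvgE
  rcases Nat.eq_zero_or_pos I with rfl | hI
  · simp
  have hIr : (0 : ℝ) < I := by exact_mod_cast hI
  rw [abs_mul, abs_of_pos (inv_pos.2 hIr), ENNReal.ofReal_mul (inv_pos.2 hIr).le,
    ENNReal.ofReal_inv_of_pos hIr, ENNReal.ofReal_natCast]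
  refine mul_le_mul_right ?_ _
  refine (ENNReal.ofReal_le_ofReal (Finset.abs_sum_le_sum_abs
    (fun s => (foldSize p s : ℝ) * x s) Finset.univ)).trans ?_
  rw [ENNReal.ofReal_sum_of_nonneg fun (s : Fin S) _ => abs_nonneg ((foldSize p s : ℝ) * x s)]
  refine Finset.sum_le_sum fun s _ => ?_
  rw [abs_mul, Nat.abs_cast, ENNReal.ofReal_mul (Nat.cast_nonneg _), ENNReal.ofReal_natCast]

lemma foldAvgE_le_mul {S I : ℕ} (p : Fin I → Fin S) {x y : Fin S → ℝ≥0∞} {C : ℝ≥0}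
    (h : ∀ s, x s ≤ C * y s) : foldAvgE p x ≤ C * foldAvgE p y := by
  unfold foldAvgE
  have h1 : ∑ s, (foldSize p s : ℝ≥0∞) * x s ≤ C * ∑ s, (foldSize p s : ℝ≥0∞) * y s := by
    rw [Finset.mul_sum]
    exact Finset.sum_le_sum fun s _ =>
      (mul_le_mul_right (h s) _).trans (mul_left_comm _ _ _).le
  exact (mul_le_mul_right h1 _).trans (mul_left_comm _ _ _).le

/-- The algebra behind the expansion: the estimation error is the sum of the empirical process of
the influence function, of the averaged biases, and of the empirical processes of the errors of the
estimated influence functions. -/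
lemma expansion_identity {S I : ℕ} {𝒵 : Type*} (hI : I ≠ 0) (p : Fin I → Fin S) (d : Fin I → 𝒵)
    (f : Fin S → 𝒵 → ℝ) (g : 𝒵 → ℝ) (m : Fin S → ℝ) (θ : ℝ) :
    ((I : ℝ)⁻¹ * ∑ s, ∑ i with p i = s, f s (d i)) - θ
        - (I : ℝ)⁻¹ * ∑ i, (g (d i) - θ) - foldAvg p (fun s => m s - θ) =
      (I : ℝ)⁻¹ * ∑ s, ∑ i with p i = s, (f s (d i) - g (d i) - (m s - θ)) := by
  have hI0 : (I : ℝ) ≠ 0 := by exact_mod_cast hI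
  have h1 : ∑ i, (g (d i) - θ) = (∑ s, ∑ i with p i = s, g (d i)) - I * θ := by
    rw [Finset.sum_fiberwise, Finset.sum_sub_distrib, Finset.sum_const, Finset.card_univ,
      Fintype.card_fin, nsmul_eq_mul]
  have h2 : ∀ s, ∑ i with p i = s, (f s (d i) - g (d i) - (m s - θ)) =
      (∑ i with p i = s, f s (d i)) - (∑ i with p i = s, g (d i)) - foldSize p s * (m s - θ) := by
    intro s
    rw [Finset.sum_sub_distrib, Finset.sum_sub_distrib, Finset.sum_const, nsmul_eq_mul]
    rfl
  simp only [h2, Finset.sum_sub_distrib, foldAvg, h1]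
  field_simp
  ring

/-- The expansion of a cross-fitted one-step estimator whose estimated influence function is
consistent in `L²` and has a bias that is bounded by `R`. -/
lemma expansion_of_bias_of_consistency [IsProbabilityMeasure Pr] [IsProbabilityMeasure P]
    {O : ℕ → Ω → Obs K 𝒳 𝒱} (hO_meas : ∀ i, Measurable (O i))
    (hO_indep : iIndepFun O Pr) (hO_law : ∀ i, Pr.map (O i) = P)
    {fold : ∀ I : ℕ, Ω → Fin I → Fin S} (hfold : ∀ I, Measurable (fold I))
    (hind : ∀ I, IndepFun (fold I) (fun ω (i : Fin I) => O i ω) Pr)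
    (L : Learner K 𝒳 𝒱 S) {Φ : Nuis K 𝒳 𝒱 → Obs K 𝒳 𝒱 → ℝ} {G : Nuis K 𝒳 𝒱} {θ : ℝ}
    {R : Nuis K 𝒳 𝒱 → ℝ≥0∞} {C : ℝ≥0}
    (hΦ : ∀ I s p, Measurable fun q : (Fin I → Obs K 𝒳 𝒱) × Obs K 𝒳 𝒱 => Φ (L.fit I s p q.1) q.2)
    (hΦG : Measurable (Φ G)) (hint : Integrable (Φ G) P) (hθ : ∫ o, Φ G o ∂P = θ)
    (hΦint : ∀ I s, ∀ᵐ ω ∂Pr, Integrable (Φ (fitted L fold O I s ω)) P)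
    (hbias : ∀ I s, ∀ᵐ ω ∂Pr, ‖∫ o, Φ (fitted L fold O I s ω) o ∂P - θ‖ₑ ≤
      C * R (fitted L fold O I s ω))
    (hcons : ∀ s, IsLittleOP Pr fun I ω =>
      eLpNorm (fun o => Φ (fitted L fold O I s ω) o - Φ G o) 2 P) :
    Expansion Pr P O (thetaHat fold O (fitted L fold O) Φ) θ (fun o => Φ G o - θ)
      (fun I ω => foldAvgE (fold I ω) fun s => R (fitted L fold O I s ω)) := by
  have hmean : ∫ o, (Φ G o - θ) ∂P = 0 := by
    rw [integral_sub hint (integrable_const _), hθ]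
    simp
  set Rem : ℕ → Ω → ℝ := fun I ω =>
    foldAvg (fold I ω) fun s => ∫ o, Φ (fitted L fold O I s ω) o ∂P - θ with hRem
  set est := thetaHat fold O (fitted L fold O) Φ with hest
  refine ⟨hint.sub (integrable_const _), Rem, fun I ω => est I ω - θ
    - empMean O (fun o => Φ G o - θ) I ω - Rem I ω, fun I ω => ?_, ?_, ?_⟩
  · rw [hmean]
    ring
  -- `Rem` averages the biases over the folds, so it is bounded by the averaged rates, up to `C`
  · intro ε _
    refine ⟨C, Eventually.of_forall fun I => ?_⟩
    refine (le_of_eq ?_).trans (zero_le : (0 : ℝ≥0∞) ≤ ε)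
    have hall : ∀ᵐ ω ∂Pr, ∀ s, ‖∫ o, Φ (fitted L fold O I s ω) o ∂P - θ‖ₑ ≤
      C * R (fitted L fold O I s ω) := ae_all_iff.2 fun s => hbias I s
    have hle : ∀ᵐ ω ∂Pr, ¬ (C : ℝ≥0∞) * foldAvgE (fold I ω) (fun s => R (fitted L fold O I s ω)) <
        ENNReal.ofReal |Rem I ω| := by
      filter_upwards [hall] with ω hω
      rw [not_lt]
      refine (ofReal_abs_foldAvg_le _ _).trans (foldAvgE_le_mul _ fun s => ?_)
      have := hω s
      rwa [← ofReal_norm, Real.norm_eq_abs] at this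
    exact measure_eq_zero_iff_ae_notMem.2 hle
  -- what is left are the empirical processes of the errors of the influence functions
  · set H : ∀ I, Fin S → (Fin I → Fin S) → (Fin I → Obs K 𝒳 𝒱) → Obs K 𝒳 𝒱 → ℝ :=
      fun I s p d o => Φ (L.fit I s p d) o - Φ G o with hH
    have hproc := fun s => isLittleOP_fold_sum (P := P) hO_meas hO_indep hO_law hfold hind s
      (H := fun I => H I s) (fun I p => (hΦ I s p).sub (hΦG.comp measurable_snd))
      (fun I p d d' hd => by
        simp only [hH]
        rw [L.out_of_fold I s p d d' hd]) (hcons s)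
    refine (IsLittleOP.sum (t := Finset.univ) fun s _ => hproc s).mono ?_
    filter_upwards [eventually_gt_atTop 0] with I hI
    have hall : ∀ᵐ ω ∂Pr, ∀ s, Integrable (Φ (fitted L fold O I s ω)) P :=
      ae_all_iff.2 fun s => hΦint I s
    filter_upwards [hall] with ω hω
    have hIr : (0 : ℝ) < I := by exact_mod_cast hI
    have hsq : √(I : ℝ) * (I : ℝ)⁻¹ = (√I)⁻¹ := by
      have h0 : 0 < √(I : ℝ) := Real.sqrt_pos.2 hIr
      refine eq_inv_of_mul_eq_one_left ?_
      rw [mul_right_comm, Real.mul_self_sqrt hIr.le,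
        mul_inv_cancel₀ hIr.ne']
    have hm : ∀ s, ∫ o, Φ (fitted L fold O I s ω) o ∂P - θ =
        ∫ o, H I s (fold I ω) (fun i => O i ω) o ∂P := fun s => by
      rw [← hθ]
      exact (integral_sub (hω s) hint).symm
    have hid : est I ω - θ - empMean O (fun o => Φ G o - θ) I ω - Rem I ω =
        (I : ℝ)⁻¹ * ∑ s, ∑ i with fold I ω i = s, (H I s (fold I ω) (fun i => O i ω) (O i ω)
          - ∫ o, H I s (fold I ω) (fun i => O i ω) o ∂P) := by
      have h1 : est I ω = (I : ℝ)⁻¹ * ∑ s, ∑ i with fold I ω i = s,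
          Φ (fitted L fold O I s ω) (O i ω) :=
        foldAvg_foldMean (fold I ω) (fun s => Φ (fitted L fold O I s ω)) fun i => O i ω
      rw [h1]
      simp only [← hm]
      exact expansion_identity hI.ne' (fold I ω) (fun i => O i ω)
        (fun s => Φ (fitted L fold O I s ω)) (Φ G)
        (fun s => ∫ o, Φ (fitted L fold O I s ω) o ∂P) θ
    rw [hid, ← mul_assoc, hsq, abs_mul, abs_of_pos (inv_pos.2 (Real.sqrt_pos.2 hIr)),
      ← ENNReal.ofReal_sum_of_nonneg fun s _ => by positivity, ← Finset.mul_sum]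
    refine ENNReal.ofReal_le_ofReal ?_
    gcongr
    exact Finset.abs_sum_le_sum_abs _ _

end Expansion

/-! ### The expansions for the mediation functionals -/

section Mediation

variable {K S : ℕ} {𝒳 𝒱 Ω : Type*} [MeasurableSpace 𝒳] [MeasurableSpace 𝒱] [MeasurableSpace Ω]
variable {Pr : Measure Ω} {D : Design K 𝒱} {P : Measure (Obs K 𝒳 𝒱)} {G : Nuis K 𝒳 𝒱}

lemma dist2_self (q : Comp K 𝒳 𝒱) : dist2 P q q = 0 := by
  simp only [dist2, sub_self]
  exact eLpNorm_zero'

lemma d2_self (q : CompJ K 𝒳 𝒱) : d2 P q q = 0 := by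
  simp only [d2, sub_self, abs_zero, Real.iSup_const_zero]
  exact eLpNorm_zero'

/-- For an error that is the same for all individuals, the norm of the maximum is at most the norm
of the error; it may be smaller, as the maximum over an empty cluster is zero. -/
lemma d2_const_le_dist2 (q r : Comp K 𝒳 𝒱) :
    d2 P (fun n (_ : Fin n) => q n) (fun n (_ : Fin n) => r n) ≤ dist2 P q r := by
  refine eLpNorm_mono fun o => ?_
  rw [Real.norm_of_nonneg (Real.iSup_nonneg fun _ => abs_nonneg _), Real.norm_eq_abs]
  exact Real.iSup_le (fun _ => le_rfl) (abs_nonneg _)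

lemma Learner.jointMeas (L : Learner K 𝒳 𝒱 S) (I : ℕ) (s : Fin S) (p : Fin I → Fin S) :
    JointMeas (L.fit I s p) :=
  ⟨L.measurable_eta I s p, L.measurable_dens I s p, L.measurable_sub I s p⟩

lemma Expansion.mono {O : ℕ → Ω → Obs K 𝒳 𝒱} {est : ℕ → Ω → ℝ} {θ : ℝ}
    {infl : Obs K 𝒳 𝒱 → ℝ} {X Y : ℕ → Ω → ℝ≥0∞} (h : Expansion Pr P O est θ infl X)
    (hXY : ∀ I ω, X I ω ≤ Y I ω) : Expansion Pr P O est θ infl Y := by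
  obtain ⟨hi, Rem, Q, h1, h2, h3⟩ := h
  refine ⟨hi, Rem, Q, h1, fun ε hε => ?_, h3⟩
  obtain ⟨C, hC⟩ := h2 ε hε
  refine ⟨C, hC.mono fun I hI => (measure_mono fun ω hω => ?_).trans hI⟩
  exact (mul_le_mul_right (hXY I ω) _).trans_lt hω

lemma foldAvgE_mono {S I : ℕ} (p : Fin I → Fin S) {x y : Fin S → ℝ≥0∞} (h : ∀ s, x s ≤ y s) :
    foldAvgE p x ≤ foldAvgE p y :=
  mul_le_mul_right (Finset.sum_le_sum fun s _ => mul_le_mul_right (h s) _) _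

/-- The expansion of the cross-fitted one-step estimator of a split functional. -/
lemma expansion_split [IsProbabilityMeasure Pr] [IsProbabilityMeasure P]
    (hD : Standing D P) (hG : IsNuisOf D P G)
    {O : ℕ → Ω → Obs K 𝒳 𝒱} (hO_meas : ∀ i, Measurable (O i))
    (hO_indep : iIndepFun O Pr) (hO_law : ∀ i, Pr.map (O i) = P)
    {fold : ∀ I : ℕ, Ω → Fin I → Fin S} (hfold : ∀ I, Measurable (fold I))
    (hind : ∀ I, IndepFun (fold I) (fun ω (i : Fin I) => O i ω) Pr)
    (L : Learner K 𝒳 𝒱 S) (s₀ : Fin S)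
    (hw : WeightBdd D P) (hf : DensBddBelow D P G) (hvar : CondVarBdd P G) {U : Split K}
    (bη : UnifBddJ Pr D P (fitted L fold O) (etaAt true))
    (bf : UnifBdd Pr D P (fitted L fold O) (densAt true))
    (lf : UnifBddBelow Pr D P (fitted L fold O) (densAt true))
    (bu : UnifBddJ Pr D P (fitted L fold O) (subAtJ U false))
    (bv : UnifBddJ Pr D P (fitted L fold O) (subAtJ (complSplit U) true))
    (cη : ConsistentJ Pr P G (fitted L fold O) (etaAt true))
    (cf : Consistent Pr P G (fitted L fold O) (densAt true))
    (cu : ConsistentJ Pr P G (fitted L fold O) (subAtJ U false))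
    (cv : ConsistentJ Pr P G (fitted L fold O) (subAtJ (complSplit U) true)) :
    Integrable (integrandSplit D G U) P ∧
      (∀ᵐ o ∂P, ∀ j, Integrable (lam1Kernel G j (U o.1 j) true false true (cov o.2))
        (ref D o.1)) ∧
      Expansion Pr P O (thetaHat fold O (fitted L fold O) fun g => phiSplit D g U)
        (thetaSplit D P G U) (fun o => phiSplit D G U o - thetaSplit D P G U)
        (fun I ω => foldAvgE (fold I ω) fun s => splitRate P U (fitted L fold O I s ω) G) := by
  obtain ⟨b₀, hb₀⟩ : ∃ b₀, IsDensLB D P G b₀ := hf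
  have hGh : ∀ I s ω, MeasNuis (fitted L fold O I s ω) := fun I s ω =>
    (L.jointMeas I s (fold I ω)).measNuis _
  obtain ⟨W, hW0, hW⟩ := exists_weight_bound hD hw
  obtain ⟨B, b, hB, hb, hGB, hGhB⟩ :=
    exists_splitBdd hD hG hb₀ s₀ hGh bη bf lf bu bv cη cf cu cv
  obtain ⟨Nmax, hN⟩ := hD.bounded_size
  obtain ⟨C, hC⟩ := eLpNorm_phiSplit_sub_le hD hG hvar hb₀ hb hB hW hGB hN
  refine ⟨integrable_integrandSplit hD hG hb₀ hW hGB, ae_integrable_lam1Kernel hD hG hb₀ hGB, ?_⟩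
  have hmean : ∫ o, phiSplit D G U o ∂P = thetaSplit D P G U := by
    have h := bias_phiSplit_le hD hG hb₀ hb hB hW0 hW hG.measNuis hGB hGB
    rw [splitRate, d2_self, d2_self, zero_mul, zero_mul, add_zero, mul_zero, nonpos_iff_eq_zero,
      enorm_eq_zero] at h
    exact sub_eq_zero.1 h
  refine expansion_of_bias_of_consistency hO_meas hO_indep hO_law hfold hind L
    (Φ := fun g => phiSplit D g U) (R := fun g => splitRate P U g G)
    (C := (W * (B * B / b + B)).toNNReal * refConst D b₀)
    (fun I s p => measurable_phiSplit hD (L.jointMeas I s p) U)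
    ((measurable_phiSplit hD hG.measNuis.jointMeas U).comp
      (measurable_const (a := ()) |>.prodMk measurable_id))
    ((memLp_phiSplit hD hG hb₀ hb hB hW hG.measNuis hGB hGB).integrable (by norm_num)) hmean
    (fun I s => ?_) (fun I s => ?_) fun s => ?_
  · filter_upwards [hGhB I s] with ω hω
    exact (memLp_phiSplit hD hG hb₀ hb hB hW (hGh I s ω) hGB hω).integrable (by norm_num)
  · filter_upwards [hGhB I s] with ω hω
    rw [ENNReal.coe_mul]
    exact bias_phiSplit_le hD hG hb₀ hb hB hW0 hW (hGh I s ω) hGB hω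
  · have herr : ∀ n (j : Fin n) i, IsLittleOP Pr fun I ω =>
        nrm P (splitErr (fitted L fold O I s ω) G j (U n j) i) := by
      intro n j i
      fin_cases i
      · exact cη s n j
      · exact cf s n
      · exact cv s n j
      · exact cu s n j
    refine ((IsLittleOP.sum (t := Finset.range (Nmax + 1)) fun n _ =>
      IsLittleOP.sum (t := Finset.univ) fun j _ => IsLittleOP.sum (t := Finset.univ) fun i _ =>
        herr n j i).const_mul C).mono (Eventually.of_forall fun I => ?_)
    filter_upwards [hGhB I s] with ω hω
    exact hC _ hω

/-- The expansion of the cross-fitted one-step estimator of `θ₁`. -/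
lemma expansion_arm [IsProbabilityMeasure Pr] [IsProbabilityMeasure P]
    (hD : Standing D P) (hG : IsNuisOf D P G)
    {O : ℕ → Ω → Obs K 𝒳 𝒱} (hO_meas : ∀ i, Measurable (O i))
    (hO_indep : iIndepFun O Pr) (hO_law : ∀ i, Pr.map (O i) = P)
    {fold : ∀ I : ℕ, Ω → Fin I → Fin S} (hfold : ∀ I, Measurable (fold I))
    (hind : ∀ I, IndepFun (fold I) (fun ω (i : Fin I) => O i ω) Pr)
    (L : Learner K 𝒳 𝒱 S) (s₀ : Fin S)
    (hw : WeightBdd D P) (hf : DensBddBelow D P G) (hvar : CondVarBdd P G) {aStar a' : Bool}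
    (bη : UnifBddJ Pr D P (fitted L fold O) (etaAt aStar))
    (bf : UnifBdd Pr D P (fitted L fold O) (densAt aStar))
    (bf' : UnifBdd Pr D P (fitted L fold O) (densAt a'))
    (lf : UnifBddBelow Pr D P (fitted L fold O) (densAt aStar))
    (cη : ConsistentJ Pr P G (fitted L fold O) (etaAt aStar))
    (cf : Consistent Pr P G (fitted L fold O) (densAt aStar))
    (cf' : Consistent Pr P G (fitted L fold O) (densAt a')) :
    Integrable (integrandI D G aStar a') P ∧
      (∀ᵐ o ∂P, ∀ j, Integrable (etaStarKernel G j aStar a' (cov o.2)) (ref D o.1)) ∧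
      Expansion Pr P O (thetaHat fold O (fitted L fold O) fun g => phiI D g aStar a')
        (thetaI D P G aStar a') (fun o => phiI D G aStar a' o - thetaI D P G aStar a')
        (fun I ω => foldAvgE (fold I ω) fun s =>
          armRate P aStar a' (fitted L fold O I s ω) G) := by
  obtain ⟨b₀, hb₀⟩ : ∃ b₀, IsDensLB D P G b₀ := hf
  have hGh : ∀ I s ω, MeasNuis (fitted L fold O I s ω) := fun I s ω =>
    (L.jointMeas I s (fold I ω)).measNuis _
  obtain ⟨W, hW0, hW⟩ := exists_weight_bound hD hw
  obtain ⟨B, b, hB, hb, hGB, hGhB⟩ :=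
    exists_armBdd hD hG hb₀ s₀ hGh bη bf bf' lf cη cf cf'
  obtain ⟨Nmax, hN⟩ := hD.bounded_size
  obtain ⟨C, hC⟩ := eLpNorm_phiI_sub_le hD hG hvar hb₀ hb hB hW hGB hN
  refine ⟨integrable_integrandI hD hG hb₀ hW hGB, ae_integrable_etaStarKernel hD hG hb₀ hGB, ?_⟩
  have hmean : ∫ o, phiI D G aStar a' o ∂P = thetaI D P G aStar a' := by
    have h := bias_phiI_le hD hG hb₀ hb hB hW0 hW hG.measNuis hGB hGB
    rw [armRate, dist2_self, zero_mul, mul_zero, nonpos_iff_eq_zero, enorm_eq_zero] at h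
    exact sub_eq_zero.1 h
  refine expansion_of_bias_of_consistency hO_meas hO_indep hO_law hfold hind L
    (Φ := fun g => phiI D g aStar a') (R := fun g => armRate P aStar a' g G)
    (C := (W * (B / b + 1)).toNNReal * refConst D b₀)
    (fun I s p => measurable_phiI hD (L.jointMeas I s p) aStar a')
    ((measurable_phiI hD hG.measNuis.jointMeas aStar a').comp
      (measurable_const (a := ()) |>.prodMk measurable_id))
    ((memLp_phiI hD hG hb₀ hb hW hG.measNuis hGB).integrable (by norm_num)) hmean
    (fun I s => ?_) (fun I s => ?_) fun s => ?_
  · filter_upwards [hGhB I s] with ω hω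
    exact (memLp_phiI hD hG hb₀ hb hW (hGh I s ω) hω).integrable (by norm_num)
  · filter_upwards [hGhB I s] with ω hω
    rw [ENNReal.coe_mul]
    exact bias_phiI_le hD hG hb₀ hb hB hW0 hW (hGh I s ω) hGB hω
  · have herr : ∀ n (j : Fin n) i, IsLittleOP Pr fun I ω =>
        nrm P (armErr (fitted L fold O I s ω) G j aStar a' i) := by
      intro n j i
      fin_cases i
      · exact cη s n j
      · exact cf s n
      · exact cf' s n
    refine ((IsLittleOP.sum (t := Finset.range (Nmax + 1)) fun n _ =>
      IsLittleOP.sum (t := Finset.univ) fun j _ => IsLittleOP.sum (t := Finset.univ) fun i _ =>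
        herr n j i).const_mul C).mono (Eventually.of_forall fun I => ?_)
    filter_upwards [hGhB I s] with ω hω
    exact hC _ hω

lemma UnifBdd.unifBddJ {Gh : RandNuis Ω K 𝒳 𝒱 S} {q : Nuis K 𝒳 𝒱 → Comp K 𝒳 𝒱}
    (h : UnifBdd Pr D P Gh q) : UnifBddJ Pr D P Gh fun g n _ => q g n := by
  obtain ⟨B, hB⟩ := h
  exact ⟨B, fun I s => (hB I s).mono fun ω hω n _ => hω n⟩

end Mediation

end CRT

end

theorem theorem4 {K S : ℕ} {𝒳 𝒱 Ω : Type*}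
    [MeasurableSpace 𝒳] [MeasurableSpace 𝒱] [MeasurableSpace Ω]
    (Pr : Measure Ω) [IsProbabilityMeasure Pr]
    -- the law of a cluster, the design and the true nuisance functions
    (P : Measure (CRT.Obs K 𝒳 𝒱)) [IsProbabilityMeasure P]
    (D : CRT.Design K 𝒱) (hD : CRT.Standing D P)
    (G : CRT.Nuis K 𝒳 𝒱) (hG : CRT.IsNuisOf D P G)
    -- i.i.d. clusters, a random partition into folds, and nuisance estimators fitted out of fold
    (O : ℕ → Ω → CRT.Obs K 𝒳 𝒱) (hO_meas : ∀ i, Measurable (O i))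
    (hO_indep : iIndepFun O Pr) (hO_law : ∀ i, Pr.map (O i) = P)
    (fold : ∀ I : ℕ, Ω → Fin I → Fin S) (hfold_meas : ∀ I, Measurable (fold I))
    (hfold_indep : ∀ I, IndepFun (fold I) (fun ω (i : Fin I) => O i ω) Pr)
    (L : CRT.Learner K 𝒳 𝒱 S)
    (Gh : CRT.RandNuis Ω K 𝒳 𝒱 S) (hGh : Gh = CRT.fitted L fold O)
    -- regularity conditions that do not depend on the functional
    (hw : CRT.WeightBdd D P) (hf : CRT.DensBddBelow D P G) (hvar : CRT.CondVarBdd P G) :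
    -- (i) the functionals `θ₁(a*, a', …, a')`
    (∀ aStar a' : Bool,
      CRT.UnifBddJ Pr D P Gh (CRT.etaAt aStar) →
      CRT.UnifBdd Pr D P Gh (CRT.densAt aStar) →
      CRT.UnifBdd Pr D P Gh (CRT.densAt a') →
      CRT.UnifBddBelow Pr D P Gh (CRT.densAt aStar) →
      CRT.ConsistentJ Pr P G Gh (CRT.etaAt aStar) →
      CRT.Consistent Pr P G Gh (CRT.densAt aStar) →
      CRT.Consistent Pr P G Gh (CRT.densAt a') →
      Integrable (CRT.integrandI D G aStar a') P ∧
        (∀ᵐ o ∂P, ∀ j, Integrable (CRT.etaStarKernel G j aStar a' (CRT.cov o.2))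
          (CRT.ref D o.1)) ∧
        CRT.Expansion Pr P O
          (CRT.thetaHat fold O Gh fun g => CRT.phiI D g aStar a')
          (CRT.thetaI D P G aStar a')
          (fun o => CRT.phiI D G aStar a' o - CRT.thetaI D P G aStar a')
          (fun I ω => CRT.foldAvgE (fold I ω) fun s =>
            CRT.dist2 P (CRT.etaBarAt aStar (Gh I s ω)) (CRT.etaBarAt aStar G) *
              (CRT.dist2 P (CRT.densAt aStar (Gh I s ω)) (CRT.densAt aStar G)
                + CRT.dist2 P (CRT.densAt a' (Gh I s ω)) (CRT.densAt a' G)))) ∧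
    -- (ii) the functionals with the mediators in `J` under control and the others under treatment
    (∀ J : Finset (Fin K),
      CRT.UnifBddJ Pr D P Gh (CRT.etaAt true) →
      CRT.UnifBdd Pr D P Gh (CRT.densAt true) →
      CRT.UnifBddBelow Pr D P Gh (CRT.densAt true) →
      CRT.UnifBdd Pr D P Gh (CRT.subAt (CRT.blockII J) false) →
      CRT.UnifBdd Pr D P Gh (CRT.subAt (CRT.complII J) true) →
      CRT.TrueBdd D P (CRT.subAt (CRT.complII J) true G) →
      CRT.ConsistentJ Pr P G Gh (CRT.etaAt true) →
      CRT.Consistent Pr P G Gh (CRT.densAt true) →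
      CRT.Consistent Pr P G Gh (CRT.subAt (CRT.blockII J) false) →
      CRT.Consistent Pr P G Gh (CRT.subAt (CRT.complII J) true) →
      Integrable (CRT.integrandSplit D G (CRT.splitII J)) P ∧
        (∀ᵐ o ∂P, ∀ j, Integrable
          (CRT.lam1Kernel G j (CRT.splitII J o.1 j) true false true (CRT.cov o.2))
          (CRT.ref D o.1)) ∧
        CRT.Expansion Pr P O
          (CRT.thetaHat fold O Gh fun g => CRT.phiSplit D g (CRT.splitII J))
          (CRT.thetaSplit D P G (CRT.splitII J))
          (fun o =>
            CRT.phiSplit D G (CRT.splitII J) o - CRT.thetaSplit D P G (CRT.splitII J))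
          (fun I ω => CRT.foldAvgE (fold I ω) fun s =>
            CRT.d2 P (CRT.etaAt true (Gh I s ω)) (CRT.etaAt true G) *
              (CRT.dist2 P (CRT.densAt true (Gh I s ω)) (CRT.densAt true G)
                + CRT.dist2 P (CRT.subAt (CRT.complII J) true (Gh I s ω))
                    (CRT.subAt (CRT.complII J) true G)
                + CRT.dist2 P (CRT.subAt (CRT.blockII J) false (Gh I s ω))
                    (CRT.subAt (CRT.blockII J) false G))
            + CRT.dist2 P (CRT.subAt (CRT.complII J) true (Gh I s ω))
                  (CRT.subAt (CRT.complII J) true G) *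
              CRT.dist2 P (CRT.subAt (CRT.blockII J) false (Gh I s ω))
                  (CRT.subAt (CRT.blockII J) false G))) ∧
    -- (iii) the functionals in which, moreover, the `k`-th mediator of the other individuals is
    -- under control
    (∀ (k : Fin K) (J : Finset (Fin K)), k ∉ J →
      CRT.UnifBddJ Pr D P Gh (CRT.etaAt true) →
      CRT.UnifBdd Pr D P Gh (CRT.densAt true) →
      CRT.UnifBddBelow Pr D P Gh (CRT.densAt true) →
      CRT.UnifBddJ Pr D P Gh (CRT.subAtJ (CRT.splitIII k J) false) →
      CRT.UnifBddJ Pr D P Gh (CRT.subAtJ (CRT.complSplit (CRT.splitIII k J)) true) →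
      CRT.TrueBddJ D P (CRT.subAtJ (CRT.complSplit (CRT.splitIII k J)) true G) →
      CRT.ConsistentJ Pr P G Gh (CRT.etaAt true) →
      CRT.Consistent Pr P G Gh (CRT.densAt true) →
      CRT.ConsistentJ Pr P G Gh (CRT.subAtJ (CRT.splitIII k J) false) →
      CRT.ConsistentJ Pr P G Gh (CRT.subAtJ (CRT.complSplit (CRT.splitIII k J)) true) →
      Integrable (CRT.integrandSplit D G (CRT.splitIII k J)) P ∧
        (∀ᵐ o ∂P, ∀ j, Integrable
          (CRT.lam1Kernel G j (CRT.splitIII k J o.1 j) true false true (CRT.cov o.2))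
          (CRT.ref D o.1)) ∧
        CRT.Expansion Pr P O
          (CRT.thetaHat fold O Gh fun g => CRT.phiSplit D g (CRT.splitIII k J))
          (CRT.thetaSplit D P G (CRT.splitIII k J))
          (fun o =>
            CRT.phiSplit D G (CRT.splitIII k J) o - CRT.thetaSplit D P G (CRT.splitIII k J))
          (fun I ω => CRT.foldAvgE (fold I ω) fun s =>
            CRT.d2 P (CRT.etaAt true (Gh I s ω)) (CRT.etaAt true G) *
              (CRT.dist2 P (CRT.densAt true (Gh I s ω)) (CRT.densAt true G)
                + CRT.d2 P (CRT.subAtJ (CRT.complSplit (CRT.splitIII k J)) true (Gh I s ω))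
                    (CRT.subAtJ (CRT.complSplit (CRT.splitIII k J)) true G)
                + CRT.d2 P (CRT.subAtJ (CRT.splitIII k J) false (Gh I s ω))
                    (CRT.subAtJ (CRT.splitIII k J) false G))
            + CRT.d2 P (CRT.subAtJ (CRT.complSplit (CRT.splitIII k J)) true (Gh I s ω))
                  (CRT.subAtJ (CRT.complSplit (CRT.splitIII k J)) true G) *
              CRT.d2 P (CRT.subAtJ (CRT.splitIII k J) false (Gh I s ω))
                  (CRT.subAtJ (CRT.splitIII k J) false G))) := by
  have : Nonempty Ω := nonempty_of_isProbabilityMeasure Pr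
  -- one of the folds serves to transfer bounds from the estimates to the limits
  let s₀ : Fin S := fold 1 (Classical.arbitrary Ω) 0
  subst hGh
  refine ⟨fun aStar a' bη bf bf' lf cη cf cf' => ?_,
    fun J bη bf lf bu bv _ cη cf cu cv => ?_, fun k J _ bη bf lf bu bv _ cη cf cu cv => ?_⟩
  · exact CRT.expansion_arm hD hG hO_meas hO_indep hO_law hfold_meas hfold_indep L s₀ hw hf hvar
      bη bf bf' lf cη cf cf'
  · obtain ⟨h1, h2, h3⟩ := CRT.expansion_split hD hG hO_meas hO_indep hO_law hfold_meas hfold_indep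
      L s₀ hw hf hvar (U := CRT.splitII J) bη bf lf bu.unifBddJ bv.unifBddJ cη cf
      (fun s n _ => cu s n) (fun s n _ => cv s n)
    refine ⟨h1, h2, h3.mono fun I ω => CRT.foldAvgE_mono _ fun s => ?_⟩
    have hu := CRT.d2_const_le_dist2 (P := P)
      (CRT.subAt (CRT.blockII J) false (CRT.fitted L fold O I s ω))
      (CRT.subAt (CRT.blockII J) false G)
    have hv := CRT.d2_const_le_dist2 (P := P)
      (CRT.subAt (CRT.complII J) true (CRT.fitted L fold O I s ω))
      (CRT.subAt (CRT.complII J) true G)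
    exact add_le_add (mul_le_mul_right (add_le_add (add_le_add le_rfl hv) hu) _)
      (mul_le_mul' hv hu)
  · exact CRT.expansion_split hD hG hO_meas hO_indep hO_law hfold_meas hfold_indep L s₀ hw hf hvar
      bη bf lf bu bv cη cf cu cv
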